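/- Let $K$ be a field of arbitrary characteristic. A \emph{finite space} is a homeomorphism class of topologies on finite sets. Let $\mathcal F$ be the $K$-vector space with basis the set of all finite spaces, graded by the number of points ($\mathcal F_n$ is spanned by the spaces with $n$ points). Let $1=\emptyset$ be the empty space and let $\epsilon:\mathcal F\to K$ be the projection onto $\mathcal F_0=K\cdot 1$. Consider on $\mathcal F$ the bilinear extensions of two products of finite spaces: the disjoint union $X.Y$, and the join $X\succ Y$, which is the set $X\sqcup Y$ with open sets the sets $O\sqcup Y$ ($O$ open in $X$) and the open sets of $Y$. Let $\Delta:\mathcal F\to\mathcal F\otimes\mathcal F$ be the linear map with $$\Delta(X)=\sum_{O\subseteq X\text{ open}}(X\setminus O)\otimes O,$$ subsets of $X$ carrying the induced topologies. All structures below are graded and connected: the products and coproducts are homogeneous of degree $0$, the degree $0$ component is $K\cdot 1$, $1$ is the unit and $\epsilon$ is the counit. For a graded space $V=\bigoplus_{n\ge 1}V_n$, let $T(V)$ be the tensor space, graded by the total degree induced by $V$. A $B_\infty$-algebra structure on $V$ is a product on $T(V)$ with unit $1$ that makes it, with the deconcatenation coproduct, a graded connected Hopf algebra; this Hopf algebra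 is the $B_\infty$-enveloping algebra of $V$. For a graded connected coalgebra $C$, put $\mathrm{Prim}(C)=\{x:\Delta(x)=x\otimes 1+1\otimes x\}$ and $\overline C=\mathrm{Ker}\,\epsilon$; for $x\in\overline C$ write $\Delta(x)=x_1\otimes x_2=x\otimes 1+1\otimes x+x'\otimes x''$. \textbf{Theorem.} \begin{enumerate} \item $(\mathcal F,.,\Delta)$ is a commutative Hopf algebra. \item $(\mathcal F,\succ,\Delta)$ is an infinitesimal bialgebra: $\succ$ is associative and unital, $\Delta$ is coassociative and counital, and for all $x,y\in\mathcal F$ $$\Delta(x\succ y)=x\succ y_1\otimes y_2+x_1\otimes x_2\succ y-x\otimes y.$$ \item The Hopf algebra $(\mathcal F,.,\Delta)$ is the $B_\infty$-enveloping algebra of a $B_\infty$-algebra: there are a $B_\infty$-algebra structure on $V=\mathrm{Prim}(\mathcal F)$ and an isomorphism of graded Hopf algebras from the $B_\infty$-enveloping algebra $T(V)$ to $\mathcal F$ that is the identity on $V$. Moreover $\mathcal F$ is cofree as a graded connected coalgebra over $V$: there is a graded linear projection $\pi:\mathcal F\to V$, with $\pi(1)=0$ and $\pi|_V=\mathrm{Id}$,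 such that for every graded connected coalgebra $C$ every graded linear map $f:C\to V$ with $f(1)=0$ is $\pi\circ g$ for a unique morphism $g:C\to\mathcal F$ of graded connected coalgebras. \item (a) $\mathcal F$ carries the structure of a shuffle bialgebra with coproduct $\Delta$: there is a graded product $\sqcup\!\!\sqcup $ making $(\mathcal F,\sqcup\!\!\sqcup ,\Delta)$ a commutative Hopf algebra, and there are graded bilinear half-products $\prec,\succ'$ with $\sqcup\!\!\sqcup =\prec+\succ'$ on $\overline{\mathcal F}$ such that, for $x,y,z\in\overline{\mathcal F}$, $$x\prec y=y\succ' x,\qquad (x\prec y)\prec z=x\prec(y\prec z+y\succ' z),$$ $x\prec 1=x=1\succ' x$, $1\prec x=0=x\succ' 1$, and $$\begin{aligned}\Delta(x\prec y)={}&x\prec y\otimes 1+1\otimes x\prec y+x\otimes y+x\prec y'\otimes y''\\&+x'\prec y\otimes x''+x'\otimes x''\,\sqcup\!\!\sqcup \,y+x'\prec y'\otimes x''\,\sqcup\!\!\sqcup \,y''.\end{aligned}$$ (b) $\mathcal F$ carries the structure of an unshuffle bialgebra with product $\succ$ (the join): there is a graded coassociative cocommutative coproduct $\delta$ making $(\mathcal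 F,\succ,\delta)$ a Hopf algebra, and there are graded linear maps $\delta_\prec,\delta_\succ:\overline{\mathcal F}\to\mathcal F\otimes\mathcal F$ with $\delta=\delta_\prec+\delta_\succ$ on $\overline{\mathcal F}$, such that, with $\tau$ the flip and on $\overline{\mathcal F}$, $$\delta_\prec=\tau\circ\delta_\succ,\quad(\delta_\prec\otimes\mathrm{Id})\circ\delta_\prec=(\mathrm{Id}\otimes\delta)\circ\delta_\prec,\quad(\epsilon\otimes\mathrm{Id})\circ\delta_\prec=0,\quad(\mathrm{Id}\otimes\epsilon)\circ\delta_\prec=\mathrm{Id},$$ and, for $x,y\in\overline{\mathcal F}$, writing $\delta_\prec(x)=x_1^\prec\otimes x_2^\prec$ and $\delta(y)=y_{(1)}\otimes y_{(2)}$, $$\delta_\prec(x\succ y)=x_1^\prec\succ y_{(1)}\otimes x_2^\prec\succ y_{(2)}.$$ \end{enumerate} -/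

import Mathlib

open scoped TensorProduct

universe u v w

/-! ### Finite spaces: homeomorphism classes of finite topological sets -/

/-- A topology on a standard finite set with `n` points. -/
structure FinTopology : Type where
  /-- the number of points -/
  n : ℕ
  /-- the topology -/
  top : TopologicalSpace (Fin n)

namespace FinTopology

/-- The underlying finite topological set. -/
def Pt (T : FinTopology) : Type := Fin T.n

instance (T : FinTopology) : TopologicalSpace T.Pt := T.top

instance (T : FinTopology) : Finite T.Pt := inferInstanceAs (Finite (Fin T.n))

/-- Two topologies on finite sets are identified if they are homeomorphic. -/
instance setoid : Setoid FinTopology where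
  r S T := Nonempty (S.Pt ≃ₜ T.Pt)
  iseqv :=
    ⟨fun T => ⟨Homeomorph.refl T.Pt⟩, fun ⟨f⟩ => ⟨f.symm⟩, fun ⟨f⟩ ⟨g⟩ => ⟨f.trans g⟩⟩

end FinTopology

/-- Finite spaces, that is, homeomorphism classes of topologies on finite sets. -/
def FiniteSpace : Type := Quotient FinTopology.setoid

/-- The join of two topological spaces `X`, `Y`, on the set `X ⊔ Y`: its open sets are the sets
`O ⊔ Y` with `O` open in `X`, and the open sets of `Y` (see `joinTopology_isOpen_iff`). -/
@[reducible] def joinTopology (X Y : Type*) [TopologicalSpace X] [TopologicalSpace Y] :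
    TopologicalSpace (X ⊕ Y) where
  IsOpen U := IsOpen (Sum.inl ⁻¹' U) ∧ IsOpen (Sum.inr ⁻¹' U) ∧
    ((Sum.inl ⁻¹' U).Nonempty → Sum.inr ⁻¹' U = Set.univ)
  isOpen_univ := by simp
  isOpen_inter := by
    rintro U V ⟨h1, h2, h3⟩ ⟨k1, k2, k3⟩
    refine ⟨h1.inter k1, h2.inter k2, ?_⟩
    rintro ⟨x, hx, hx'⟩
    rw [Set.preimage_inter, h3 ⟨x, hx⟩, k3 ⟨x, hx'⟩, Set.univ_inter]
  isOpen_sUnion := by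
    intro S hS
    refine ⟨?_, ?_, ?_⟩
    · rw [Set.preimage_sUnion]
      exact isOpen_biUnion fun U hU => (hS U hU).1
    · rw [Set.preimage_sUnion]
      exact isOpen_biUnion fun U hU => (hS U hU).2.1
    · rintro ⟨x, U, hU, hx⟩
      refine Set.eq_univ_of_forall fun y => ⟨U, hU, ?_⟩
      have h := (hS U hU).2.2 ⟨x, hx⟩
      exact (h ▸ Set.mem_univ y : y ∈ Sum.inr ⁻¹' U)

theorem joinTopology_isOpen_iff (X Y : Type*) [TopologicalSpace X] [TopologicalSpace Y]
    (U : Set (X ⊕ Y)) :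
    @IsOpen _ (joinTopology X Y) U ↔
      (∃ O : Set X, IsOpen O ∧ U = Sum.inl '' O ∪ Set.range Sum.inr) ∨
      (∃ O : Set Y, IsOpen O ∧ U = Sum.inr '' O) := by
  constructor
  · rintro ⟨h1, h2, h3⟩
    by_cases h : (Sum.inl ⁻¹' U).Nonempty
    · left
      refine ⟨Sum.inl ⁻¹' U, h1, ?_⟩
      have h4 := h3 h
      ext (x | y)
      · simp
      · have : y ∈ Sum.inr ⁻¹' U := h4 ▸ Set.mem_univ y
        simpa using this
    · right
      refine ⟨Sum.inr ⁻¹' U, h2, ?_⟩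
      rw [Set.not_nonempty_iff_eq_empty] at h
      ext (x | y)
      · have : x ∉ Sum.inl ⁻¹' U := h ▸ Set.notMem_empty x
        simpa using this
      · simp
  · rintro (⟨O, hO, rfl⟩ | ⟨O, hO, rfl⟩)
    · have e1 : Sum.inl ⁻¹' (Sum.inl '' O ∪ Set.range Sum.inr : Set (X ⊕ Y)) = O := by
        ext x; simp
      have e2 : Sum.inr ⁻¹' (Sum.inl '' O ∪ Set.range Sum.inr : Set (X ⊕ Y)) = Set.univ := by
        ext x; simp
      refine ⟨?_, ?_, fun _ => e2⟩
      · rw [e1]; exact hO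
      · rw [e2]; exact isOpen_univ
    · have e1 : Sum.inl ⁻¹' (Sum.inr '' O : Set (X ⊕ Y)) = ∅ := by
        ext x; simp
      have e2 : Sum.inr ⁻¹' (Sum.inr '' O : Set (X ⊕ Y)) = O := by
        ext x; simp
      refine ⟨?_, ?_, fun h => ?_⟩
      · rw [e1]; exact isOpen_empty
      · rw [e2]; exact hO
      · rw [e1] at h; simp at h

/-- The join as a topological space. -/
def JoinSpace (X Y : Type*) : Type _ := X ⊕ Y

instance (X Y : Type*) [TopologicalSpace X] [TopologicalSpace Y] :
    TopologicalSpace (JoinSpace X Y) := joinTopology X Y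

instance (X Y : Type*) [Finite X] [Finite Y] : Finite (JoinSpace X Y) :=
  inferInstanceAs (Finite (X ⊕ Y))

/-- The join is invariant under homeomorphisms. -/
def JoinSpace.congr {X Y X' Y' : Type*} [TopologicalSpace X] [TopologicalSpace Y]
    [TopologicalSpace X'] [TopologicalSpace Y'] (f : X ≃ₜ X') (g : Y ≃ₜ Y') :
    JoinSpace X Y ≃ₜ JoinSpace X' Y' where
  toEquiv := Equiv.sumCongr f.toEquiv g.toEquiv
  continuous_toFun := by
    refine ⟨fun U hU => ?_⟩
    obtain ⟨h1, h2, h3⟩ := hU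
    refine ⟨h1.preimage f.continuous, h2.preimage g.continuous, ?_⟩
    rintro ⟨x, hx⟩
    have h4 := h3 ⟨f x, hx⟩
    refine Set.eq_univ_of_forall fun y => ?_
    exact (h4 ▸ Set.mem_univ (g y) : g y ∈ Sum.inr ⁻¹' U)
  continuous_invFun := by
    refine ⟨fun U hU => ?_⟩
    obtain ⟨h1, h2, h3⟩ := hU
    refine ⟨h1.preimage f.symm.continuous, h2.preimage g.symm.continuous, ?_⟩
    rintro ⟨x, hx⟩
    have h4 := h3 ⟨f.symm x, hx⟩
    refine Set.eq_univ_of_forall fun y => ?_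
    exact (h4 ▸ Set.mem_univ (g.symm y) : g.symm y ∈ Sum.inr ⁻¹' U)

namespace FiniteSpace

/-- A standard representation, on `{0, …, n - 1}`, of a finite topological set. -/
noncomputable def stdRep (X : Type*) [TopologicalSpace X] [Finite X] : FinTopology where
  n := Nat.card X
  top := TopologicalSpace.induced (Finite.equivFin X).symm inferInstance

/-- A finite topological set is homeomorphic to its standard representation. -/
noncomputable def stdRepHomeo (X : Type*) [TopologicalSpace X] [Finite X] :
    (stdRep X).Pt ≃ₜ X :=
  Equiv.toHomeomorphOfIsInducing (X := (stdRep X).Pt) (Finite.equivFin X).symm ⟨rfl⟩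

/-- The finite space defined by a finite topological set. -/
noncomputable def of (X : Type*) [TopologicalSpace X] [Finite X] : FiniteSpace :=
  Quotient.mk _ (stdRep X)

theorem of_eq_of_iff {X Y : Type*} [TopologicalSpace X] [Finite X] [TopologicalSpace Y]
    [Finite Y] : of X = of Y ↔ Nonempty (X ≃ₜ Y) := by
  constructor
  · intro h
    obtain ⟨f⟩ := Quotient.exact h
    exact ⟨(stdRepHomeo X).symm.trans (f.trans (stdRepHomeo Y))⟩
  · rintro ⟨f⟩
    exact Quotient.sound ⟨(stdRepHomeo X).trans (f.trans (stdRepHomeo Y).symm)⟩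

/-- The number of points of a finite space. -/
def card : FiniteSpace → ℕ :=
  Quotient.lift FinTopology.n fun S T ⟨f⟩ => by
    simpa [FinTopology.Pt] using Nat.card_congr f.toEquiv

/-- The empty finite space. -/
noncomputable def empty : FiniteSpace := of PEmpty.{1}

/-- The sum (disjoint union) of two finite spaces. -/
noncomputable def sum : FiniteSpace → FiniteSpace → FiniteSpace :=
  Quotient.map₂ (fun S T => stdRep (S.Pt ⊕ T.Pt)) fun _ _ ⟨f⟩ _ _ ⟨g⟩ =>
    ⟨(stdRepHomeo _).trans ((f.sumCongr g).trans (stdRepHomeo _).symm)⟩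

/-- The join of two finite spaces. -/
noncomputable def join : FiniteSpace → FiniteSpace → FiniteSpace :=
  Quotient.map₂ (fun S T => stdRep (JoinSpace S.Pt T.Pt)) fun _ _ ⟨f⟩ _ _ ⟨g⟩ =>
    ⟨(stdRepHomeo _).trans ((JoinSpace.congr f g).trans (stdRepHomeo _).symm)⟩

end FiniteSpace

/-! ### The linear span of finite spaces -/

/-- The vector space with basis the set of all finite spaces. -/
abbrev SpanFS (K : Type u) [Field K] : Type u := FiniteSpace →₀ K

namespace SpanFS

variable (K : Type u) [Field K]

/-- The basis vector of a finite space. -/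
noncomputable def single (X : FiniteSpace) : SpanFS K := Finsupp.single X 1

/-- The unit: the empty space. -/
noncomputable def one : SpanFS K := single K FiniteSpace.empty

/-- The degree `n` component, spanned by the finite spaces with `n` points. -/
noncomputable def degree (n : ℕ) : Submodule K (SpanFS K) :=
  Submodule.span K {x | ∃ X : FiniteSpace, X.card = n ∧ x = single K X}

/-- The bilinear extension of the sum of finite spaces. -/
noncomputable def dot : SpanFS K →ₗ[K] SpanFS K →ₗ[K] SpanFS K :=
  Finsupp.linearCombination K fun X =>
    Finsupp.linearCombination K fun Y => single K (X.sum Y)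

/-- The bilinear extension of the join of finite spaces. -/
noncomputable def join : SpanFS K →ₗ[K] SpanFS K →ₗ[K] SpanFS K :=
  Finsupp.linearCombination K fun X =>
    Finsupp.linearCombination K fun Y => single K (X.join Y)

/-- `∑ [X ∖ O] ⊗ [O]`, the sum over the (finitely many) open subsets `O` of a finite topological
set `X`, where the subsets of `X` carry the induced topologies. -/
noncomputable def comulSpace (X : Type*) [TopologicalSpace X] [Finite X] :
    SpanFS K ⊗[K] SpanFS K :=
  ∑ᶠ O : TopologicalSpace.Opens X,
    single K (FiniteSpace.of ↥((O : Set X)ᶜ)) ⊗ₜ[K] single K (FiniteSpace.of ↥(O : Set X))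

theorem comulSpace_congr {X Y : Type*} [TopologicalSpace X] [Finite X] [TopologicalSpace Y]
    [Finite Y] (f : X ≃ₜ Y) : comulSpace K X = comulSpace K Y := by
  unfold comulSpace
  rw [← finsum_comp_equiv f.opensCongr.toEquiv]
  refine finsum_congr fun O => ?_
  have hO : ((f.opensCongr O : TopologicalSpace.Opens Y) : Set Y) = f.symm ⁻¹' (O : Set X) := rfl
  have key : ∀ s : Set X, FiniteSpace.of ↥s = FiniteSpace.of ↥(f.symm ⁻¹' s) := fun s =>
    FiniteSpace.of_eq_of_iff.2 ⟨f.subtype fun x => by simp⟩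
  have h1 := key (O : Set X)
  have h2 := key ((O : Set X)ᶜ)
  rw [h1, h2]
  rfl

/-- The coproduct extracting open subsets. -/
noncomputable def comul : SpanFS K →ₗ[K] SpanFS K ⊗[K] SpanFS K :=
  Finsupp.linearCombination K <|
    Quotient.lift (fun T : FinTopology => comulSpace K T.Pt)
      fun _ _ ⟨f⟩ => comulSpace_congr K f

/-- The counit: the coefficient of the empty space. -/
noncomputable def counit : SpanFS K →ₗ[K] K := Finsupp.lapply FiniteSpace.empty

end SpanFS

/-! ### Graded algebraic structures

A structure on a vector space `A` is given by bare linear data: a grading `𝒜`, a product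
`m : A →ₗ A →ₗ A`, a unit `e : A`, a coproduct `Δ : A →ₗ A ⊗ A`, a counit `ε : A →ₗ K`. -/

section Structures

variable {K : Type u} [Field K] {A : Type v} [AddCommGroup A] [Module K A]

/-- `(A, m, e)` is an associative unital algebra: it is isomorphic to a `K`-algebra. -/
def IsUnitalAlgebra (m : A →ₗ[K] A →ₗ[K] A) (e : A) : Prop :=
  ∃ (B : Type v) (_ : Ring B) (_ : Algebra K B) (φ : A ≃ₗ[K] B),
    φ e = 1 ∧ ∀ x y, φ (m x y) = φ x * φ y

/-- `(A, Δ, ε)` is a coassociative counital coalgebra. -/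
def IsCounitalCoalgebra (Δ : A →ₗ[K] A ⊗[K] A) (ε : A →ₗ[K] K) : Prop :=
  ∃ C : Coalgebra K A, C.comul = Δ ∧ C.counit = ε

/-- `(A, m, e, Δ, ε)` is a Hopf algebra: the data correspond, under a linear isomorphism, to those
of a Hopf algebra over `K`. -/
def IsHopfAlgebra (m : A →ₗ[K] A →ₗ[K] A) (e : A) (Δ : A →ₗ[K] A ⊗[K] A) (ε : A →ₗ[K] K) :
    Prop :=
  ∃ (H : Type v) (_ : Ring H) (_ : HopfAlgebra K H) (φ : A ≃ₗ[K] H),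
    φ e = 1 ∧ (∀ x y, φ (m x y) = φ x * φ y) ∧
    (∀ x, Coalgebra.comul (R := K) (φ x) =
      TensorProduct.map (φ : A →ₗ[K] H) (φ : A →ₗ[K] H) (Δ x)) ∧
    ∀ x, Coalgebra.counit (R := K) (φ x) = ε x

/-- The degree `n` part `⨁_{i + j = n} 𝒜 i ⊗ 𝒜 j` of `A ⊗ A`. -/
def tensorDegree (𝒜 : ℕ → Submodule K A) (n : ℕ) : Submodule K (A ⊗[K] A) :=
  ⨆ (i : ℕ) (j : ℕ) (_ : i + j = n),
    LinearMap.range (TensorProduct.map (𝒜 i).subtype (𝒜 j).subtype)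

/-- `A = ⨁ 𝒜 n` is connected, with degree zero component `K e`, and `ε` is the canonical
projection to that component. -/
structure IsConnectedGraded (𝒜 : ℕ → Submodule K A) (e : A) (ε : A →ₗ[K] K) : Prop where
  internal : DirectSum.IsInternal 𝒜
  degree_zero : 𝒜 0 = Submodule.span K {e}
  counit_one : ε e = 1
  counit_pos : ∀ n, 0 < n → ∀ x ∈ 𝒜 n, ε x = 0

/-- The product is homogeneous of degree zero. -/
def IsGradedMul (𝒜 : ℕ → Submodule K A) (m : A →ₗ[K] A →ₗ[K] A) : Prop :=
  ∀ i j, ∀ x ∈ 𝒜 i, ∀ y ∈ 𝒜 j, m x y ∈ 𝒜 (i + j)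

/-- The coproduct is homogeneous of degree zero. -/
def IsGradedComul (𝒜 : ℕ → Submodule K A) (Δ : A →ₗ[K] A ⊗[K] A) : Prop :=
  ∀ n, ∀ x ∈ 𝒜 n, Δ x ∈ tensorDegree 𝒜 n

/-- Graded connected coalgebras. -/
structure IsGradedCoalgebra (𝒜 : ℕ → Submodule K A) (e : A) (Δ : A →ₗ[K] A ⊗[K] A)
    (ε : A →ₗ[K] K) : Prop where
  connected : IsConnectedGraded 𝒜 e ε
  coalgebra : IsCounitalCoalgebra Δ ε
  graded_comul : IsGradedComul 𝒜 Δ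

/-- Graded connected Hopf algebras. -/
structure IsGradedHopf (𝒜 : ℕ → Submodule K A) (m : A →ₗ[K] A →ₗ[K] A) (e : A)
    (Δ : A →ₗ[K] A ⊗[K] A) (ε : A →ₗ[K] K) : Prop where
  connected : IsConnectedGraded 𝒜 e ε
  hopf : IsHopfAlgebra m e Δ ε
  graded_mul : IsGradedMul 𝒜 m
  graded_comul : IsGradedComul 𝒜 Δ

/-- Infinitesimal bialgebras:
`Δ(x · y) = x · y₁ ⊗ y₂ + x₁ ⊗ x₂ · y - x ⊗ y`. -/
structure IsInfinitesimalBialgebra (𝒜 : ℕ → Submodule K A) (m : A →ₗ[K] A →ₗ[K] A) (e : A)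
    (Δ : A →ₗ[K] A ⊗[K] A) (ε : A →ₗ[K] K) : Prop where
  connected : IsConnectedGraded 𝒜 e ε
  algebra : IsUnitalAlgebra m e
  coalgebra : IsCounitalCoalgebra Δ ε
  graded_mul : IsGradedMul 𝒜 m
  graded_comul : IsGradedComul 𝒜 Δ
  compat : ∀ x y, Δ (m x y) =
    (m x).rTensor A (Δ y) + (m.flip y).lTensor A (Δ x) - x ⊗ₜ[K] y

/-- For bilinear `f`, `g`: the linear map `(x₁ ⊗ x₂) ⊗ (y₁ ⊗ y₂) ↦ f x₁ y₁ ⊗ g x₂ y₂`. -/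
noncomputable def tensorOp (f g : A →ₗ[K] A →ₗ[K] A) :
    (A ⊗[K] A) ⊗[K] (A ⊗[K] A) →ₗ[K] A ⊗[K] A :=
  TensorProduct.map (TensorProduct.lift f) (TensorProduct.lift g) ∘ₗ
    (TensorProduct.tensorTensorTensorComm K A A A A).toLinearMap

/-- The reduced coproduct `x' ⊗ x'' = Δ x - x ⊗ 1 - 1 ⊗ x` (used on the kernel of the counit). -/
def reducedComul (e : A) (Δ : A →ₗ[K] A ⊗[K] A) (x : A) : A ⊗[K] A :=
  Δ x - x ⊗ₜ[K] e - e ⊗ₜ[K] x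

/-- Shuffle bialgebras: commutative graded connected Hopf algebras with product `m = ≺ + ≻` on the
kernel of the counit, where `≺ = prec` and `≻ = succ` satisfy the (commutative) half-shuffle
identities and `≺` the compatibility with the coproduct. The half-products are extended to the
unit by `x ≺ 1 = x = 1 ≻ x` and `1 ≺ x = 0 = x ≻ 1` for `x` in the kernel of the counit; the
values of `1 ≺ 1` and `1 ≻ 1` play no role. -/
structure IsShuffleBialgebra (𝒜 : ℕ → Submodule K A) (m prec succ : A →ₗ[K] A →ₗ[K] A) (e : A)
    (Δ : A →ₗ[K] A ⊗[K] A) (ε : A →ₗ[K] K) : Prop where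
  hopf : IsGradedHopf 𝒜 m e Δ ε
  comm : ∀ x y, m x y = m y x
  graded_prec : ∀ i j, 0 < i → 0 < j → ∀ x ∈ 𝒜 i, ∀ y ∈ 𝒜 j, prec x y ∈ 𝒜 (i + j)
  graded_succ : ∀ i j, 0 < i → 0 < j → ∀ x ∈ 𝒜 i, ∀ y ∈ 𝒜 j, succ x y ∈ 𝒜 (i + j)
  split : ∀ x y, ε x = 0 → ε y = 0 → m x y = prec x y + succ x y
  prec_one : ∀ x, ε x = 0 → prec x e = x
  one_prec : ∀ x, ε x = 0 → prec e x = 0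
  one_succ : ∀ x, ε x = 0 → succ e x = x
  succ_one : ∀ x, ε x = 0 → succ x e = 0
  prec_eq_succ : ∀ x y, ε x = 0 → ε y = 0 → prec x y = succ y x
  prec_prec : ∀ x y z, ε x = 0 → ε y = 0 → ε z = 0 →
    prec (prec x y) z = prec x (prec y z + succ y z)
  comul_prec : ∀ x y, ε x = 0 → ε y = 0 →
    Δ (prec x y) =
      prec x y ⊗ₜ[K] e + e ⊗ₜ[K] prec x y + x ⊗ₜ[K] y
      + (prec x).rTensor A (reducedComul e Δ y)
      + (prec.flip y).rTensor A (reducedComul e Δ x)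
      + (m.flip y).lTensor A (reducedComul e Δ x)
      + tensorOp prec m (reducedComul e Δ x ⊗ₜ[K] reducedComul e Δ y)

/-- Unshuffle bialgebras: graded connected bialgebras (hence Hopf algebras) with a cocommutative
coproduct that splits as `δ = δ≺ + δ≻` on the kernel of the counit, where `δ≺ = dprec` and
`δ≻ = dsucc` satisfy the half-unshuffle identities and `δ≺(x · y) = x₁≺ · y₁ ⊗ x₂≺ · y₂`. Only
the values of `δ≺` and `δ≻` on the kernel of the counit play a role. -/
structure IsUnshuffleBialgebra (𝒜 : ℕ → Submodule K A) (m : A →ₗ[K] A →ₗ[K] A) (e : A)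
    (δ dprec dsucc : A →ₗ[K] A ⊗[K] A) (ε : A →ₗ[K] K) : Prop where
  hopf : IsGradedHopf 𝒜 m e δ ε
  cocomm : ∀ x, TensorProduct.comm K A A (δ x) = δ x
  graded_dprec : ∀ n, 0 < n → ∀ x ∈ 𝒜 n, dprec x ∈ tensorDegree 𝒜 n
  graded_dsucc : ∀ n, 0 < n → ∀ x ∈ 𝒜 n, dsucc x ∈ tensorDegree 𝒜 n
  split : ∀ x, ε x = 0 → δ x = dprec x + dsucc x
  dprec_eq : ∀ x, ε x = 0 → dprec x = TensorProduct.comm K A A (dsucc x)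
  dprec_dprec : ∀ x, ε x = 0 →
    TensorProduct.assoc K A A A (dprec.rTensor A (dprec x)) = δ.lTensor A (dprec x)
  counit_left : ∀ x, ε x = 0 → TensorProduct.lid K A (ε.rTensor A (dprec x)) = 0
  counit_right : ∀ x, ε x = 0 → TensorProduct.rid K A (ε.lTensor A (dprec x)) = x
  dprec_mul : ∀ x y, ε x = 0 → ε y = 0 →
    dprec (m x y) = tensorOp m m (dprec x ⊗ₜ[K] δ y)

/-- The space of primitive elements. -/
def primitives (e : A) (Δ : A →ₗ[K] A ⊗[K] A) : Submodule K A where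
  carrier := {x | Δ x = x ⊗ₜ[K] e + e ⊗ₜ[K] x}
  zero_mem' := by simp
  add_mem' := by
    intro x y hx hy
    simp only [Set.mem_ofPred_eq] at hx hy ⊢
    rw [map_add, hx, hy, TensorProduct.add_tmul, TensorProduct.tmul_add]
    abel
  smul_mem' := by
    intro c x hx
    simp only [Set.mem_ofPred_eq] at hx ⊢
    rw [map_smul, hx, smul_add, TensorProduct.smul_tmul', TensorProduct.tmul_smul]

/-- The grading of the space of primitive elements. -/
def primitivesDegree (𝒜 : ℕ → Submodule K A) (e : A) (Δ : A →ₗ[K] A ⊗[K] A) (n : ℕ) :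
    Submodule K (primitives e Δ) :=
  (𝒜 n).comap (primitives e Δ).subtype

/-- Morphisms of graded connected coalgebras. -/
structure IsGradedCoalgHom {C : Type w} [AddCommGroup C] [Module K C]
    (𝒞 : ℕ → Submodule K C) (eC : C) (ΔC : C →ₗ[K] C ⊗[K] C) (εC : C →ₗ[K] K)
    (𝒜 : ℕ → Submodule K A) (e : A) (Δ : A →ₗ[K] A ⊗[K] A) (ε : A →ₗ[K] K)
    (g : C →ₗ[K] A) : Prop where
  map_degree : ∀ n, ∀ x ∈ 𝒞 n, g x ∈ 𝒜 n
  map_one : g eC = e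
  map_comul : ∀ x, Δ (g x) = TensorProduct.map g g (ΔC x)
  map_counit : ∀ x, ε (g x) = εC x

/-- The graded connected coalgebra `A` is cofree (among graded connected coalgebras) over the
space of its primitive elements: there is a graded projection `π` from `A` to the space of
primitive elements, vanishing on the unit, through which every morphism of graded vector spaces
from (the positive part of) a graded connected coalgebra `C` to the space of primitive elements
lifts uniquely to a morphism of graded connected coalgebras from `C` to `A`. -/
def IsCofree (𝒜 : ℕ → Submodule K A) (e : A) (Δ : A →ₗ[K] A ⊗[K] A) (ε : A →ₗ[K] K) : Prop :=
  IsGradedCoalgebra 𝒜 e Δ ε ∧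
  ∃ π : A →ₗ[K] primitives e Δ,
    (∀ x : primitives e Δ, π x = x) ∧ π e = 0 ∧
    (∀ n, ∀ x ∈ 𝒜 n, π x ∈ primitivesDegree 𝒜 e Δ n) ∧
    ∀ (C : Type w) [AddCommGroup C] [Module K C] (𝒞 : ℕ → Submodule K C) (eC : C)
      (ΔC : C →ₗ[K] C ⊗[K] C) (εC : C →ₗ[K] K), IsGradedCoalgebra 𝒞 eC ΔC εC →
      ∀ f : C →ₗ[K] primitives e Δ, f eC = 0 →
        (∀ n, ∀ x ∈ 𝒞 n, f x ∈ primitivesDegree 𝒜 e Δ n) →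
        ∃! g : C →ₗ[K] A, IsGradedCoalgHom 𝒞 eC ΔC εC 𝒜 e Δ ε g ∧ π ∘ₗ g = f

end Structures

/-! ### The tensor coalgebra and `B_∞`-algebras -/

section TensorCoalgebra

variable {K : Type u} [Field K] {V : Type v} [AddCommGroup V] [Module K V]

/-- The word `v₁ ⋯ v_k` in the tensor space. -/
def tensorWord (l : List V) : TensorAlgebra K V := (l.map (TensorAlgebra.ι K)).prod

/-- The operator `(x, t) ↦ (v x, 1 ⊗ v x + (v ⊗ 1) t)`. -/
noncomputable def deconcatStep : V →ₗ[K]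
    Module.End K (TensorAlgebra K V × (TensorAlgebra K V ⊗[K] TensorAlgebra K V)) :=
  LinearMap.mk₂ K
    (fun v p => (TensorAlgebra.ι K v * p.1,
      1 ⊗ₜ[K] (TensorAlgebra.ι K v * p.1) +
        (LinearMap.mulLeft K (TensorAlgebra.ι K v)).rTensor (TensorAlgebra K V) p.2))
    (by
      intro v v' p
      ext1
      · simp [add_mul]
      · have : LinearMap.mulLeft K (TensorAlgebra.ι K v + TensorAlgebra.ι K v') =
            LinearMap.mulLeft K (TensorAlgebra.ι K v) +
              LinearMap.mulLeft K (TensorAlgebra.ι K v') := by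
          ext x; simp [add_mul]
        simp only [map_add, add_mul, TensorProduct.tmul_add, this, LinearMap.rTensor_add,
          LinearMap.add_apply, Prod.mk_add_mk]
        abel)
    (by
      intro c v p
      ext1
      · simp
      · have : LinearMap.mulLeft K (c • TensorAlgebra.ι K v) =
            c • LinearMap.mulLeft K (TensorAlgebra.ι K v) := by
          ext x; simp
        simp only [map_smul, smul_mul_assoc, TensorProduct.tmul_smul, this,
          LinearMap.rTensor_smul, LinearMap.smul_apply, Prod.smul_mk, smul_add])
    (by
      intro v p q
      ext1
      · simp [mul_add]
      · simp only [Prod.fst_add, Prod.snd_add, mul_add, TensorProduct.tmul_add, map_add,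
          Prod.mk_add_mk]
        abel)
    (by
      intro c v p
      ext1
      · simp
      · simp)

/-- The deconcatenation coproduct on the tensor space, characterized by
`deconcat_tensorWord` below. -/
noncomputable def deconcat :
    TensorAlgebra K V →ₗ[K] TensorAlgebra K V ⊗[K] TensorAlgebra K V :=
  LinearMap.snd K (TensorAlgebra K V) (TensorAlgebra K V ⊗[K] TensorAlgebra K V) ∘ₗ
    LinearMap.applyₗ ((1 : TensorAlgebra K V),
      (1 : TensorAlgebra K V) ⊗ₜ[K] (1 : TensorAlgebra K V)) ∘ₗ
    (TensorAlgebra.lift K (deconcatStep (K := K) (V := V))).toLinearMap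

theorem deconcat_tensorWord (l : List V) :
    deconcat (tensorWord l : TensorAlgebra K V) =
      ∑ i ∈ Finset.range (l.length + 1),
        (tensorWord (l.take i) : TensorAlgebra K V) ⊗ₜ[K] tensorWord (l.drop i) := by
  have key : ∀ l : List V,
      TensorAlgebra.lift K deconcatStep (tensorWord l : TensorAlgebra K V) (1, 1 ⊗ₜ[K] 1) =
        ((tensorWord l : TensorAlgebra K V), ∑ i ∈ Finset.range (l.length + 1),
        (tensorWord (l.take i) : TensorAlgebra K V) ⊗ₜ[K] tensorWord (l.drop i)) := by
    intro l
    induction l with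
    | nil => simp [tensorWord]
    | cons v l ih =>
      have hw : ∀ l : List V, (tensorWord (v :: l) : TensorAlgebra K V) =
          TensorAlgebra.ι K v * tensorWord l := fun l => by simp [tensorWord]
      rw [hw, map_mul, Module.End.mul_apply, ih, TensorAlgebra.lift_ι_apply]
      ext1
      · rfl
      · change 1 ⊗ₜ[K] (TensorAlgebra.ι K v * tensorWord l) +
          LinearMap.rTensor _ (LinearMap.mulLeft K (TensorAlgebra.ι K v))
            (∑ i ∈ Finset.range (l.length + 1),
              (tensorWord (l.take i) : TensorAlgebra K V) ⊗ₜ[K] tensorWord (l.drop i)) =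
          ∑ i ∈ Finset.range ((v :: l).length + 1),
            (tensorWord ((v :: l).take i) : TensorAlgebra K V) ⊗ₜ[K]
              tensorWord ((v :: l).drop i)
        rw [map_sum, List.length_cons, Finset.sum_range_succ' _ (l.length + 1), add_comm]
        simp only [LinearMap.rTensor_tmul, LinearMap.mulLeft_apply, List.take_succ_cons,
          List.drop_succ_cons, List.take_zero, List.drop_zero, hw]
        simp [tensorWord]
  have := congrArg Prod.snd (key l)
  exact this

/-- The degree `n` part of the tensor space, for the grading induced by that of `V`: it is spanned
by the words `v₁ ⋯ v_k` in homogeneous elements whose degrees add up to `n`. -/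
def tensorSpaceDegree (𝒱 : ℕ → Submodule K V) (n : ℕ) : Submodule K (TensorAlgebra K V) :=
  Submodule.span K {x | ∃ (l : List V) (d : List ℕ),
    List.Forall₂ (fun v i => v ∈ 𝒱 i) l d ∧ d.sum = n ∧ x = tensorWord l}

/-- A `B_∞`-algebra structure on the graded vector space `V = ⨁_{n > 0} 𝒱 n`: a product on the
tensor space that makes it, with the deconcatenation coproduct, a (graded connected) Hopf
algebra. The Hopf algebra obtained is the `B_∞`-enveloping algebra of `V`. -/
structure IsBInfinityAlgebra (𝒱 : ℕ → Submodule K V)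
    (m : TensorAlgebra K V →ₗ[K] TensorAlgebra K V →ₗ[K] TensorAlgebra K V) : Prop where
  internal : DirectSum.IsInternal 𝒱
  degree_zero : 𝒱 0 = ⊥
  hopf : IsGradedHopf (tensorSpaceDegree 𝒱) m 1 deconcat
    (TensorAlgebra.algebraMapInv (R := K) (M := V)).toLinearMap

/-- `φ` is an isomorphism of graded Hopf algebras from the `B_∞`-enveloping algebra of the
`B_∞`-algebra `V` (with the product `mV` on the tensor space) to `A`. -/
structure IsBInfinityEnvelopingIso (𝒱 : ℕ → Submodule K V)
    (mV : TensorAlgebra K V →ₗ[K] TensorAlgebra K V →ₗ[K] TensorAlgebra K V)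
    {A : Type w} [AddCommGroup A] [Module K A] (𝒜 : ℕ → Submodule K A)
    (m : A →ₗ[K] A →ₗ[K] A) (e : A) (Δ : A →ₗ[K] A ⊗[K] A) (ε : A →ₗ[K] K)
    (φ : TensorAlgebra K V ≃ₗ[K] A) : Prop where
  map_degree : ∀ n x, x ∈ tensorSpaceDegree 𝒱 n ↔ φ x ∈ 𝒜 n
  map_one : φ 1 = e
  map_mul : ∀ x y, φ (mV x y) = m (φ x) (φ y)
  map_comul : ∀ x, Δ (φ x) =
    TensorProduct.map (φ : TensorAlgebra K V →ₗ[K] A) (φ : TensorAlgebra K V →ₗ[K] A) (deconcat x)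
  map_counit : ∀ x, ε (φ x) = TensorAlgebra.algebraMapInv x

end TensorCoalgebra

/-! ### Homogeneous elements of the tensor square -/

section TensorDegree

variable {K : Type u} [Field K] {A : Type v} [AddCommGroup A] [Module K A]

/-! Finite spaces enter only through three counts of open sets. An open set of X.Y is a pair of open
sets, so Δ is multiplicative for the disjoint union. An open set of X ≻ Y is a pair (U, V) of open
sets with U = ∅ or V = Y; the two cases overlap only in (∅, Y), and inclusion-exclusion gives the
infinitesimal compatibility with its correction term -X ⊗ Y (`comul_join_space`). Coassociativity
counts nested pairs of open sets in two ways.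

The rest holds for every graded connected infinitesimal bialgebra A and rests on convolution. In
Hom(C, B), with C graded connected, 1 - f is invertible as soon as f kills degree zero, by the
geometric series (`isUnit_one_sub_conv`). This provides antipodes, and also the operator π = 1 -
Id⁻¹ (`primProj`), for which x = ε(x)1 + Σ π(x₁)x₂. The compatibility makes π a projection onto
Prim(A), with π(vy) = ε(y)v for v primitive (`primProj_mem`, `primProj_prim_mul`). Iterating the
formula for x writes every element through products of primitives, and A is the free algebra T(Prim
A). As Δ(vy) = (v ⊗ 1)Δ(y) + 1 ⊗ vy is the recursion of deconcatenation, this identifies Δ with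
deconcatenation (`primEquiv`, `comul_primEquiv`). Any graded Hopf product sharing Δ, such as the
disjoint union, is thereby transported to a B_∞-structure on Prim(A).

A coalgebra morphism g to A is the convolution inverse of 1 - π∘g; conversely, if f takes primitive
values and kills degree zero, the inverse of 1 - f is a coalgebra morphism with projection f
(`coalgHom_ext`, `exists_coalgHom`). This is cofreeness. The shuffle product is the coalgebra
morphism A ⊗ A → A with projection π ⊗ ε + ε ⊗ π, and its identities follow from uniqueness. Dually,
the unshuffle coproduct is the algebra morphism with v ↦ v ⊗ 1 + 1 ⊗ v, and its identities are
checked on generators. The half operations fix the side of the first letter: vw ≺ y = v(w ⧢ y) and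
δ≺(vy) = (v ⊗ 1)δ(y). Nothing is ever divided by an integer, so the characteristic is arbitrary. -/

theorem tensorDegree_le_iff {𝒜 : ℕ → Submodule K A} {n : ℕ} {S : Submodule K (A ⊗[K] A)} :
    tensorDegree 𝒜 n ≤ S ↔
      ∀ i j, i + j = n → ∀ x ∈ 𝒜 i, ∀ y ∈ 𝒜 j, x ⊗ₜ[K] y ∈ S := by
  simp only [tensorDegree, iSup_le_iff]
  refine forall_congr' fun i => forall_congr' fun j => forall_congr' fun _ => ?_
  constructor
  · intro h x hx y hy
    exact h ⟨(⟨x, hx⟩ : 𝒜 i) ⊗ₜ[K] (⟨y, hy⟩ : 𝒜 j), rfl⟩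
  · rintro h _ ⟨t, rfl⟩
    induction t with
    | zero => simp
    | tmul x y => exact h x x.2 y y.2
    | add s t hs ht => rw [map_add]; exact S.add_mem hs ht

theorem tmul_mem_tensorDegree {𝒜 : ℕ → Submodule K A} {n i j : ℕ} (hij : i + j = n) {x y : A}
    (hx : x ∈ 𝒜 i) (hy : y ∈ 𝒜 j) : x ⊗ₜ[K] y ∈ tensorDegree 𝒜 n :=
  tensorDegree_le_iff.1 le_rfl i j hij x hx y hy

/-- Linear maps that agree on the tensors `x ⊗ y` of homogeneous elements of total degree `n`
agree in degree `n`. -/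
theorem eqOn_tensorDegree {𝒜 : ℕ → Submodule K A} {n : ℕ} {M : Type*} [AddCommGroup M] [Module K M]
    {f g : A ⊗[K] A →ₗ[K] M}
    (h : ∀ i j, i + j = n → ∀ x ∈ 𝒜 i, ∀ y ∈ 𝒜 j, f (x ⊗ₜ y) = g (x ⊗ₜ y))
    {t : A ⊗[K] A} (ht : t ∈ tensorDegree 𝒜 n) : f t = g t :=
  (tensorDegree_le_iff (S := LinearMap.eqLocus f g)).2 h ht

theorem mapsTo_tensorDegree {𝒜 : ℕ → Submodule K A} {n : ℕ} {M : Type*} [AddCommGroup M]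
    [Module K M] {f : A ⊗[K] A →ₗ[K] M} {S : Submodule K M}
    (h : ∀ i j, i + j = n → ∀ x ∈ 𝒜 i, ∀ y ∈ 𝒜 j, f (x ⊗ₜ y) ∈ S)
    {t : A ⊗[K] A} (ht : t ∈ tensorDegree 𝒜 n) : f t ∈ S :=
  (tensorDegree_le_iff (S := S.comap f)).2 h ht

end TensorDegree

/-! ### Convolution inverses over a graded connected coalgebra -/

section Convolution

open WithConv LinearMap

variable {K : Type u} [Field K] {C : Type v} [AddCommGroup C] [Module K C] [Coalgebra K C]
  {B : Type w} [Ring B] [Algebra K B] {𝒞 : ℕ → Submodule K C}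

/-- The coproduct of an element of degree n only involves degrees at most n. This allows an infinite
convolution series to be replaced by a partial sum in each degree. -/
theorem convMul_apply_congr (hΔ : IsGradedComul 𝒞 (Coalgebra.comul (R := K)))
    (f : WithConv (C →ₗ[K] B)) {g g' : WithConv (C →ₗ[K] B)} {n : ℕ}
    (h : ∀ j ≤ n, ∀ x ∈ 𝒞 j, g x = g' x) {x : C} (hx : x ∈ 𝒞 n) : (f * g) x = (f * g') x := by
  rw [convMul_apply, convMul_apply]
  refine eqOn_tensorDegree (f := mul' K B ∘ₗ TensorProduct.map f.ofConv g.ofConv)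
    (g := mul' K B ∘ₗ TensorProduct.map f.ofConv g'.ofConv) ?_ (hΔ n x hx)
  intro i j hij a ha b hb
  simp [h j (by omega) b hb]

/-- Each of the k convolution factors must receive a tensor factor of degree at least one, which is
impossible in total degree less than k. -/
theorem convPow_apply_eq_zero (hΔ : IsGradedComul 𝒞 (Coalgebra.comul (R := K)))
    {f : WithConv (C →ₗ[K] B)} (hf : ∀ x ∈ 𝒞 0, f x = 0) :
    ∀ k n, n < k → ∀ x ∈ 𝒞 n, (f ^ k) x = 0
  | 0, n, hn, x, hx => absurd hn (by omega)
  | k + 1, n, hn, x, hx => by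
    rw [pow_succ', convMul_apply]
    refine eqOn_tensorDegree (f := mul' K B ∘ₗ TensorProduct.map f.ofConv (f ^ k).ofConv)
      (g := 0) ?_ (hΔ n x hx)
    intro i j hij a ha b hb
    rcases Nat.eq_zero_or_pos i with rfl | hi
    · simp [hf a ha]
    · simp [convPow_apply_eq_zero hΔ hf k j (by omega) b hb]

/-- A linear map from a graded connected coalgebra to an algebra that vanishes in degree zero is
topologically nilpotent for the convolution. -/
theorem isUnit_one_sub_conv (hC : ⨆ n, 𝒞 n = ⊤)
    (hΔ : IsGradedComul 𝒞 (Coalgebra.comul (R := K)))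
    {f : WithConv (C →ₗ[K] B)} (hf : ∀ x ∈ 𝒞 0, f x = 0) : IsUnit (1 - f) := by
  have hfin : ∀ x : C, (Function.support fun k => (f ^ k) x).Finite := by
    intro x
    have hx : x ∈ ⨆ n, 𝒞 n := hC ▸ Submodule.mem_top
    induction hx using Submodule.iSup_induction' with
    | mem n x hx =>
      refine (Set.finite_Iic n).subset fun k hk => ?_
      by_contra h
      exact hk (convPow_apply_eq_zero hΔ hf k n (by simpa using h) x hx)
    | zero => simp
    | add x y _ _ hx hy =>
      refine (hx.union hy).subset fun k hk => ?_
      by_contra h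
      simp only [Set.mem_union, Function.mem_support, not_or, not_not] at h
      exact hk (by simp [h.1, h.2])
  -- The geometric series Σ fᵏ: it is finite at each element, though with no uniform bound on the
  -- number of terms.
  let g : C →ₗ[K] B :=
    { toFun := fun x => ∑ᶠ k, (f ^ k) x
      map_add' := fun x y => by
        rw [← finsum_add_distrib (hfin x) (hfin y)]; simp
      map_smul' := fun c x => by
        rw [RingHom.id_apply, smul_finsum' _ (hfin x)]; simp }
  have hg : ∀ n, ∀ x ∈ 𝒞 n, g x = (∑ k ∈ Finset.range (n + 1), f ^ k) x := by
    intro n x hx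
    have : (∑ k ∈ Finset.range (n + 1), f ^ k) x = ∑ k ∈ Finset.range (n + 1), (f ^ k) x := by
      simp
    rw [this]
    refine finsum_eq_sum_of_support_subset _ fun k hk => ?_
    by_contra h
    exact hk (convPow_apply_eq_zero hΔ hf k n (by simpa using h) x hx)
  have hgN : ∀ N, ∀ n ≤ N, ∀ x ∈ 𝒞 n, g x = (∑ k ∈ Finset.range (N + 1), f ^ k) x := by
    intro N n hn x hx
    rw [hg n x hx]
    simp only [ofConv_sum, LinearMap.sum_apply]
    refine Finset.sum_subset (Finset.range_mono (by omega)) fun k _ hk => ?_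
    exact convPow_apply_eq_zero hΔ hf k n (by simpa using hk) x hx
  have hext : ∀ {a b : WithConv (C →ₗ[K] B)}, (∀ n, ∀ x ∈ 𝒞 n, a x = b x) → a = b := by
    intro a b h
    ext x
    have hx : x ∈ ⨆ n, 𝒞 n := hC ▸ Submodule.mem_top
    exact (iSup_le (a := LinearMap.eqLocus a.ofConv b.ofConv) fun n x hx => h n x hx) hx
  -- In degree n the series agrees with a polynomial in f, which commutes with f.
  have hcomm : f * toConv g = toConv g * f := by
    refine hext fun n x hx => ?_
    rw [convMul_apply_congr hΔ f (g' := ∑ k ∈ Finset.range (n + 1), f ^ k)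
      (fun j hj x hx => hgN n j hj x hx) hx]
    rw [((Commute.sum_right _ _ _ fun k _ => (Commute.refl f).pow_right k).eq :
      f * ∑ k ∈ Finset.range (n + 1), f ^ k = _)]
    rw [convMul_apply, convMul_apply]
    refine eqOn_tensorDegree (f := mul' K B ∘ₗ TensorProduct.map
      (∑ k ∈ Finset.range (n + 1), f ^ k).ofConv f.ofConv)
      (g := mul' K B ∘ₗ TensorProduct.map g f.ofConv) ?_ (hΔ n x hx)
    intro i j hij a ha b hb
    rw [LinearMap.comp_apply, LinearMap.comp_apply, TensorProduct.map_tmul, TensorProduct.map_tmul,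
      ← hgN n i (by omega) a ha]
  have h1 : (1 - f) * toConv g = 1 := by
    refine hext fun n x hx => ?_
    rw [convMul_apply_congr hΔ (1 - f) (g' := ∑ k ∈ Finset.range (n + 1), f ^ k)
      (fun j hj x hx => hgN n j hj x hx) hx, mul_neg_geom_sum]
    rw [ofConv_sub, LinearMap.sub_apply, convPow_apply_eq_zero hΔ hf (n + 1) n (by omega) x hx,
      sub_zero]
  have h2 : toConv g * (1 - f) = 1 := by
    rw [mul_sub, ← hcomm, mul_one, ← h1, sub_mul, one_mul]
  exact ⟨⟨1 - f, toConv g, h1, h2⟩, rfl⟩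

/-- The convolution inverse of `1 - f` is homogeneous when `f` is. -/
theorem graded_of_one_sub_conv_mul {e : C} (hΔ : IsGradedComul 𝒞 (Coalgebra.comul (R := K)))
    (h0 : 𝒞 0 = Submodule.span K {e}) (hε : ∀ n, 0 < n → ∀ x ∈ 𝒞 n, Coalgebra.counit (R := K) x = 0)
    {ℬ : ℕ → Submodule K B} (hone : (1 : B) ∈ ℬ 0)
    (hmul : ∀ i j, ∀ x ∈ ℬ i, ∀ y ∈ ℬ j, x * y ∈ ℬ (i + j))
    {f g : WithConv (C →ₗ[K] B)} (hf0 : f e = 0) (hf : ∀ n, ∀ x ∈ 𝒞 n, f x ∈ ℬ n)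
    (hg : (1 - f) * g = 1) : ∀ n, ∀ x ∈ 𝒞 n, g x ∈ ℬ n := by
  -- Since f kills degree zero, this fixed point equation determines g in degree n from its values
  -- in degrees less than n, whence the strong induction.
  have hg' : g = 1 + f * g := by rw [sub_mul, one_mul, sub_eq_iff_eq_add] at hg; exact hg
  have hf0' : ∀ x ∈ 𝒞 0, f x = 0 := by
    intro x hx
    rw [h0, Submodule.mem_span_singleton] at hx
    obtain ⟨c, rfl⟩ := hx
    simp [hf0]
  intro n
  induction n using Nat.strong_induction_on with
  | _ n ih =>
    intro x hx
    rw [hg', ofConv_add, LinearMap.add_apply, convOne_apply, convMul_apply]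
    refine (ℬ n).add_mem ?_ ?_
    · rcases Nat.eq_zero_or_pos n with rfl | hn
      · rw [Algebra.algebraMap_eq_smul_one]; exact (ℬ 0).smul_mem _ hone
      · simp [hε n hn x hx]
    · refine mapsTo_tensorDegree (f := mul' K B ∘ₗ TensorProduct.map f.ofConv g.ofConv) ?_
        (hΔ n x hx)
      intro i j hij a ha b hb
      rcases Nat.eq_zero_or_pos i with rfl | hi
      · simp [hf0' a ha]
      · rw [← hij]
        exact hmul i j _ (hf i a ha) _ (ih j (by omega) b hb)

end Convolution

/-! ### Hopf structures on graded connected data -/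

section Hopf

open WithConv LinearMap Coalgebra

variable {K : Type u} [Field K]

theorem IsConnectedGraded.iSup_eq_top {A : Type v} [AddCommGroup A] [Module K A]
    {𝒜 : ℕ → Submodule K A} {e : A} {ε : A →ₗ[K] K} (h : IsConnectedGraded 𝒜 e ε) :
    ⨆ n, 𝒜 n = ⊤ :=
  h.internal.submodule_iSup_eq_top

theorem IsConnectedGraded.eq_smul_of_mem_zero {A : Type v} [AddCommGroup A] [Module K A]
    {𝒜 : ℕ → Submodule K A} {e : A} {ε : A →ₗ[K] K} (h : IsConnectedGraded 𝒜 e ε) {x : A}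
    (hx : x ∈ 𝒜 0) : x = ε x • e := by
  rw [h.degree_zero, Submodule.mem_span_singleton] at hx
  obtain ⟨c, rfl⟩ := hx
  rw [map_smul, h.counit_one, smul_eq_mul, mul_one]

/-- The identity of a graded connected coalgebra with an algebra structure is invertible for the
convolution. -/
theorem isUnit_conv_id {A : Type v} [Ring A] [Algebra K A] [Coalgebra K A]
    {𝒜 : ℕ → Submodule K A} (h : IsConnectedGraded 𝒜 (1 : A) (counit (R := K)))
    (hΔ : IsGradedComul 𝒜 (comul (R := K))) :
    IsUnit (toConv (LinearMap.id : A →ₗ[K] A)) := by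
  -- In degree zero the identity coincides with the convolution unit `algebraMap ∘ counit`, so that
  -- 1 - Id vanishes there and Id = 1 - (1 - Id) is invertible.
  have := isUnit_one_sub_conv h.iSup_eq_top hΔ
    (f := 1 - toConv (LinearMap.id : A →ₗ[K] A)) (by
      intro x hx
      conv_lhs => rw [h.eq_smul_of_mem_zero hx]
      simp [h.counit_one])
  rwa [sub_sub_cancel] at this

/-- A graded connected bialgebra is a Hopf algebra. -/
theorem isHopfAlgebra_of_bialgebra {A : Type v} [Ring A] [Bialgebra K A]
    {𝒜 : ℕ → Submodule K A} (h : IsConnectedGraded 𝒜 (1 : A) (counit (R := K)))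
    (hΔ : IsGradedComul 𝒜 (comul (R := K))) :
    IsHopfAlgebra (LinearMap.mul K A) 1 (comul (R := K)) (counit (R := K)) := by
  obtain ⟨u, hu⟩ := isUnit_conv_id h hΔ
  refine ⟨A, inferInstance,
    { antipode := (↑u⁻¹ : WithConv (A →ₗ[K] A)).ofConv
      mul_antipode_rTensor_comul := ?_
      mul_antipode_lTensor_comul := ?_ }, LinearEquiv.refl K A, rfl, fun _ _ => rfl, ?_,
      fun _ => rfl⟩
  · have := u.inv_mul
    rw [hu] at this
    exact congrArg WithConv.ofConv this
  · have := u.mul_inv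
    rw [hu] at this
    exact congrArg WithConv.ofConv this
  · intro x
    exact (LinearMap.congr_fun (TensorProduct.map_id (R := K) (M := A) (N := A)) _).symm

theorem tensorOp_mul {A : Type v} [Ring A] [Algebra K A] (s t : A ⊗[K] A) :
    tensorOp (LinearMap.mul K A) (LinearMap.mul K A) (s ⊗ₜ t) = s * t := by
  induction s with
  | zero => simp
  | add s s' hs hs' => rw [TensorProduct.add_tmul, map_add, add_mul, hs, hs']
  | tmul a b =>
    induction t with
    | zero => simp
    | add s s' hs hs' => rw [TensorProduct.tmul_add, map_add, mul_add, hs, hs']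
    | tmul c d => exact (Algebra.TensorProduct.tmul_mul_tmul a c b d).symm

section Bare

variable {A : Type v} [AddCommGroup A] [Module K A]

/-- The ring with a given bilinear product. -/
@[reducible] def ringOfMul (m : A →ₗ[K] A →ₗ[K] A) (e : A)
    (h : (∀ x y z, m (m x y) z = m x (m y z)) ∧ (∀ x, m e x = x) ∧ ∀ x, m x e = x) : Ring A :=
  { ‹AddCommGroup A› with
    mul := fun x y => m x y
    one := e
    mul_assoc := h.1
    one_mul := h.2.1
    mul_one := h.2.2
    left_distrib := fun x y z => map_add (m x) y z
    right_distrib := fun x y z => LinearMap.map_add₂ m x y z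
    zero_mul := fun x => LinearMap.map_zero₂ m x
    mul_zero := fun x => map_zero (m x) }

/-- The algebra with a given bilinear product. -/
@[reducible] def algebraOfMul (m : A →ₗ[K] A →ₗ[K] A) (e : A)
    (h : (∀ x y z, m (m x y) z = m x (m y z)) ∧ (∀ x, m e x = x) ∧ ∀ x, m x e = x) :
    @Algebra K A _ (ringOfMul m e h).toSemiring :=
  letI := ringOfMul m e h
  Algebra.ofModule (fun c x y => LinearMap.map_smul₂ m c x y) (fun c x y => map_smul (m x) c y)

theorem isUnitalAlgebra_iff {m : A →ₗ[K] A →ₗ[K] A} {e : A} :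
    IsUnitalAlgebra m e ↔
      (∀ x y z, m (m x y) z = m x (m y z)) ∧ (∀ x, m e x = x) ∧ ∀ x, m x e = x := by
  constructor
  · rintro ⟨B, _, _, φ, h1, hm⟩
    refine ⟨fun x y z => φ.injective ?_, fun x => φ.injective ?_, fun x => φ.injective ?_⟩
    · simp only [hm, mul_assoc]
    · simp only [hm, h1, one_mul]
    · simp only [hm, h1, mul_one]
  · intro h
    exact ⟨A, ringOfMul m e h, algebraOfMul m e h, LinearEquiv.refl K A, rfl, fun _ _ => rfl⟩

theorem tensorOp_tmul (f g : A →ₗ[K] A →ₗ[K] A) (a b c d : A) :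
    tensorOp f g ((a ⊗ₜ b) ⊗ₜ (c ⊗ₜ d)) = f a c ⊗ₜ g b d := rfl

/-- Connectedness supplies the antipode as the convolution inverse of the identity, so only the
bialgebra axioms have to be verified on the bare data. -/
theorem isHopfAlgebra_of_connected {𝒜 : ℕ → Submodule K A} {m : A →ₗ[K] A →ₗ[K] A} {e : A}
    {Δ : A →ₗ[K] A ⊗[K] A} {ε : A →ₗ[K] K} (h : IsConnectedGraded 𝒜 e ε)
    (hm : IsUnitalAlgebra m e) (hC : IsCounitalCoalgebra Δ ε) (hΔ : IsGradedComul 𝒜 Δ)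
    (hΔ1 : Δ e = e ⊗ₜ e) (hΔm : ∀ x y, Δ (m x y) = tensorOp m m (Δ x ⊗ₜ Δ y))
    (hεm : ∀ x y, ε (m x y) = ε x * ε y) : IsHopfAlgebra m e Δ ε := by
  obtain ⟨C, rfl, rfl⟩ := hC
  rw [isUnitalAlgebra_iff] at hm
  let R := ringOfMul m e hm
  let Al := algebraOfMul m e hm
  let C' : @Coalgebra K A _ R.toAddCommGroup.toAddCommMonoid Al.toModule := C
  let _ : Bialgebra K A := Bialgebra.mk' K A h.counit_one (fun {a b} => hεm a b) hΔ1
    (fun {a b} => (hΔm a b).trans (tensorOp_mul (A := A) _ _))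
  exact isHopfAlgebra_of_bialgebra (A := A) (𝒜 := 𝒜) h hΔ

theorem isGradedHopf_of_connected {𝒜 : ℕ → Submodule K A} {m : A →ₗ[K] A →ₗ[K] A} {e : A}
    {Δ : A →ₗ[K] A ⊗[K] A} {ε : A →ₗ[K] K} (h : IsConnectedGraded 𝒜 e ε)
    (hm : IsUnitalAlgebra m e) (hC : IsCounitalCoalgebra Δ ε) (hgm : IsGradedMul 𝒜 m)
    (hΔ : IsGradedComul 𝒜 Δ)
    (hΔ1 : Δ e = e ⊗ₜ e) (hΔm : ∀ x y, Δ (m x y) = tensorOp m m (Δ x ⊗ₜ Δ y))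
    (hεm : ∀ x y, ε (m x y) = ε x * ε y) : IsGradedHopf 𝒜 m e Δ ε :=
  ⟨h, isHopfAlgebra_of_connected h hm hC hΔ hΔ1 hΔm hεm, hgm, hΔ⟩

end Bare

end Hopf

/-! ### Functoriality of convolution rings -/

section ConvolutionFunctoriality

open WithConv LinearMap Coalgebra

variable {K : Type u} [Field K] {C : Type*} [AddCommGroup C] [Module K C] [Coalgebra K C]
  {D : Type*} [AddCommGroup D] [Module K D] [Coalgebra K D]
  {B : Type*} [Ring B] [Algebra K B] {B' : Type*} [Ring B'] [Algebra K B']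

/-- Composition with an algebra morphism, as a morphism of convolution rings. -/
def convPostcomp (h : B →ₐ[K] B') : WithConv (C →ₗ[K] B) →+* WithConv (C →ₗ[K] B') where
  toFun f := toConv (h.toLinearMap ∘ₗ f.ofConv)
  map_one' := by ext x; simp
  map_mul' f g := congrArg toConv (algHom_comp_convMul_distrib h f g)
  map_zero' := by ext x; simp
  map_add' f g := by ext x; simp

/-- Composition with a coalgebra morphism, as a morphism of convolution rings. -/
def convPrecomp (h : C →ₗc[K] D) : WithConv (D →ₗ[K] B) →+* WithConv (C →ₗ[K] B) where
  toFun f := toConv (f.ofConv ∘ₗ h.toLinearMap)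
  map_one' := by ext x; simp
  map_mul' f g := congrArg toConv (convMul_comp_coalgHom_distrib f g h)
  map_zero' := by ext x; simp
  map_add' f g := by ext x; simp

end ConvolutionFunctoriality

/-! ### Infinitesimal bialgebras and the projection onto primitive elements -/

section Infinitesimal

open WithConv LinearMap Coalgebra

variable {K : Type u} [Field K] {A : Type v} [Ring A] [Algebra K A] [Coalgebra K A]
  {𝒜 : ℕ → Submodule K A}

variable (K A) in
/-- The primitive elements of an algebra with a coproduct. -/
abbrev primSub : Submodule K A := primitives (1 : A) (comul (R := K))

theorem mem_primSub {x : A} : x ∈ primSub K A ↔ comul (R := K) x = x ⊗ₜ 1 + 1 ⊗ₜ x := Iff.rfl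

variable (K A) in
/-- The projection onto the primitive elements of an infinitesimal bialgebra: the unit minus the
convolution inverse of the identity. -/
noncomputable def primProj : A →ₗ[K] A :=
  (1 - Ring.inverse (toConv (LinearMap.id : A →ₗ[K] A))).ofConv

variable (K A) in
/-- Compatibility of the product and the coproduct in an infinitesimal bialgebra. -/
abbrev InfCompat (𝒜 : ℕ → Submodule K A) : Prop :=
  IsInfinitesimalBialgebra 𝒜 (LinearMap.mul K A) 1 (comul (R := K)) (counit (R := K))

namespace IsInfinitesimalBialgebra

variable (h : InfCompat K A 𝒜)
include h

theorem comul_mul (x y : A) :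
    comul (R := K) (x * y) =
      (x ⊗ₜ 1) * comul (R := K) y + comul (R := K) x * (1 ⊗ₜ y) - x ⊗ₜ[K] y := by
  refine (h.compat x y).trans ?_
  have h1 : (LinearMap.mul K A x).rTensor A = LinearMap.mulLeft K (x ⊗ₜ[K] (1 : A)) := by
    ext; simp
  have h2 : ((LinearMap.mul K A).flip y).lTensor A = LinearMap.mulRight K ((1 : A) ⊗ₜ[K] y) := by
    ext; simp
  rw [h1, h2]; rfl

/-- The compatibility at x = y = 1 reads Δ(1) = Δ(1) + Δ(1) - 1 ⊗ 1. -/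
theorem comul_one : comul (R := K) (1 : A) = 1 ⊗ₜ 1 := by
  have := h.comul_mul 1 1
  rw [← Algebra.TensorProduct.one_def, one_mul, one_mul, mul_one] at this
  rw [← Algebra.TensorProduct.one_def]
  exact (add_left_cancel (eq_sub_iff_add_eq.1 this)).symm

theorem counit_one : counit (R := K) (1 : A) = 1 := h.connected.counit_one

/-- Applying ε ⊗ ε to the compatibility gives ε(xy) = ε(xy) + ε(xy) - ε(x)ε(y). -/
theorem counit_mul (x y : A) : counit (R := K) (x * y) = counit (R := K) x * counit (R := K) y := by
  have := congrArg ((TensorProduct.lid K K).toLinearMap ∘ₗ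
    TensorProduct.map (counit (R := K)) (counit (R := K))) (h.comul_mul x y)
  have e1 : ∀ t : A ⊗[K] A, ((TensorProduct.lid K K).toLinearMap ∘ₗ
      TensorProduct.map (counit (R := K)) (counit (R := K))) t =
      counit (R := K) (TensorProduct.rid K A ((counit (R := K)).lTensor A t)) := by
    intro t; induction t with
    | zero => simp
    | add s t hs ht => simp only [map_add, hs, ht]
    | tmul a b => simp [mul_comm]
  have e2 : ∀ t : A ⊗[K] A, ((TensorProduct.lid K K).toLinearMap ∘ₗ
      TensorProduct.map (counit (R := K)) (counit (R := K))) t =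
      counit (R := K) (TensorProduct.lid K A ((counit (R := K)).rTensor A t)) := by
    intro t; induction t with
    | zero => simp
    | add s t hs ht => simp only [map_add, hs, ht]
    | tmul a b => simp
  have r1 : ∀ t : A ⊗[K] A, TensorProduct.rid K A ((counit (R := K)).lTensor A ((x ⊗ₜ 1) * t)) =
      x * TensorProduct.rid K A ((counit (R := K)).lTensor A t) := by
    intro t; induction t with
    | zero => simp
    | add s t hs ht => simp only [map_add, mul_add, hs, ht]
    | tmul a b => simp
  have r2 : ∀ t : A ⊗[K] A, TensorProduct.lid K A ((counit (R := K)).rTensor A (t * (1 ⊗ₜ y))) =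
      TensorProduct.lid K A ((counit (R := K)).rTensor A t) * y := by
    intro t; induction t with
    | zero => simp
    | add s t hs ht => simp only [map_add, add_mul, hs, ht]
    | tmul a b => simp
  rw [map_sub, map_add, e1, e1, r1, lTensor_counit_comul, lTensor_counit_comul, e2, r2,
    rTensor_counit_comul] at this
  simp only [TensorProduct.rid_tmul, TensorProduct.lid_tmul, one_smul, LinearMap.comp_apply,
    TensorProduct.map_tmul, LinearEquiv.coe_coe, smul_eq_mul] at this
  linear_combination -this

/-- The counit as an algebra morphism. -/
noncomputable def counitHom : A →ₐ[K] K :=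
  AlgHom.ofLinearMap (counit (R := K)) h.counit_one h.counit_mul

theorem counit_prim {v : A} (hv : v ∈ primSub K A) : counit (R := K) v = 0 := by
  have := congrArg ((TensorProduct.lid K A).toLinearMap ∘ₗ (counit (R := K)).rTensor A) (mem_primSub.1 hv)
  simp only [LinearMap.comp_apply, LinearEquiv.coe_coe, map_add, LinearMap.rTensor_tmul,
    TensorProduct.lid_tmul, rTensor_counit_comul, h.counit_one, one_smul] at this
  have := congrArg (counit (R := K)) (right_eq_add.1 this)
  simpa [h.counit_one] using this

/-- The term v ⊗ y coming from Δ(v)(1 ⊗ y) cancels the correction of the compatibility. What remains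
is the recursion of deconcatenation for a word with first letter v, and almost every later
computation reduces to it. -/
theorem comul_prim_mul {v : A} (hv : v ∈ primSub K A) (y : A) :
    comul (R := K) (v * y) = (v ⊗ₜ 1) * comul (R := K) y + 1 ⊗ₜ (v * y) := by
  rw [h.comul_mul, mem_primSub.1 hv, add_mul, Algebra.TensorProduct.tmul_mul_tmul,
    Algebra.TensorProduct.tmul_mul_tmul]
  simp only [mul_one, one_mul]
  abel

theorem isUnit_id : IsUnit (toConv (LinearMap.id : A →ₗ[K] A)) :=
  isUnit_conv_id h.connected h.graded_comul

theorem one_sub_primProj_mul_id :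
    (1 - toConv (primProj K A)) * toConv (LinearMap.id : A →ₗ[K] A) = 1 := by
  rw [primProj, toConv_ofConv, sub_sub_cancel, Ring.inverse_mul_cancel _ h.isUnit_id]

theorem id_mul_one_sub_primProj :
    toConv (LinearMap.id : A →ₗ[K] A) * (1 - toConv (primProj K A)) = 1 := by
  rw [primProj, toConv_ofConv, sub_sub_cancel, Ring.mul_inverse_cancel _ h.isUnit_id]

theorem primProj_mul_id :
    toConv (primProj K A) * toConv (LinearMap.id : A →ₗ[K] A) = toConv LinearMap.id - 1 := by
  rw [← h.one_sub_primProj_mul_id, sub_mul, one_mul, sub_sub_cancel]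

theorem mul'_primProj (x : A) :
    mul' K A (TensorProduct.map (primProj K A) LinearMap.id (comul (R := K) x)) =
      x - algebraMap K A (counit x) :=
  congrArg (fun f : WithConv (A →ₗ[K] A) => f x) h.primProj_mul_id

theorem primProj_one : primProj K A 1 = 0 := by
  have := h.mul'_primProj 1
  simpa [h.comul_one, h.counit_one] using this

/-- The projection onto the primitive elements vanishes on products. -/
theorem primProj_prim_mul {v : A} (hv : v ∈ primSub K A) (y : A) :
    primProj K A (v * y) = counit (R := K) y • v := by
  -- The identity may be cancelled on the right, so it suffices to compare after convolving with it,
  -- where both sides become y ↦ vy. On the left this is `mul'_primProj` at vy combined with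
  -- `comul_prim_mul`.
  have hE : toConv (primProj K A ∘ₗ mulLeft K v) * toConv (LinearMap.id : A →ₗ[K] A) =
      toConv ((counit (R := K)).smulRight v) * toConv (LinearMap.id : A →ₗ[K] A) := by
    ext y
    rw [convMul_apply, convMul_apply]
    have e1 : ∀ t : A ⊗[K] A, TensorProduct.map (primProj K A ∘ₗ mulLeft K v) LinearMap.id t =
        TensorProduct.map (primProj K A) LinearMap.id ((v ⊗ₜ 1) * t) := by
      intro t; induction t with
      | zero => simp
      | add s t hs ht => simp only [map_add, mul_add, hs, ht]
      | tmul a b => simp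
    have e2 : ∀ t : A ⊗[K] A, mul' K A (TensorProduct.map ((counit (R := K)).smulRight v)
        LinearMap.id t) = v * TensorProduct.lid K A ((counit (R := K)).rTensor A t) := by
      intro t; induction t with
      | zero => simp
      | add s t hs ht => simp only [map_add, mul_add, hs, ht]
      | tmul a b => simp
    rw [e1, e2, eq_sub_of_add_eq (h.comul_prim_mul hv y).symm, map_sub, map_sub, h.mul'_primProj,
      rTensor_counit_comul]
    simp [h.primProj_one, h.counit_mul, h.counit_prim hv]
  exact congrArg (fun f : WithConv (A →ₗ[K] A) => f y) (h.isUnit_id.mul_right_cancel hE)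

theorem primProj_prim {v : A} (hv : v ∈ primSub K A) : primProj K A v = v := by
  simpa [h.counit_one] using h.primProj_prim_mul hv 1

/-- Primitivity of all values of π is the equality Δ∘π = i∘π + j∘π of maps A → A ⊗ A, where i and j
are the two inclusions. It is proved after convolving on the right with j, which is invertible. -/
theorem primProj_mem (x : A) : primProj K A x ∈ primSub K A := by
  set e := primProj K A with he
  let i : A →ₐ[K] A ⊗[K] A := Algebra.TensorProduct.includeLeft
  let j : A →ₐ[K] A ⊗[K] A := Algebra.TensorProduct.includeRight
  set I : WithConv (A →ₗ[K] A) := toConv LinearMap.id with hI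
  -- Since a ⊗ b = i(a)j(b), the coproduct itself is the convolution product i * j.
  have hD : toConv (comul (R := K) (A := A)) = convPostcomp i I * convPostcomp j I := by
    ext x
    rw [convMul_apply]
    change comul x = (mul' K (A ⊗[K] A) ∘ₗ TensorProduct.map i.toLinearMap j.toLinearMap) _
    have : mul' K (A ⊗[K] A) ∘ₗ TensorProduct.map i.toLinearMap j.toLinearMap = LinearMap.id := by
      ext; simp [i, j]
    rw [this]; rfl
  -- The compatibility for the product e(a)b, solved for Δ(e(a))(1 ⊗ b).
  have h1 : toConv (comul (R := K) (A := A) ∘ₗ e) * convPostcomp j I =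
      toConv (comul (R := K) (A := A) ∘ₗ (toConv e * I).ofConv)
        - convPostcomp i (toConv e) * toConv (comul (R := K) (A := A))
        + convPostcomp i (toConv e) * convPostcomp j I := by
    ext x
    have key : ∀ t : A ⊗[K] A, mul' K (A ⊗[K] A)
        (TensorProduct.map (comul (R := K) (A := A) ∘ₗ e) j.toLinearMap t) =
        comul (R := K) (mul' K A (TensorProduct.map e LinearMap.id t))
        - mul' K (A ⊗[K] A) (TensorProduct.map (i.toLinearMap ∘ₗ e) (comul (R := K)) t)
        + mul' K (A ⊗[K] A) (TensorProduct.map (i.toLinearMap ∘ₗ e) j.toLinearMap t) := by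
      intro t; induction t with
      | zero => simp
      | add s t hs ht => simp only [map_add, hs, ht]; abel
      | tmul a b => simp [i, j, h.comul_mul]; abel
    exact key _
  have h2 : toConv (comul (R := K) (A := A) ∘ₗ (toConv e * I).ofConv) =
      convPostcomp i I * convPostcomp j I - 1 := by
    rw [← hD, h.primProj_mul_id]
    ext x
    simp [h.comul_one, Algebra.algebraMap_eq_smul_one, Algebra.TensorProduct.one_def]
  -- With e * Id = Id - 1 under both inclusions, the right side of `h1` becomes (i * j - 1) - (i -
  -- 1) * j + (i∘e) * j, and j - 1 = (j∘e) * j.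
  have h3 : toConv (comul (R := K) (A := A) ∘ₗ e) * convPostcomp j I =
      (convPostcomp i (toConv e) + convPostcomp j (toConv e)) * convPostcomp j I := by
    rw [h1, h2, hD, ← mul_assoc, ← map_mul, add_mul, ← map_mul (convPostcomp j),
      h.primProj_mul_id, map_sub, map_sub, map_one, map_one, sub_mul, one_mul]
    abel
  have h4 := (h.isUnit_id.map (convPostcomp j)).mul_right_cancel h3
  have h5 := congrArg (fun f : WithConv (A →ₗ[K] A ⊗[K] A) => f x) h4
  exact h5

end IsInfinitesimalBialgebra

end Infinitesimal

/-! ### Cofreeness over the primitive elements -/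

section Cofree

open WithConv LinearMap Coalgebra

variable {K : Type u} [Field K]

theorem tensorDegree_zero {A : Type v} [AddCommGroup A] [Module K A] {𝒜 : ℕ → Submodule K A}
    {e : A} (h : 𝒜 0 = Submodule.span K {e}) : tensorDegree 𝒜 0 = Submodule.span K {e ⊗ₜ[K] e} := by
  refine le_antisymm (tensorDegree_le_iff.2 ?_) ?_
  · intro i j hij x hx y hy
    obtain ⟨rfl, rfl⟩ : i = 0 ∧ j = 0 := by omega
    rw [h, Submodule.mem_span_singleton] at hx hy
    obtain ⟨c, rfl⟩ := hx
    obtain ⟨d, rfl⟩ := hy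
    exact Submodule.mem_span_singleton.2 ⟨c * d, by
      rw [TensorProduct.smul_tmul c e, smul_smul, TensorProduct.tmul_smul]⟩
  · refine (Submodule.span_singleton_le_iff_mem _ _).2 ?_
    have he : e ∈ 𝒜 0 := h ▸ Submodule.mem_span_singleton_self e
    exact tmul_mem_tensorDegree (zero_add 0) he he

/-- By degree, Δ(e) is a multiple of e ⊗ e, and the counit axiom forces the coefficient to be 1. -/
theorem IsGradedCoalgebra.comul_unit {A : Type v} [AddCommGroup A] [Module K A]
    {𝒜 : ℕ → Submodule K A} {e : A} {Δ : A →ₗ[K] A ⊗[K] A} {ε : A →ₗ[K] K}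
    (h : IsGradedCoalgebra 𝒜 e Δ ε) : Δ e = e ⊗ₜ e := by
  have he : e ∈ 𝒜 0 := h.connected.degree_zero ▸ Submodule.mem_span_singleton_self e
  have h1 := h.graded_comul 0 e he
  rw [tensorDegree_zero h.connected.degree_zero, Submodule.mem_span_singleton] at h1
  obtain ⟨c, hc⟩ := h1
  obtain ⟨C, rfl, rfl⟩ := h.coalgebra
  have h2 := rTensor_counit_comul (R := K) e
  rw [← hc, map_smul, LinearMap.rTensor_tmul, h.connected.counit_one] at h2
  have h3 := congrArg (counit (R := K) ∘ₗ (TensorProduct.lid K A).toLinearMap) h2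
  have h4 : c = 1 := by simpa [h.connected.counit_one] using h3
  rw [← hc, h4, one_smul]

variable {A : Type v} [Ring A] [Algebra K A] [Coalgebra K A] {𝒜 : ℕ → Submodule K A}

namespace IsInfinitesimalBialgebra

variable (h : InfCompat K A 𝒜)
include h

theorem isGradedCoalgebra : IsGradedCoalgebra 𝒜 (1 : A) (comul (R := K)) (counit (R := K)) :=
  ⟨h.connected, h.coalgebra, h.graded_comul⟩

theorem one_mem : (1 : A) ∈ 𝒜 0 :=
  h.connected.degree_zero ▸ Submodule.mem_span_singleton_self 1

theorem counit_smul_mem {n : ℕ} {x : A} (hx : x ∈ 𝒜 n) :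
    algebraMap K A (counit (R := K) x) ∈ 𝒜 n := by
  rw [Algebra.algebraMap_eq_smul_one]
  rcases Nat.eq_zero_or_pos n with rfl | hn
  · exact Submodule.smul_mem _ _ h.one_mem
  · simp [h.connected.counit_pos n hn x hx]

theorem primProj_graded (n : ℕ) (x : A) (hx : x ∈ 𝒜 n) : primProj K A x ∈ 𝒜 n := by
  have := graded_of_one_sub_conv_mul (f := 1 - toConv (LinearMap.id : A →ₗ[K] A))
    (g := Ring.inverse (toConv (LinearMap.id : A →ₗ[K] A)))
    h.graded_comul h.connected.degree_zero h.connected.counit_pos h.one_mem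
    (fun i j x hx y hy => h.graded_mul i j x hx y hy) (by simp [h.counit_one])
    (fun n x hx => Submodule.sub_mem _ (h.counit_smul_mem hx) hx)
    (by rw [sub_sub_cancel, Ring.mul_inverse_cancel _ h.isUnit_id]) n x hx
  exact Submodule.sub_mem _ (h.counit_smul_mem hx) this

variable {C : Type w} [AddCommGroup C] [Module K C] [Coalgebra K C] {𝒞 : ℕ → Submodule K C}

/-- Precomposition with a coalgebra morphism is a morphism of convolution rings, so (1 - π) * Id = 1
pulls back along g. Hence g is recovered from π∘g as a convolution inverse. -/
theorem one_sub_conv_mul_coalgHom (g : C →ₗc[K] A) :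
    (1 - toConv (primProj K A ∘ₗ g.toLinearMap)) * toConv g.toLinearMap = 1 := by
  have := congrArg (convPrecomp g) h.one_sub_primProj_mul_id
  rwa [map_mul, map_sub, map_one] at this

theorem coalgHom_mul_one_sub_conv (g : C →ₗc[K] A) :
    toConv g.toLinearMap * (1 - toConv (primProj K A ∘ₗ g.toLinearMap)) = 1 := by
  have := congrArg (convPrecomp g) h.id_mul_one_sub_primProj
  rwa [map_mul, map_sub, map_one] at this

/-- Coalgebra morphisms to an infinitesimal bialgebra are determined by their projection to the
primitive elements. -/
theorem coalgHom_ext {g g' : C →ₗc[K] A}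
    (hg : ∀ x, primProj K A (g x) = primProj K A (g' x)) (x : C) : g x = g' x := by
  have e1 : primProj K A ∘ₗ g.toLinearMap = primProj K A ∘ₗ g'.toLinearMap := LinearMap.ext hg
  have e2 := left_inv_eq_right_inv (h.coalgHom_mul_one_sub_conv g)
    (e1 ▸ h.one_sub_conv_mul_coalgHom g')
  exact congrArg (fun f : WithConv (C →ₗ[K] A) => f x) e2

set_option maxHeartbeats 400000 in
-- The morphism is g = (1 - f)⁻¹, that is Σ f(x₁)⋯f(x_k). The equation g = 1 + f * g writes it with
-- a primitive first factor, so `comul_prim_mul` and `primProj_prim_mul` apply.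
theorem exists_coalgHom (hC : ⨆ n, 𝒞 n = ⊤) (hΔ : IsGradedComul 𝒞 (comul (R := K)))
    (f : C →ₗ[K] A) (hf : ∀ x, f x ∈ primSub K A) (hf0 : ∀ x ∈ 𝒞 0, f x = 0) :
    ∃ g : C →ₗc[K] A, (∀ x, primProj K A (g x) = f x) ∧
      (1 - toConv f) * toConv g.toLinearMap = 1 := by
  have hu : IsUnit (1 - toConv f) := isUnit_one_sub_conv hC hΔ hf0
  obtain ⟨g, hg⟩ := hu.exists_right_inv
  obtain ⟨g, rfl⟩ := toConv_surjective g
  have hgl : toConv g * (1 - toConv f) = 1 := by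
    obtain ⟨g', hg'⟩ := hu.exists_left_inv
    rwa [← left_inv_eq_right_inv hg' hg]
  have hg' : toConv g = 1 + toConv f * toConv g := by
    rw [sub_mul, one_mul, sub_eq_iff_eq_add] at hg; exact hg
  have hgx : ∀ x, g x = algebraMap K A (counit x) +
      mul' K A (TensorProduct.map f g (comul (R := K) x)) := fun x =>
    congrArg (fun f : WithConv (C →ₗ[K] A) => f x) hg'
  -- Composition with the algebra morphism ε kills f, so (1 - f) * g = 1 turns into ε∘g = 1.
  have hcounit : ∀ x, counit (R := K) (g x) = counit (R := K) x := by
    intro x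
    have e1 := congrArg (convPostcomp h.counitHom) hg
    have e2 : convPostcomp h.counitHom (toConv f) = 0 := by
      ext x; exact h.counit_prim (hf x)
    rw [map_mul, map_sub, map_one, e2, sub_zero, one_mul] at e1
    exact congrArg (fun f : WithConv (C →ₗ[K] K) => f x) e1
  let i : A →ₐ[K] A ⊗[K] A := Algebra.TensorProduct.includeLeft
  let j : A →ₐ[K] A ⊗[K] A := Algebra.TensorProduct.includeRight
  have hcomul : toConv (comul (R := K) ∘ₗ g) =
      convPostcomp i (toConv g) * convPostcomp j (toConv g) := by
    -- With i and j the two inclusions, Δ∘g solves (1 - i∘f) * Z = j∘g, and i∘g is the inverse of 1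
    -- - i∘f. Therefore Δ∘g = (i∘g) * (j∘g), which is comultiplicativity.
    have e1 : toConv (comul (R := K) ∘ₗ g) =
        convPostcomp i (toConv f) * toConv (comul (R := K) ∘ₗ g) + convPostcomp j (toConv g) := by
      ext x
      have key : ∀ t : C ⊗[K] C, comul (R := K) (mul' K A (TensorProduct.map f g t)) =
          mul' K (A ⊗[K] A) (TensorProduct.map (i.toLinearMap ∘ₗ f) (comul (R := K) ∘ₗ g) t) +
            j (mul' K A (TensorProduct.map f g t)) := by
        intro t; induction t with
        | zero => simp
        | add s t hs ht => simp only [map_add, hs, ht]; abel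
        | tmul a b => simp [i, j, h.comul_prim_mul (hf a)]
      change comul (R := K) (g x) = mul' K (A ⊗[K] A)
        (TensorProduct.map (i.toLinearMap ∘ₗ f) (comul (R := K) ∘ₗ g) (comul (R := K) x)) + j (g x)
      rw [hgx x, map_add, map_add, key, Algebra.algebraMap_eq_smul_one, map_smul, map_smul,
        h.comul_one, map_one, Algebra.TensorProduct.one_def]
      abel
    have e2 : (1 - convPostcomp i (toConv f)) * toConv (comul (R := K) ∘ₗ g) =
        convPostcomp j (toConv g) := by
      rw [sub_mul, one_mul, sub_eq_iff_eq_add']; exact e1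
    have e3 : convPostcomp i (toConv g) * (1 - convPostcomp i (toConv f)) = 1 := by
      have := congrArg (convPostcomp i) hgl
      rwa [map_mul, map_sub, map_one] at this
    rw [← e2, ← mul_assoc, e3, one_mul]
  refine ⟨{ g with
    counit_comp := LinearMap.ext hcounit
    map_comp_comul := ?_ }, ?_, hg⟩
  · ext x
    have key : ∀ t : C ⊗[K] C, mul' K (A ⊗[K] A)
        (TensorProduct.map (i.toLinearMap ∘ₗ g) (j.toLinearMap ∘ₗ g) t) =
        TensorProduct.map g g t := by
      intro t; induction t with
      | zero => simp
      | add s t hs ht => simp only [map_add, hs, ht]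
      | tmul a b => simp [i, j]
    have := congrArg (fun f : WithConv (C →ₗ[K] A ⊗[K] A) => f x) hcomul
    exact ((key _).symm.trans this.symm)
  · intro x
    have key : ∀ t : C ⊗[K] C, primProj K A (mul' K A (TensorProduct.map f g t)) =
        f (TensorProduct.rid K C ((counit (R := K)).lTensor C t)) := by
      intro t; induction t with
      | zero => simp
      | add s t hs ht => simp only [map_add, hs, ht]
      | tmul a b => simp [h.primProj_prim_mul (hf a), hcounit]
    change primProj K A (g x) = f x
    rw [hgx, map_add, key, Algebra.algebraMap_eq_smul_one, map_smul, h.primProj_one,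
      lTensor_counit_comul]
    simp

theorem isCofree : IsCofree.{u, v, w} 𝒜 (1 : A) (comul (R := K)) (counit (R := K)) := by
  refine ⟨h.isGradedCoalgebra, (primProj K A).codRestrict _ h.primProj_mem,
    fun x => Subtype.ext (h.primProj_prim x.2), Subtype.ext h.primProj_one,
    fun n x hx => h.primProj_graded n x hx, ?_⟩
  intro C _ _ 𝒞 eC ΔC εC hC f hf1 hf
  have hΔ1 := hC.comul_unit
  have hconn := hC.connected
  have hΔ := hC.graded_comul
  obtain ⟨inst, rfl, rfl⟩ := hC.coalgebra
  let f' : C →ₗ[K] A := (primSub K A).subtype ∘ₗ f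
  have hf'1 : f' eC = 0 := congrArg Subtype.val hf1
  obtain ⟨g, hg, hg1⟩ := h.exists_coalgHom hconn.iSup_eq_top hΔ f' (fun x => (f x).2) (by
    intro x hx
    rw [hconn.eq_smul_of_mem_zero hx, map_smul, hf'1, smul_zero])
  refine ⟨g.toLinearMap, ⟨⟨?_, ?_, fun x => ?_, fun x => ?_⟩, ?_⟩, ?_⟩
  · exact graded_of_one_sub_conv_mul hΔ hconn.degree_zero hconn.counit_pos h.one_mem
      (fun i j x hx y hy => h.graded_mul i j x hx y hy) hf'1 (fun n x hx => hf n x hx) hg1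
  · have := congrArg (fun f : WithConv (C →ₗ[K] A) => f eC) hg1
    rw [sub_mul, one_mul] at this
    simpa [hΔ1, hf'1, hconn.counit_one] using this
  · exact (LinearMap.congr_fun g.map_comp_comul x).symm
  · exact LinearMap.congr_fun g.counit_comp x
  · exact LinearMap.ext fun x => Subtype.ext (hg x)
  · rintro k ⟨hk, hkf⟩
    let k' : C →ₗc[K] A :=
      { k with
        counit_comp := LinearMap.ext hk.map_counit
        map_comp_comul := LinearMap.ext fun x => (hk.map_comul x).symm }
    refine LinearMap.ext fun x => h.coalgHom_ext (g := k') (g' := g) (fun y => ?_) x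
    rw [hg]
    exact congrArg Subtype.val (LinearMap.congr_fun hkf y)

end IsInfinitesimalBialgebra

end Cofree

/-! ### Recursions on the tensor space -/

section TensorSpace

variable {K : Type u} [Field K] {V : Type v} [AddCommGroup V] [Module K V]

/-- Induction on the length of words, in a form suited to linear maps that are not multiplicative:
agreement is propagated through left multiplication by an arbitrary tensor. -/
theorem tensorAlgebra_linearMap_ext {M : Type*} [AddCommGroup M] [Module K M]
    {f g : TensorAlgebra K V →ₗ[K] M} (h1 : f 1 = g 1)
    (hι : ∀ v w, f w = g w → f (TensorAlgebra.ι K v * w) = g (TensorAlgebra.ι K v * w)) :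
    f = g := by
  have key : ∀ w y : TensorAlgebra K V, f y = g y → f (w * y) = g (w * y) := by
    intro w
    induction w using TensorAlgebra.induction with
    | algebraMap r => intro y hy; simp [← Algebra.smul_def, hy]
    | ι v => exact hι v
    | mul a b ha hb => intro y hy; rw [mul_assoc]; exact ha _ (hb _ hy)
    | add a b ha hb => intro y hy; rw [add_mul, map_add, map_add, ha _ hy, hb _ hy]
  ext w
  simpa using key w 1 h1

theorem deconcat_one : deconcat (1 : TensorAlgebra K V) = 1 ⊗ₜ[K] 1 := by
  simpa [tensorWord] using deconcat_tensorWord (K := K) ([] : List V)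

/-- A word is cut either before its first letter or after it. This is the formula of
`comul_prim_mul`. -/
theorem deconcat_ι_mul (v : V) (w : TensorAlgebra K V) :
    deconcat (TensorAlgebra.ι K v * w) = 1 ⊗ₜ[K] (TensorAlgebra.ι K v * w) +
      (TensorAlgebra.ι K v ⊗ₜ[K] 1) * deconcat w := by
  -- The first component of the pair merely records the word read so far; the second one carries the
  -- coproduct.
  have h1 : ∀ (w : TensorAlgebra K V)
      (p : TensorAlgebra K V × (TensorAlgebra K V ⊗[K] TensorAlgebra K V)),
      (TensorAlgebra.lift K (deconcatStep (K := K) (V := V)) w p).1 = w * p.1 := by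
    intro w
    induction w using TensorAlgebra.induction with
    | algebraMap r => intro p; simp [Algebra.smul_def]
    | ι v => intro p; rw [TensorAlgebra.lift_ι_apply]; rfl
    | mul a b ha hb => intro p; rw [map_mul, Module.End.mul_apply, ha, hb, mul_assoc]
    | add a b ha hb =>
      intro p; rw [map_add, LinearMap.add_apply, Prod.fst_add, ha, hb, add_mul]
  have h2 : deconcat (TensorAlgebra.ι K v * w) = (deconcatStep v
      (TensorAlgebra.lift K (deconcatStep (K := K) (V := V)) w (1, 1 ⊗ₜ[K] 1))).2 := by
    change (TensorAlgebra.lift K (deconcatStep (K := K) (V := V))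
      (TensorAlgebra.ι K v * w) (1, 1 ⊗ₜ[K] 1)).2 = _
    rw [map_mul, Module.End.mul_apply, TensorAlgebra.lift_ι_apply]
  have h3 : (LinearMap.mulLeft K (TensorAlgebra.ι K v)).rTensor (TensorAlgebra K V) =
      LinearMap.mulLeft K (TensorAlgebra.ι K v ⊗ₜ[K] (1 : TensorAlgebra K V)) := by
    ext1; ext1; ext1; simp
  rw [h2]
  change 1 ⊗ₜ[K] (TensorAlgebra.ι K v * (TensorAlgebra.lift K deconcatStep w (1, 1 ⊗ₜ[K] 1)).1) +
    (LinearMap.mulLeft K (TensorAlgebra.ι K v)).rTensor (TensorAlgebra K V) (deconcat w) = _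
  rw [h1, mul_one, h3]
  rfl

variable {𝒱 : ℕ → Submodule K V}

theorem one_mem_tensorSpaceDegree : (1 : TensorAlgebra K V) ∈ tensorSpaceDegree 𝒱 0 :=
  Submodule.subset_span ⟨[], [], List.Forall₂.nil, rfl, by simp [tensorWord]⟩

theorem ι_mem_tensorSpaceDegree {n : ℕ} {v : V} (hv : v ∈ 𝒱 n) :
    TensorAlgebra.ι K v ∈ tensorSpaceDegree 𝒱 n :=
  Submodule.subset_span ⟨[v], [n], by simpa using hv, by simp, by simp [tensorWord]⟩

theorem mul_mem_tensorSpaceDegree (i j : ℕ) (x : TensorAlgebra K V)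
    (hx : x ∈ tensorSpaceDegree 𝒱 i) (y : TensorAlgebra K V) (hy : y ∈ tensorSpaceDegree 𝒱 j) :
    x * y ∈ tensorSpaceDegree 𝒱 (i + j) := by
  have : tensorSpaceDegree 𝒱 i * tensorSpaceDegree 𝒱 j ≤ tensorSpaceDegree 𝒱 (i + j) := by
    rw [tensorSpaceDegree, tensorSpaceDegree, Submodule.span_mul_span, tensorSpaceDegree]
    refine Submodule.span_mono ?_
    rintro _ ⟨_, ⟨l, d, hl, rfl, rfl⟩, _, ⟨l', d', hl', rfl, rfl⟩, rfl⟩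
    exact ⟨l ++ l', d ++ d', List.rel_append hl hl', by simp, by simp [tensorWord]⟩
  exact this (Submodule.mul_mem_mul hx hy)

/-- An algebra morphism from the tensor space is homogeneous if it is so on words of length one. -/
theorem lift_mem_of_mem_tensorSpaceDegree {B : Type*} [Ring B] [Algebra K B]
    {ℬ : ℕ → Submodule K B} (hone : (1 : B) ∈ ℬ 0)
    (hmul : ∀ i j, ∀ x ∈ ℬ i, ∀ y ∈ ℬ j, x * y ∈ ℬ (i + j)) {f : V →ₗ[K] B}
    (hf : ∀ n, ∀ v ∈ 𝒱 n, f v ∈ ℬ n) (n : ℕ) (x : TensorAlgebra K V)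
    (hx : x ∈ tensorSpaceDegree 𝒱 n) : TensorAlgebra.lift K f x ∈ ℬ n := by
  refine (Submodule.span_le (p := (ℬ n).comap (TensorAlgebra.lift K f).toLinearMap)).2 ?_ hx
  rintro _ ⟨l, d, hl, rfl, rfl⟩
  clear hx
  change TensorAlgebra.lift K f (tensorWord l) ∈ ℬ d.sum
  induction hl with
  | nil => simpa [tensorWord] using hone
  | cons hv _ ih =>
    have := hmul _ _ _ (hf _ _ hv) _ ih
    simpa [tensorWord] using this

end TensorSpace

/-! ### Transport of graded Hopf algebras -/

section Transport

variable {K : Type u} [Field K] {A B : Type v} [AddCommGroup A] [Module K A]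
  [AddCommGroup B] [Module K B]

theorem isInternal_comap_equiv {𝒜 : ℕ → Submodule K A} (h : DirectSum.IsInternal 𝒜)
    (φ : B ≃ₗ[K] A) : DirectSum.IsInternal fun n => (𝒜 n).comap φ.toLinearMap := by
  rw [DirectSum.isInternal_submodule_iff_iSupIndep_and_iSup_eq_top] at h ⊢
  have e : (fun n => (𝒜 n).comap φ.toLinearMap) =
      fun n => (Submodule.orderIsoMapComap φ).symm (𝒜 n) := rfl
  refine ⟨?_, ?_⟩
  · rw [e]; exact h.1.map_orderIso (Submodule.orderIsoMapComap φ).symm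
  · have := congrArg (Submodule.orderIsoMapComap φ).symm h.2
    rwa [OrderIso.map_iSup, map_top] at this

/-- Transport of a graded Hopf algebra along a linear isomorphism. -/
theorem IsGradedHopf.of_equiv {𝒜 : ℕ → Submodule K A} {m : A →ₗ[K] A →ₗ[K] A} {e : A}
    {Δ : A →ₗ[K] A ⊗[K] A} {ε : A →ₗ[K] K} (h : IsGradedHopf 𝒜 m e Δ ε) (φ : B ≃ₗ[K] A)
    {ℬ : ℕ → Submodule K B} {m' : B →ₗ[K] B →ₗ[K] B} {e' : B}
    {Δ' : B →ₗ[K] B ⊗[K] B} {ε' : B →ₗ[K] K} (hdeg : ∀ n x, x ∈ ℬ n ↔ φ x ∈ 𝒜 n)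
    (hone : φ e' = e) (hmul : ∀ x y, φ (m' x y) = m (φ x) (φ y))
    (hΔ : ∀ x, Δ (φ x) = TensorProduct.map φ.toLinearMap φ.toLinearMap (Δ' x))
    (hε : ∀ x, ε (φ x) = ε' x) : IsGradedHopf ℬ m' e' Δ' ε' := by
  have hℬ : ℬ = fun n => (𝒜 n).comap φ.toLinearMap := by
    ext n x; exact hdeg n x
  have hsymm : ∀ x, Δ' x = TensorProduct.map φ.symm.toLinearMap φ.symm.toLinearMap (Δ (φ x)) := by
    intro x
    rw [hΔ, ← LinearMap.comp_apply, ← TensorProduct.map_comp]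
    simp
  refine ⟨⟨hℬ ▸ isInternal_comap_equiv h.connected.internal φ, ?_, ?_, ?_⟩, ?_, ?_, ?_⟩
  · ext x
    rw [hdeg, h.connected.degree_zero, Submodule.mem_span_singleton, Submodule.mem_span_singleton]
    refine exists_congr fun c => ?_
    rw [← hone, ← map_smul, φ.injective.eq_iff]
  · rw [← hε, hone, h.connected.counit_one]
  · intro n hn x hx
    rw [← hε]; exact h.connected.counit_pos n hn _ ((hdeg n x).1 hx)
  · obtain ⟨H, _, _, ψ, h1, hm, hc, hcu⟩ := h.hopf
    refine ⟨H, inferInstance, inferInstance, φ.trans ψ, ?_, ?_, ?_, ?_⟩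
    · simp [hone, h1]
    · intro x y; simp [hmul, hm]
    · intro x
      change Coalgebra.comul (ψ (φ x)) = TensorProduct.map (ψ.toLinearMap ∘ₗ φ.toLinearMap)
        (ψ.toLinearMap ∘ₗ φ.toLinearMap) (Δ' x)
      rw [hc, hΔ, TensorProduct.map_comp]; rfl
    · intro x; simp [hcu, hε]
  · intro i j x hx y hy
    rw [hdeg, hmul]
    exact h.graded_mul i j _ ((hdeg i x).1 hx) _ ((hdeg j y).1 hy)
  · intro n x hx
    rw [hsymm]
    refine mapsTo_tensorDegree ?_ (h.graded_comul n _ ((hdeg n x).1 hx))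
    intro i j hij a ha b hb
    refine tmul_mem_tensorDegree hij ?_ ?_
    · rw [hdeg]; simpa using ha
    · rw [hdeg]; simpa using hb

end Transport

/-! ### Freeness over the primitive elements and `B_∞`-structures -/

section Enveloping

open WithConv LinearMap Coalgebra

variable {K : Type u} [Field K] {A : Type v} [Ring A] [Algebra K A] [Coalgebra K A]
  {𝒜 : ℕ → Submodule K A}

variable (K A) in
/-- The words in primitive elements, multiplied in an infinitesimal bialgebra. -/
noncomputable def primLift : TensorAlgebra K (primSub K A) →ₐ[K] A :=
  TensorAlgebra.lift K (primSub K A).subtype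

@[simp] theorem primLift_ι (v : primSub K A) : primLift K A (TensorAlgebra.ι K v) = v := by
  simp [primLift]

namespace IsInfinitesimalBialgebra

variable (h : InfCompat K A 𝒜)
include h

/-- The inverse is ψ = (1 - ι∘π)⁻¹, which spells x as the sum of the words π(x₁)⋯π(x_k). Multiplying
out the letters turns it into (1 - π)⁻¹ = Id. The other composite is the identity because ψ(vy) =
v·ψ(y) for v primitive. -/
theorem exists_primLift_inverse : ∃ ψ : A →ₗ[K] TensorAlgebra K (primSub K A),
    (∀ x, primLift K A (ψ x) = x) ∧ (∀ w, ψ (primLift K A w) = w) ∧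
    ∀ n, ∀ x ∈ 𝒜 n, ψ x ∈ tensorSpaceDegree (primitivesDegree 𝒜 1 (comul (R := K))) n := by
  let p : A →ₗ[K] primSub K A := (primProj K A).codRestrict _ h.primProj_mem
  have hp1 : p 1 = 0 := Subtype.ext h.primProj_one
  let f : WithConv (A →ₗ[K] TensorAlgebra K (primSub K A)) := toConv (TensorAlgebra.ι K ∘ₗ p)
  have hf1 : f 1 = 0 := by
    change TensorAlgebra.ι K (p 1) = 0
    rw [hp1, map_zero]
  obtain ⟨ψ, hψ⟩ := (isUnit_one_sub_conv (f := f) h.connected.iSup_eq_top h.graded_comul (by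
    intro x hx
    rw [h.connected.eq_smul_of_mem_zero hx, map_smul, hf1, smul_zero])).exists_right_inv
  have hψ' : ψ = 1 + f * ψ := by
    rw [sub_mul, one_mul, sub_eq_iff_eq_add] at hψ; exact hψ
  have hψx : ∀ x, ψ x = algebraMap K _ (counit (R := K) x) +
      mul' K _ (TensorProduct.map f.ofConv ψ.ofConv (comul (R := K) x)) := fun x =>
    congrArg (fun f : WithConv (A →ₗ[K] _) => f x) hψ'
  have hψ1 : ψ 1 = 1 := by
    rw [hψx, h.comul_one, TensorProduct.map_tmul, hf1]
    simp [h.counit_one]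
  have hψmul : ∀ (v : primSub K A) (y : A), ψ ((v : A) * y) = TensorAlgebra.ι K v * ψ y := by
    intro v y
    have key : ∀ t : A ⊗[K] A, mul' K _ (TensorProduct.map f.ofConv ψ.ofConv
        (((v : A) ⊗ₜ 1) * t)) = TensorAlgebra.ι K v *
          ψ (TensorProduct.lid K A ((counit (R := K)).rTensor A t)) := by
      intro t; induction t with
      | zero => simp
      | add s t hs ht => simp only [map_add, mul_add, hs, ht]
      | tmul a b =>
        have : p (v * a) = counit (R := K) a • v := Subtype.ext (h.primProj_prim_mul v.2 a)
        simp [f, this]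
    rw [hψx, h.comul_prim_mul v.2, map_add, map_add, key, rTensor_counit_comul,
      TensorProduct.map_tmul, hf1, h.counit_mul, h.counit_prim v.2]
    simp
  have hφψ : convPostcomp (primLift K A) ψ = toConv LinearMap.id := by
    have e1 := congrArg (convPostcomp (primLift K A)) hψ
    have e2 : convPostcomp (primLift K A) f = toConv (primProj K A) := by
      ext x
      change primLift K A (TensorAlgebra.ι K (p x)) = _
      rw [primLift_ι]; rfl
    rw [map_mul, map_sub, map_one, e2] at e1
    exact (left_inv_eq_right_inv h.id_mul_one_sub_primProj e1).symm
  refine ⟨ψ.ofConv, fun x => congrArg (fun f : WithConv (A →ₗ[K] _) => f x) hφψ, fun w => ?_, ?_⟩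
  · have : ψ.ofConv ∘ₗ (primLift K A).toLinearMap = LinearMap.id := by
      refine tensorAlgebra_linearMap_ext ?_ ?_
      · simpa using hψ1
      · intro v w hw
        have hw' : ψ (primLift K A w) = w := hw
        simp [hψmul, hw']
    exact LinearMap.congr_fun this w
  · exact graded_of_one_sub_conv_mul h.graded_comul h.connected.degree_zero h.connected.counit_pos
      one_mem_tensorSpaceDegree mul_mem_tensorSpaceDegree hf1
      (fun n x hx => ι_mem_tensorSpaceDegree (h.primProj_graded n x hx)) hψ

/-- An infinitesimal bialgebra is, as an algebra, free over its primitive elements. -/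
noncomputable def primEquiv : TensorAlgebra K (primSub K A) ≃ₐ[K] A :=
  { primLift K A with
    invFun := h.exists_primLift_inverse.choose
    left_inv := h.exists_primLift_inverse.choose_spec.2.1
    right_inv := h.exists_primLift_inverse.choose_spec.1 }

theorem primEquiv_ι (v : primSub K A) : h.primEquiv (TensorAlgebra.ι K v) = v :=
  primLift_ι v

theorem mem_tensorSpaceDegree_iff (n : ℕ) (x : TensorAlgebra K (primSub K A)) :
    x ∈ tensorSpaceDegree (primitivesDegree 𝒜 1 (comul (R := K))) n ↔ h.primEquiv x ∈ 𝒜 n := by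
  constructor
  · exact lift_mem_of_mem_tensorSpaceDegree h.one_mem
      (fun i j x hx y hy => h.graded_mul i j x hx y hy) (fun n v hv => hv) n x
  · intro hx
    have := h.exists_primLift_inverse.choose_spec.2.2 n _ hx
    rwa [show h.primEquiv x = primLift K A x from rfl,
      h.exists_primLift_inverse.choose_spec.2.1] at this

/-- Both coproducts obey the same recursion on the first letter, by `comul_prim_mul` and
`deconcat_ι_mul`. -/
theorem comul_primEquiv (x : TensorAlgebra K (primSub K A)) :
    comul (R := K) (h.primEquiv x) =
      TensorProduct.map h.primEquiv.toLinearMap h.primEquiv.toLinearMap (deconcat x) := by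
  have : comul (R := K) ∘ₗ h.primEquiv.toLinearMap =
      TensorProduct.map h.primEquiv.toLinearMap h.primEquiv.toLinearMap ∘ₗ deconcat := by
    refine tensorAlgebra_linearMap_ext ?_ ?_
    · simp [h.comul_one, deconcat_one]
    · intro v w hw
      have key : ∀ t : TensorAlgebra K (primSub K A) ⊗[K] TensorAlgebra K (primSub K A),
          TensorProduct.map h.primEquiv.toLinearMap h.primEquiv.toLinearMap
            ((TensorAlgebra.ι K v ⊗ₜ 1) * t) = ((v : A) ⊗ₜ[K] (1 : A)) *
          TensorProduct.map h.primEquiv.toLinearMap h.primEquiv.toLinearMap t := by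
        intro t; induction t with
        | zero => simp
        | add s t hs ht => simp only [map_add, mul_add, hs, ht]
        | tmul a b => simp [h.primEquiv_ι]
      simp only [LinearMap.comp_apply, AlgEquiv.toLinearMap_apply] at hw ⊢
      rw [map_mul, h.primEquiv_ι, h.comul_prim_mul v.2, hw, deconcat_ι_mul, map_add, key, add_comm]
      simp [h.primEquiv_ι]
  exact LinearMap.congr_fun this x

theorem counit_primEquiv (x : TensorAlgebra K (primSub K A)) :
    counit (R := K) (h.primEquiv x) = TensorAlgebra.algebraMapInv x := by
  have : h.counitHom.comp h.primEquiv.toAlgHom = TensorAlgebra.algebraMapInv := by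
    ext v
    have : counit (R := K) (h.primEquiv (TensorAlgebra.ι K v)) = 0 := by
      rw [h.primEquiv_ι, h.counit_prim v.2]
    simpa [TensorAlgebra.algebraMapInv, counitHom] using this
  exact DFunLike.congr_fun this x

/-- Independence is inherited from A, and the primitive elements are spanned by homogeneous ones
because the projection onto them is graded. -/
theorem isInternal_primitivesDegree :
    DirectSum.IsInternal (primitivesDegree 𝒜 (1 : A) (comul (R := K))) := by
  rw [DirectSum.isInternal_submodule_iff_iSupIndep_and_iSup_eq_top]
  have hA := (DirectSum.isInternal_submodule_iff_iSupIndep_and_iSup_eq_top _).1 h.connected.internal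
  constructor
  · refine iSupIndep_def.2 fun i => Submodule.disjoint_def.2 fun x hx hx' => Subtype.ext ?_
    refine Submodule.disjoint_def.1 (iSupIndep_def.1 hA.1 i) x hx ?_
    have := Submodule.mem_map_of_mem (f := (primSub K A).subtype) hx'
    rw [Submodule.map_iSup] at this
    refine SetLike.le_def.1 (iSup_mono fun j => ?_) this
    rw [Submodule.map_iSup]
    exact iSup_mono fun _ => Submodule.map_comap_le _ _
  · let p : A →ₗ[K] primSub K A := (primProj K A).codRestrict _ h.primProj_mem
    have key : ⨆ n, 𝒜 n ≤ (⨆ n, primitivesDegree 𝒜 (1 : A) (comul (R := K)) n).comap p :=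
      iSup_le fun n x hx => Submodule.mem_iSup_of_mem n (h.primProj_graded n x hx)
    refine Submodule.eq_top_iff'.2 fun v => ?_
    have hv : p v = v := Subtype.ext (h.primProj_prim v.2)
    rw [← hv]
    exact key (hA.2 ▸ Submodule.mem_top)

theorem primitivesDegree_zero : primitivesDegree 𝒜 (1 : A) (comul (R := K)) 0 = ⊥ := by
  refine (Submodule.eq_bot_iff _).2 fun v hv => Subtype.ext ?_
  rw [h.connected.eq_smul_of_mem_zero (x := (v : A)) hv, h.counit_prim v.2, zero_smul]
  rfl

end IsInfinitesimalBialgebra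

/-- The infinitesimal product only serves to identify the coalgebra A with the tensor coalgebra. The
product `m`, unrelated to it except through the common coproduct, is then carried over to the tensor
space. -/
theorem IsInfinitesimalBialgebra.exists_bInfinity {A : Type u} [Ring A] [Algebra K A]
    [Coalgebra K A] {𝒜 : ℕ → Submodule K A} (h : InfCompat K A 𝒜) {m : A →ₗ[K] A →ₗ[K] A}
    (hm : IsGradedHopf 𝒜 m 1 (comul (R := K)) (counit (R := K))) :
    ∃ mV, IsBInfinityAlgebra (primitivesDegree 𝒜 (1 : A) (comul (R := K))) mV ∧
      ∃ φ : TensorAlgebra K (primSub K A) ≃ₗ[K] A,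
        IsBInfinityEnvelopingIso (V := primSub K A)
          (primitivesDegree 𝒜 (1 : A) (comul (R := K))) mV 𝒜 m 1 (comul (R := K))
          (counit (R := K)) φ ∧
        ∀ x, φ (TensorAlgebra.ι K x) = x := by
  let φ := h.primEquiv.toLinearEquiv
  let mV : TensorAlgebra K (primSub K A) →ₗ[K] TensorAlgebra K (primSub K A) →ₗ[K]
      TensorAlgebra K (primSub K A) := (m.compl₁₂ φ.toLinearMap φ.toLinearMap).compr₂
        φ.symm.toLinearMap
  have hmul : ∀ x y, φ (mV x y) = m (φ x) (φ y) := fun x y => φ.apply_symm_apply _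
  refine ⟨mV, ⟨h.isInternal_primitivesDegree, h.primitivesDegree_zero, ?_⟩, φ,
    ⟨h.mem_tensorSpaceDegree_iff, map_one h.primEquiv, hmul, h.comul_primEquiv,
      h.counit_primEquiv⟩, h.primEquiv_ι⟩
  exact hm.of_equiv φ h.mem_tensorSpaceDegree_iff (map_one h.primEquiv) hmul h.comul_primEquiv
    h.counit_primEquiv

end Enveloping

/-! ### The unshuffle bialgebra -/

section Unshuffle

open WithConv LinearMap Coalgebra

variable {K : Type u} [Field K] {A : Type v} [Ring A] [Algebra K A]

theorem mul_mem_tensorDegree {𝒜 : ℕ → Submodule K A}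
    (hmul : ∀ i j, ∀ x ∈ 𝒜 i, ∀ y ∈ 𝒜 j, x * y ∈ 𝒜 (i + j)) (m n : ℕ)
    (s : A ⊗[K] A) (hs : s ∈ tensorDegree 𝒜 m) (t : A ⊗[K] A) (ht : t ∈ tensorDegree 𝒜 n) :
    s * t ∈ tensorDegree 𝒜 (m + n) := by
  refine mapsTo_tensorDegree (f := mulRight K t) ?_ hs
  intro i j hij a ha b hb
  refine mapsTo_tensorDegree (f := mulLeft K (a ⊗ₜ[K] b)) ?_ ht
  intro k l hkl c hc d hd
  rw [mulLeft_apply, Algebra.TensorProduct.tmul_mul_tmul]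
  exact tmul_mem_tensorDegree (by omega) (hmul _ _ _ ha _ hc) (hmul _ _ _ hb _ hd)

theorem comm_mem_tensorDegree {𝒜 : ℕ → Submodule K A} (n : ℕ) (t : A ⊗[K] A) (ht : t ∈ tensorDegree 𝒜 n) :
    TensorProduct.comm K A A t ∈ tensorDegree 𝒜 n := by
  refine mapsTo_tensorDegree (f := (TensorProduct.comm K A A).toLinearMap) ?_ ht
  intro i j hij a ha b hb
  exact tmul_mem_tensorDegree (by omega) hb ha

variable [Coalgebra K A] {𝒜 : ℕ → Submodule K A}

namespace IsInfinitesimalBialgebra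

variable (h : InfCompat K A 𝒜)
include h

/-- The kernel of the counit is spanned by the products whose first factor is primitive. -/
theorem eq_of_eq_prim_mul {M : Type*} [AddCommGroup M] [Module K M] {f g : A →ₗ[K] M}
    (hfg : ∀ v ∈ primSub K A, ∀ y, f (v * y) = g (v * y)) {x : A}
    (hx : counit (R := K) x = 0) : f x = g x := by
  have h1 := h.mul'_primProj x
  rw [hx, map_zero, sub_zero] at h1
  have key : f ∘ₗ mul' K A ∘ₗ TensorProduct.map (primProj K A) LinearMap.id =
      g ∘ₗ mul' K A ∘ₗ TensorProduct.map (primProj K A) LinearMap.id := by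
    ext a b
    exact hfg _ (h.primProj_mem a) b
  rw [← h1]
  exact LinearMap.congr_fun key _

/-- A is freely generated by its primitive elements. The axioms of the unshuffle coproduct, being
equalities of algebra morphisms, are thus checked on v ⊗ 1 + 1 ⊗ v. -/
theorem algHom_ext {B : Type*} [Ring B] [Algebra K B] {f g : A →ₐ[K] B}
    (hfg : ∀ v ∈ primSub K A, f v = g v) : f = g := by
  have : f.comp h.primEquiv.toAlgHom = g.comp h.primEquiv.toAlgHom := by
    ext v
    have := hfg v v.2
    simpa [h.primEquiv_ι] using this
  ext x
  simpa using DFunLike.congr_fun this (h.primEquiv.symm x)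

/-- The coproduct for which the product of an infinitesimal bialgebra is that of a free algebra
over primitive elements. -/
noncomputable def unshuffle : A →ₐ[K] A ⊗[K] A :=
  (TensorAlgebra.lift K
    ((Algebra.TensorProduct.includeLeft.toLinearMap : A →ₗ[K] A ⊗[K] A) ∘ₗ (primSub K A).subtype +
      (Algebra.TensorProduct.includeRight.toLinearMap : A →ₗ[K] A ⊗[K] A) ∘ₗ
        (primSub K A).subtype)).comp h.primEquiv.symm.toAlgHom

theorem unshuffle_prim {v : A} (hv : v ∈ primSub K A) :
    h.unshuffle v = v ⊗ₜ 1 + 1 ⊗ₜ v := by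
  have : h.primEquiv.symm v = TensorAlgebra.ι K (⟨v, hv⟩ : primSub K A) := by
    rw [AlgEquiv.symm_apply_eq, h.primEquiv_ι]
  simp [unshuffle, this]

theorem unshuffle_graded (n : ℕ) (x : A) (hx : x ∈ 𝒜 n) :
    h.unshuffle x ∈ tensorDegree 𝒜 n := by
  refine lift_mem_of_mem_tensorSpaceDegree (𝒱 := primitivesDegree 𝒜 1 (comul (R := K)))
    (ℬ := tensorDegree 𝒜) (tmul_mem_tensorDegree (zero_add 0) h.one_mem h.one_mem)
    (mul_mem_tensorDegree fun i j x hx y hy => h.graded_mul i j x hx y hy) ?_ n _ ?_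
  · intro n v hv
    exact Submodule.add_mem _ (tmul_mem_tensorDegree (add_zero n) hv h.one_mem)
      (tmul_mem_tensorDegree (zero_add n) h.one_mem hv)
  · rw [h.mem_tensorSpaceDegree_iff]
    simpa using hx

theorem unshuffle_coassoc (x : A) :
    TensorProduct.assoc K A A A (h.unshuffle.toLinearMap.rTensor A (h.unshuffle x)) =
      h.unshuffle.toLinearMap.lTensor A (h.unshuffle x) := by
  have : ((Algebra.TensorProduct.assoc K K K A A A).toAlgHom.comp
      (Algebra.TensorProduct.map h.unshuffle (AlgHom.id K A))).comp h.unshuffle =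
      (Algebra.TensorProduct.map (AlgHom.id K A) h.unshuffle).comp h.unshuffle := by
    refine h.algHom_ext fun v hv => ?_
    simp [h.unshuffle_prim hv, Algebra.TensorProduct.one_def, TensorProduct.add_tmul,
      TensorProduct.tmul_add, add_assoc]
  exact DFunLike.congr_fun this x

theorem unshuffle_counit_left (x : A) :
    TensorProduct.lid K A ((counit (R := K)).rTensor A (h.unshuffle x)) = x := by
  have : ((Algebra.TensorProduct.lid K A).toAlgHom.comp
      (Algebra.TensorProduct.map h.counitHom (AlgHom.id K A))).comp h.unshuffle =
      AlgHom.id K A := by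
    refine h.algHom_ext fun v hv => ?_
    have e1 : h.counitHom v = 0 := h.counit_prim hv
    simp [h.unshuffle_prim hv, e1]
  exact DFunLike.congr_fun this x

theorem unshuffle_comm (x : A) : TensorProduct.comm K A A (h.unshuffle x) = h.unshuffle x := by
  have : (Algebra.TensorProduct.comm K A A).toAlgHom.comp h.unshuffle = h.unshuffle := by
    refine h.algHom_ext fun v hv => ?_
    simp [h.unshuffle_prim hv, add_comm]
  exact DFunLike.congr_fun this x

theorem unshuffle_counit_right (x : A) :
    TensorProduct.rid K A ((counit (R := K)).lTensor A (h.unshuffle x)) = x := by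
  have : ((Algebra.TensorProduct.rid K K A).toAlgHom.comp
      (Algebra.TensorProduct.map (AlgHom.id K A) h.counitHom)).comp h.unshuffle =
      AlgHom.id K A := by
    refine h.algHom_ext fun v hv => ?_
    have e1 : h.counitHom v = 0 := h.counit_prim hv
    simp [h.unshuffle_prim hv, e1]
  exact DFunLike.congr_fun this x

theorem unshuffle_isGradedHopf : IsGradedHopf 𝒜 (LinearMap.mul K A) 1 h.unshuffle.toLinearMap
    (counit (R := K)) := by
  refine isGradedHopf_of_connected h.connected h.algebra
    ⟨{ comul := h.unshuffle.toLinearMap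
       counit := counit (R := K)
       coassoc := LinearMap.ext h.unshuffle_coassoc
       rTensor_counit_comp_comul := ?_
       lTensor_counit_comp_comul := ?_ }, rfl, rfl⟩ h.graded_mul h.unshuffle_graded
    (map_one h.unshuffle) (fun x y => ?_) h.counit_mul
  · ext x
    apply (TensorProduct.lid K A).injective
    simpa using h.unshuffle_counit_left x
  · ext x
    apply (TensorProduct.rid K A).injective
    simpa using h.unshuffle_counit_right x
  · rw [tensorOp_mul]
    exact map_mul h.unshuffle x y

/-- The left half-unshuffle: the first letter of a word goes to the left. -/
noncomputable def halfUnshuffle : A →ₗ[K] A ⊗[K] A :=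
  mul' K (A ⊗[K] A) ∘ₗ TensorProduct.map
    ((Algebra.TensorProduct.includeLeft.toLinearMap : A →ₗ[K] A ⊗[K] A) ∘ₗ primProj K A)
    h.unshuffle.toLinearMap ∘ₗ comul (R := K)

theorem halfUnshuffle_prim_mul {v : A} (hv : v ∈ primSub K A) (y : A) :
    h.halfUnshuffle (v * y) = (v ⊗ₜ 1) * h.unshuffle y := by
  have key : ∀ t : A ⊗[K] A, mul' K (A ⊗[K] A) (TensorProduct.map
      ((Algebra.TensorProduct.includeLeft.toLinearMap : A →ₗ[K] A ⊗[K] A) ∘ₗ primProj K A)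
      h.unshuffle.toLinearMap ((v ⊗ₜ 1) * t)) = (v ⊗ₜ 1) * h.unshuffle
        (TensorProduct.lid K A ((counit (R := K)).rTensor A t)) := by
    intro t; induction t with
    | zero => simp
    | add s t hs ht => simp only [map_add, mul_add, hs, ht]
    | tmul a b =>
      simp only [TensorProduct.map_tmul, Algebra.TensorProduct.tmul_mul_tmul, one_mul,
        LinearMap.comp_apply, h.primProj_prim_mul hv, map_smul, mul'_apply,
        LinearMap.rTensor_tmul, TensorProduct.lid_tmul, smul_mul_assoc, mul_smul_comm,
        AlgHom.toLinearMap_apply, Algebra.TensorProduct.includeLeft_apply]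
  rw [halfUnshuffle, LinearMap.comp_apply, LinearMap.comp_apply, h.comul_prim_mul hv, map_add,
    map_add, key, rTensor_counit_comul]
  simp [h.primProj_one]

theorem halfUnshuffle_graded (n : ℕ) (x : A) (hx : x ∈ 𝒜 n) :
    h.halfUnshuffle x ∈ tensorDegree 𝒜 n := by
  refine mapsTo_tensorDegree (f := mul' K (A ⊗[K] A) ∘ₗ TensorProduct.map _ _) ?_
    (h.graded_comul n x hx)
  rintro i j rfl a ha b hb
  exact mul_mem_tensorDegree (fun i j x hx y hy => h.graded_mul i j x hx y hy) i j _
    (tmul_mem_tensorDegree (add_zero i) (h.primProj_graded i a ha) h.one_mem) _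
    (h.unshuffle_graded j b hb)

theorem exists_unshuffleBialgebra : ∃ δ dprec dsucc,
    IsUnshuffleBialgebra 𝒜 (LinearMap.mul K A) 1 δ dprec dsucc (counit (R := K)) := by
  refine ⟨h.unshuffle.toLinearMap, h.halfUnshuffle,
    (TensorProduct.comm K A A).toLinearMap ∘ₗ h.halfUnshuffle, h.unshuffle_isGradedHopf,
    h.unshuffle_comm, fun n _ => h.halfUnshuffle_graded n,
    fun n _ x hx => comm_mem_tensorDegree n _ (h.halfUnshuffle_graded n x hx), ?_, ?_, ?_, ?_, ?_,
    ?_⟩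
  · intro x hx
    refine h.eq_of_eq_prim_mul (g := h.halfUnshuffle +
      (TensorProduct.comm K A A).toLinearMap ∘ₗ h.halfUnshuffle) (fun v hv y => ?_) hx
    -- By cocommutativity the flip only moves v to the right factor, so the two halves add up to (v
    -- ⊗ 1 + 1 ⊗ v)δ(y) = δ(vy).
    have e1 : TensorProduct.comm K A A ((v ⊗ₜ 1) * h.unshuffle y) =
        (1 ⊗ₜ v) * h.unshuffle y := by
      have := map_mul (Algebra.TensorProduct.comm K A A) (v ⊗ₜ 1) (h.unshuffle y)
      rw [Algebra.TensorProduct.comm_tmul] at this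
      refine this.trans (congrArg _ (h.unshuffle_comm y))
    rw [LinearMap.add_apply, LinearMap.comp_apply, h.halfUnshuffle_prim_mul hv]
    change h.unshuffle (v * y) = _ + TensorProduct.comm K A A _
    rw [e1, map_mul, h.unshuffle_prim hv, add_mul]
  · intro x _
    simp
  · intro x hx
    refine h.eq_of_eq_prim_mul (f := (TensorProduct.assoc K A A A).toLinearMap ∘ₗ
      h.halfUnshuffle.rTensor A ∘ₗ h.halfUnshuffle)
      (g := h.unshuffle.toLinearMap.lTensor A ∘ₗ h.halfUnshuffle) (fun v hv y => ?_) hx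
    have e1 : ∀ t : A ⊗[K] A, h.halfUnshuffle.rTensor A ((v ⊗ₜ 1) * t) =
        ((v ⊗ₜ 1) ⊗ₜ 1) * h.unshuffle.toLinearMap.rTensor A t := by
      intro t; induction t with
      | zero => simp
      | add s t hs ht => simp only [map_add, mul_add, hs, ht]
      | tmul a b => simp [h.halfUnshuffle_prim_mul hv]
    have e2 : ∀ t : A ⊗[K] A, h.unshuffle.toLinearMap.lTensor A ((v ⊗ₜ 1) * t) =
        (v ⊗ₜ (1 ⊗ₜ 1)) * h.unshuffle.toLinearMap.lTensor A t := by
      intro t; induction t with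
      | zero => simp
      | add s t hs ht => simp only [map_add, mul_add, hs, ht]
      | tmul a b => simp [← Algebra.TensorProduct.one_def]
    have e3 : ∀ t : (A ⊗[K] A) ⊗[K] A, TensorProduct.assoc K A A A (((v ⊗ₜ 1) ⊗ₜ 1) * t) =
        (v ⊗ₜ (1 ⊗ₜ 1)) * TensorProduct.assoc K A A A t := fun t =>
      map_mul (Algebra.TensorProduct.assoc K K K A A A) ((v ⊗ₜ 1) ⊗ₜ 1) t
    change TensorProduct.assoc K A A A (h.halfUnshuffle.rTensor A (h.halfUnshuffle (v * y))) =
      h.unshuffle.toLinearMap.lTensor A (h.halfUnshuffle (v * y))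
    rw [h.halfUnshuffle_prim_mul hv, e1, e2, e3, h.unshuffle_coassoc]
  · intro x hx
    refine h.eq_of_eq_prim_mul (f := (TensorProduct.lid K A).toLinearMap ∘ₗ
      (counit (R := K)).rTensor A ∘ₗ h.halfUnshuffle) (g := 0) (fun v hv y => ?_) hx
    have e1 : ∀ t : A ⊗[K] A,
        TensorProduct.lid K A ((counit (R := K)).rTensor A ((v ⊗ₜ 1) * t)) = 0 := by
      intro t; induction t with
      | zero => simp
      | add s t hs ht => rw [mul_add, map_add, map_add, hs, ht, add_zero]
      | tmul a b => simp [h.counit_mul, h.counit_prim hv]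
    change TensorProduct.lid K A ((counit (R := K)).rTensor A (h.halfUnshuffle (v * y))) = 0
    rw [h.halfUnshuffle_prim_mul hv, e1]
  · intro x hx
    refine h.eq_of_eq_prim_mul (f := (TensorProduct.rid K A).toLinearMap ∘ₗ
      (counit (R := K)).lTensor A ∘ₗ h.halfUnshuffle) (g := LinearMap.id) (fun v hv y => ?_) hx
    have e1 : ∀ t : A ⊗[K] A, TensorProduct.rid K A ((counit (R := K)).lTensor A ((v ⊗ₜ 1) * t)) =
        v * TensorProduct.rid K A ((counit (R := K)).lTensor A t) := by
      intro t; induction t with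
      | zero => simp
      | add s t hs ht => simp only [map_add, mul_add, hs, ht]
      | tmul a b => simp
    change TensorProduct.rid K A ((counit (R := K)).lTensor A (h.halfUnshuffle (v * y))) = v * y
    rw [h.halfUnshuffle_prim_mul hv, e1, h.unshuffle_counit_right]
  · intro x y hx _
    rw [tensorOp_mul]
    refine h.eq_of_eq_prim_mul (f := h.halfUnshuffle ∘ₗ mulRight K y)
      (g := mulRight K (h.unshuffle y) ∘ₗ h.halfUnshuffle) (fun v hv w => ?_) hx
    simp only [LinearMap.comp_apply, mulRight_apply]
    change h.halfUnshuffle (v * w * y) = h.halfUnshuffle (v * w) * h.unshuffle y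
    rw [mul_assoc, h.halfUnshuffle_prim_mul hv, h.halfUnshuffle_prim_mul hv, map_mul, mul_assoc]

end IsInfinitesimalBialgebra

end Unshuffle

/-! ### The shuffle bialgebra -/

section Shuffle

open WithConv LinearMap Coalgebra

variable {K : Type u} [Field K]

theorem iSup_tensorDegree {A : Type v} [AddCommGroup A] [Module K A] {𝒜 : ℕ → Submodule K A}
    (h : ⨆ n, 𝒜 n = ⊤) : ⨆ n, tensorDegree 𝒜 n = ⊤ := by
  refine Submodule.eq_top_iff'.2 fun t => ?_
  induction t with
  | zero => exact Submodule.zero_mem _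
  | add s t hs ht => exact Submodule.add_mem _ hs ht
  | tmul x y =>
    have hx : x ∈ ⨆ n, 𝒜 n := h ▸ Submodule.mem_top
    have hy : y ∈ ⨆ n, 𝒜 n := h ▸ Submodule.mem_top
    induction hx using Submodule.iSup_induction' with
    | zero => rw [TensorProduct.zero_tmul]; exact Submodule.zero_mem _
    | add a b _ _ ha hb => rw [TensorProduct.add_tmul]; exact Submodule.add_mem _ ha hb
    | mem i a ha =>
      induction hy using Submodule.iSup_induction' with
      | zero => rw [TensorProduct.tmul_zero]; exact Submodule.zero_mem _
      | add b c _ _ hb hc => rw [TensorProduct.tmul_add]; exact Submodule.add_mem _ hb hc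
      | mem j b hb => exact Submodule.mem_iSup_of_mem (i + j) (tmul_mem_tensorDegree rfl ha hb)

/-- Needed so that A ⊗ A can be the source in `exists_coalgHom`. -/
theorem isGradedComul_tensor {A : Type v} [AddCommGroup A] [Module K A] [Coalgebra K A]
    {𝒜 : ℕ → Submodule K A} (hΔ : IsGradedComul 𝒜 (comul (R := K))) :
    IsGradedComul (tensorDegree 𝒜) (comul (R := K) (A := A ⊗[K] A)) := by
  intro n t ht
  refine mapsTo_tensorDegree ?_ ht
  intro i j hij x hx y hy
  rw [TensorProduct.comul_tmul]
  let T := (TensorProduct.tensorTensorTensorComm K A A A A).toLinearMap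
  change T (comul x ⊗ₜ comul y) ∈ _
  refine mapsTo_tensorDegree (f := T ∘ₗ (TensorProduct.mk K _ _).flip (comul y)) ?_ (hΔ i x hx)
  intro k l hkl a ha b hb
  refine mapsTo_tensorDegree (f := T ∘ₗ TensorProduct.mk K _ _ (a ⊗ₜ b)) ?_ (hΔ j y hy)
  intro p q hpq c hc d hd
  exact tmul_mem_tensorDegree (i := k + p) (j := l + q) (by omega)
    (tmul_mem_tensorDegree rfl ha hc) (tmul_mem_tensorDegree rfl hb hd)

variable {A : Type v} [Ring A] [Algebra K A] [Coalgebra K A] {𝒜 : ℕ → Submodule K A}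

variable (K A) in
/-- The projection of `A ⊗ A` to the primitive elements of `A` that defines the shuffle product. -/
noncomputable def shuffleProj : A ⊗[K] A →ₗ[K] A :=
  (TensorProduct.rid K A).toLinearMap ∘ₗ TensorProduct.map (primProj K A) (counit (R := K)) +
    (TensorProduct.lid K A).toLinearMap ∘ₗ TensorProduct.map (counit (R := K)) (primProj K A)

@[simp] theorem shuffleProj_tmul (x y : A) : shuffleProj K A (x ⊗ₜ y) =
    counit (R := K) y • primProj K A x + counit (R := K) x • primProj K A y := by
  simp [shuffleProj]

namespace IsInfinitesimalBialgebra

variable (h : InfCompat K A 𝒜)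
include h

theorem exists_shuffleHom : ∃ g : A ⊗[K] A →ₗc[K] A,
    (∀ x, primProj K A (g x) = shuffleProj K A x) ∧
      (1 - toConv (shuffleProj K A)) * toConv g.toLinearMap = 1 := by
  refine h.exists_coalgHom (iSup_tensorDegree h.connected.iSup_eq_top)
    (isGradedComul_tensor h.graded_comul) _ (fun t => ?_) (fun t ht => ?_)
  · induction t with
    | zero => rw [map_zero]; exact Submodule.zero_mem _
    | add s t hs ht => rw [map_add]; exact Submodule.add_mem _ hs ht
    | tmul x y =>
      rw [shuffleProj_tmul]
      exact Submodule.add_mem _ (Submodule.smul_mem _ _ (h.primProj_mem x))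
        (Submodule.smul_mem _ _ (h.primProj_mem y))
  · rw [tensorDegree_zero h.connected.degree_zero, Submodule.mem_span_singleton] at ht
    obtain ⟨c, rfl⟩ := ht
    simp [h.primProj_one]

/-- The shuffle product, as the unique coalgebra morphism from `A ⊗ A` to `A` with the appropriate
projection to the primitive elements. -/
noncomputable def shuffleHom : A ⊗[K] A →ₗc[K] A := h.exists_shuffleHom.choose

theorem primProj_shuffleHom (x y : A) : primProj K A (h.shuffleHom (x ⊗ₜ y)) =
    counit (R := K) y • primProj K A x + counit (R := K) x • primProj K A y := by
  rw [← shuffleProj_tmul]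
  exact h.exists_shuffleHom.choose_spec.1 _

theorem counit_shuffleHom (x y : A) :
    counit (R := K) (h.shuffleHom (x ⊗ₜ y)) = counit (R := K) x * counit (R := K) y := by
  rw [CoalgHomClass.counit_comp_apply, TensorProduct.counit_tmul, smul_eq_mul, mul_comm]

/-- The shuffle product. -/
noncomputable def shuffle : A →ₗ[K] A →ₗ[K] A := TensorProduct.curry h.shuffleHom.toLinearMap

theorem shuffle_apply (x y : A) : h.shuffle x y = h.shuffleHom (x ⊗ₜ y) := rfl

/-- The flip is a coalgebra morphism and the projection π ⊗ ε + ε ⊗ π is symmetric, so uniqueness of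
lifts applies. -/
theorem shuffle_comm (x y : A) : h.shuffle x y = h.shuffle y x := by
  let τ : A ⊗[K] A →ₗc[K] A ⊗[K] A :=
    { (TensorProduct.comm K A A).toLinearMap with
      counit_comp := by ext; simp [mul_comm]
      map_comp_comul := by
        ext x y
        have key : ∀ s t : A ⊗[K] A,
            TensorProduct.map (TensorProduct.comm K A A).toLinearMap
              (TensorProduct.comm K A A).toLinearMap
              (TensorProduct.tensorTensorTensorComm K A A A A (s ⊗ₜ t)) =
            TensorProduct.tensorTensorTensorComm K A A A A (t ⊗ₜ s) := by
          intro s t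
          induction s with
          | zero => simp
          | add s s' hs hs' => simp only [TensorProduct.add_tmul, TensorProduct.tmul_add, map_add,
              hs, hs']
          | tmul a b =>
            induction t with
            | zero => simp
            | add s s' hs hs' => simp only [TensorProduct.add_tmul, TensorProduct.tmul_add,
                map_add, hs, hs']
            | tmul c d => simp
        exact key _ _ }
  refine h.coalgHom_ext (g := h.shuffleHom) (g' := h.shuffleHom.comp τ) (fun t => ?_) (x ⊗ₜ y)
  induction t with
  | zero => simp
  | add s t hs ht => simp only [map_add, hs, ht]
  | tmul a b =>
    change _ = primProj K A (h.shuffleHom (b ⊗ₜ a))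
    rw [h.primProj_shuffleHom, h.primProj_shuffleHom, add_comm]

theorem shuffle_one (x : A) : h.shuffle x 1 = x := by
  let η : A →ₗc[K] A ⊗[K] A :=
    { (TensorProduct.mk K A A).flip 1 with
      counit_comp := by ext; simp [h.counit_one]
      map_comp_comul := by
        ext x
        have key : ∀ s : A ⊗[K] A,
            TensorProduct.map ((TensorProduct.mk K A A).flip 1) ((TensorProduct.mk K A A).flip 1) s =
            TensorProduct.tensorTensorTensorComm K A A A A (s ⊗ₜ (1 ⊗ₜ 1)) := by
          intro s
          induction s with
          | zero => simp
          | add s s' hs hs' => simp only [TensorProduct.add_tmul, map_add, hs, hs']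
          | tmul a b => simp
        refine (key _).trans ?_
        rw [← h.comul_one]
        rfl }
  refine h.coalgHom_ext (g := h.shuffleHom.comp η) (g' := CoalgHom.id K A) (fun x => ?_) x
  change primProj K A (h.shuffleHom (x ⊗ₜ 1)) = primProj K A x
  rw [h.primProj_shuffleHom, h.primProj_one, h.counit_one, one_smul, smul_zero, add_zero]

theorem one_shuffle (x : A) : h.shuffle 1 x = x := by
  rw [h.shuffle_comm, h.shuffle_one]

/-- Both bracketings are coalgebra morphisms from the triple tensor product whose projection is π on
one factor and ε on the other two, summed over the three positions. -/
theorem shuffle_assoc (x y z : A) :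
    h.shuffle (h.shuffle x y) z = h.shuffle x (h.shuffle y z) := by
  refine h.coalgHom_ext (g := h.shuffleHom.comp (CoalgHom.rTensor A h.shuffleHom))
    (g' := (h.shuffleHom.comp (CoalgHom.lTensor A h.shuffleHom)).comp
      (Coalgebra.TensorProduct.assoc K K A A A).toCoalgHom) (fun t => ?_) ((x ⊗ₜ y) ⊗ₜ z)
  induction t with
  | zero => simp
  | add s t hs ht => simp only [map_add, hs, ht]
  | tmul s c =>
    induction s with
    | zero => simp
    | add s t hs ht => simp only [TensorProduct.add_tmul, map_add, hs, ht]
    | tmul a b =>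
      change primProj K A (h.shuffleHom (h.shuffleHom (a ⊗ₜ b) ⊗ₜ c)) =
        primProj K A (h.shuffleHom (a ⊗ₜ h.shuffleHom (b ⊗ₜ c)))
      simp only [h.primProj_shuffleHom, h.counit_shuffleHom, smul_add, smul_smul]
      rw [mul_comm (counit c) (counit b), mul_comm (counit c) (counit a), add_assoc]

theorem shuffle_graded : IsGradedMul 𝒜 h.shuffle := by
  have hC := tensorDegree_zero h.connected.degree_zero
  intro i j x hx y hy
  refine graded_of_one_sub_conv_mul (isGradedComul_tensor h.graded_comul) hC ?_ h.one_mem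
    (fun i j x hx y hy => h.graded_mul i j x hx y hy) (f := toConv (shuffleProj K A)) ?_ ?_
    h.exists_shuffleHom.choose_spec.2 (i + j) _ (tmul_mem_tensorDegree rfl hx hy)
  · intro n hn t ht
    refine eqOn_tensorDegree (g := 0) ?_ ht
    intro i j hij a ha b hb
    rw [TensorProduct.counit_tmul, smul_eq_mul, LinearMap.zero_apply]
    rcases Nat.eq_zero_or_pos i with rfl | hi
    · rw [h.connected.counit_pos j (by omega) b hb, zero_mul]
    · rw [h.connected.counit_pos i hi a ha, mul_zero]
  · simp [h.primProj_one]
  · intro n t ht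
    refine mapsTo_tensorDegree (f := shuffleProj K A) ?_ ht
    intro i j hij a ha b hb
    rw [shuffleProj_tmul]
    refine Submodule.add_mem _ ?_ ?_
    · rcases Nat.eq_zero_or_pos j with rfl | hj
      · rw [← hij]; exact Submodule.smul_mem _ _ (h.primProj_graded i a ha)
      · rw [h.connected.counit_pos j hj b hb, zero_smul]; exact Submodule.zero_mem _
    · rcases Nat.eq_zero_or_pos i with rfl | hi
      · rw [← hij, zero_add]; exact Submodule.smul_mem _ _ (h.primProj_graded j b hb)
      · rw [h.connected.counit_pos i hi a ha, zero_smul]; exact Submodule.zero_mem _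

theorem comul_shuffle (x y : A) : comul (R := K) (h.shuffle x y) =
    tensorOp h.shuffle h.shuffle (comul (R := K) x ⊗ₜ comul (R := K) y) := by
  refine (LinearMap.congr_fun h.shuffleHom.map_comp_comul (x ⊗ₜ[K] y)).symm.trans ?_
  have : TensorProduct.lift h.shuffle = h.shuffleHom.toLinearMap := by ext; rfl
  rw [tensorOp, this]
  rfl

theorem shuffle_isGradedHopf :
    IsGradedHopf 𝒜 h.shuffle 1 (comul (R := K)) (counit (R := K)) :=
  isGradedHopf_of_connected h.connected
    (isUnitalAlgebra_iff.2 ⟨h.shuffle_assoc, h.one_shuffle, h.shuffle_one⟩) h.coalgebra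
    h.shuffle_graded h.graded_comul h.comul_one h.comul_shuffle h.counit_shuffleHom

/-- The left half-shuffle: the first letter of the result is that of the first word. -/
noncomputable def halfShuffle : A →ₗ[K] A →ₗ[K] A :=
  LinearMap.mk₂ K (fun x y => mul' K A
    (TensorProduct.map (primProj K A) (h.shuffle.flip y) (comul (R := K) x)))
    (fun x x' y => by simp) (fun c x y => by simp)
    (fun x y y' => by simp [TensorProduct.map_add_right])
    (fun c x y => by simp [TensorProduct.map_smul_right])

theorem halfShuffle_apply (x y : A) : h.halfShuffle x y = mul' K A
    (TensorProduct.map (primProj K A) (h.shuffle.flip y) (comul (R := K) x)) := rfl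

theorem halfShuffle_prim_mul {v : A} (hv : v ∈ primSub K A) (w y : A) :
    h.halfShuffle (v * w) y = v * h.shuffle w y := by
  have key : ∀ t : A ⊗[K] A, mul' K A (TensorProduct.map (primProj K A) (h.shuffle.flip y)
      ((v ⊗ₜ 1) * t)) =
      v * h.shuffle (TensorProduct.lid K A ((counit (R := K)).rTensor A t)) y := by
    intro t; induction t with
    | zero => simp
    | add s t hs ht => simp only [map_add, mul_add, hs, ht, LinearMap.add_apply]
    | tmul a b => simp [h.primProj_prim_mul hv]
  rw [h.halfShuffle_apply, h.comul_prim_mul hv, map_add, map_add, key, rTensor_counit_comul]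
  simp [h.primProj_one]

theorem one_halfShuffle (y : A) : h.halfShuffle 1 y = 0 := by
  simp [h.halfShuffle_apply, h.comul_one, h.primProj_one]

theorem halfShuffle_one (x : A) : h.halfShuffle x 1 = x - algebraMap K A (counit (R := K) x) := by
  have : h.shuffle.flip 1 = LinearMap.id := LinearMap.ext h.shuffle_one
  rw [h.halfShuffle_apply, this, h.mul'_primProj]

theorem halfShuffle_graded (i j : ℕ) (x : A) (hx : x ∈ 𝒜 i) (y : A) (hy : y ∈ 𝒜 j) :
    h.halfShuffle x y ∈ 𝒜 (i + j) := by
  refine mapsTo_tensorDegree (f := mul' K A ∘ₗ TensorProduct.map _ _) ?_ (h.graded_comul i x hx)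
  rintro k l rfl a ha b hb
  rw [add_assoc]
  exact h.graded_mul _ _ _ (h.primProj_graded k a ha) _ (h.shuffle_graded l j b hb y hy)

/-- This is g = 1 + (π ⊗ ε + ε ⊗ π) * g evaluated at x ⊗ y: the first letter of the result comes
either from x or from y. -/
theorem shuffle_eq_add (x y : A) : h.shuffle x y =
    algebraMap K A (counit (R := K) x * counit (R := K) y) +
      (h.halfShuffle x y + h.halfShuffle y x) := by
  have h1 := h.exists_shuffleHom.choose_spec.2
  rw [sub_mul, one_mul, sub_eq_iff_eq_add] at h1
  have h2 : h.shuffle x y = algebraMap K A (counit (R := K) (x ⊗ₜ[K] y)) +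
      mul' K A (TensorProduct.map (shuffleProj K A) h.shuffleHom.toLinearMap
        (TensorProduct.tensorTensorTensorComm K A A A A
          (comul (R := K) x ⊗ₜ[K] comul (R := K) y))) :=
    congrArg (fun f : WithConv (A ⊗[K] A →ₗ[K] A) => f (x ⊗ₜ y)) h1
  have key : ∀ s t : A ⊗[K] A, mul' K A (TensorProduct.map (shuffleProj K A)
      h.shuffleHom.toLinearMap (TensorProduct.tensorTensorTensorComm K A A A A (s ⊗ₜ[K] t))) =
      mul' K A (TensorProduct.map (primProj K A)
        (h.shuffle.flip (TensorProduct.lid K A ((counit (R := K)).rTensor A t))) s) +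
      mul' K A (TensorProduct.map (primProj K A)
        (h.shuffle (TensorProduct.lid K A ((counit (R := K)).rTensor A s))) t) := by
    intro s t
    induction s with
    | zero => simp
    | add s s' hs hs' =>
      simp only [TensorProduct.add_tmul, map_add, hs, hs', TensorProduct.map_add_right,
        LinearMap.add_apply]
      abel
    | tmul a b =>
      induction t with
      | zero => simp
      | add s s' hs hs' =>
        simp only [TensorProduct.tmul_add, map_add, hs, hs', TensorProduct.map_add_right,
          LinearMap.add_apply]
        abel
      | tmul c d =>
        simp [h.shuffle_apply, add_mul]
  have h3 : h.shuffle x = h.shuffle.flip x := LinearMap.ext fun y => h.shuffle_comm x y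
  rw [h2, key, rTensor_counit_comul, rTensor_counit_comul, TensorProduct.counit_tmul, smul_eq_mul,
    mul_comm (counit y)]
  simp only [TensorProduct.lid_tmul, one_smul]
  rw [h3]
  rfl

/-- On x = vw with v primitive both sides are v times a triple shuffle of w, y, z, so associativity
of the shuffle suffices. -/
theorem halfShuffle_halfShuffle {x : A} (hx : counit (R := K) x = 0) (y z : A) :
    h.halfShuffle (h.halfShuffle x y) z = h.halfShuffle x (h.shuffle y z) := by
  refine h.eq_of_eq_prim_mul (f := h.halfShuffle.flip z ∘ₗ h.halfShuffle.flip y)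
    (g := h.halfShuffle.flip (h.shuffle y z)) (fun v hv w => ?_) hx
  simp only [LinearMap.comp_apply, LinearMap.flip_apply]
  rw [h.halfShuffle_prim_mul hv, h.halfShuffle_prim_mul hv, h.halfShuffle_prim_mul hv,
    h.shuffle_assoc]

/-- The unreduced form of the compatibility. On x = vw it combines `comul_prim_mul` with
multiplicativity of Δ for the shuffle; the part 1 ⊗ x of Δ(x) contributes nothing because 1 ≺ y = 0,
and the added term 1 ⊗ (x ≺ y) makes up for it. -/
theorem comul_halfShuffle {x : A} (hx : counit (R := K) x = 0) (y : A) :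
    comul (R := K) (h.halfShuffle x y) =
      tensorOp h.halfShuffle h.shuffle (comul (R := K) x ⊗ₜ comul (R := K) y) +
        1 ⊗ₜ h.halfShuffle x y := by
  refine h.eq_of_eq_prim_mul (f := comul (R := K) ∘ₗ h.halfShuffle.flip y)
    (g := tensorOp h.halfShuffle h.shuffle ∘ₗ (TensorProduct.mk K _ _).flip (comul (R := K) y) ∘ₗ
      comul (R := K) + TensorProduct.mk K A A 1 ∘ₗ h.halfShuffle.flip y) (fun v hv w => ?_) hx
  have e1 : ∀ s t : A ⊗[K] A, tensorOp h.halfShuffle h.shuffle (((v ⊗ₜ 1) * s) ⊗ₜ t) =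
      (v ⊗ₜ 1) * tensorOp h.shuffle h.shuffle (s ⊗ₜ t) := by
    intro s t
    induction s with
    | zero => simp
    | add s s' hs hs' => simp only [TensorProduct.add_tmul, map_add, mul_add, hs, hs']
    | tmul a b =>
      induction t with
      | zero => simp
      | add s s' hs hs' => simp only [TensorProduct.tmul_add, map_add, mul_add, hs, hs']
      | tmul c d => simp [tensorOp_tmul, h.halfShuffle_prim_mul hv]
  have e2 : ∀ (b : A) (t : A ⊗[K] A), tensorOp h.halfShuffle h.shuffle ((1 ⊗ₜ b) ⊗ₜ t) = 0 := by
    intro b t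
    induction t with
    | zero => simp
    | add s s' hs hs' => rw [TensorProduct.tmul_add, map_add, hs, hs', add_zero]
    | tmul c d => simp [tensorOp_tmul, h.one_halfShuffle]
  simp only [LinearMap.comp_apply, LinearMap.flip_apply, LinearMap.add_apply,
    TensorProduct.mk_apply]
  rw [h.halfShuffle_prim_mul hv, h.comul_prim_mul hv, h.comul_prim_mul hv, TensorProduct.add_tmul,
    map_add, e1, e2, add_zero, h.comul_shuffle]

theorem isShuffleBialgebra : IsShuffleBialgebra 𝒜 h.shuffle h.halfShuffle h.halfShuffle.flip 1
    (comul (R := K)) (counit (R := K)) := by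
  have split : ∀ x y, counit (R := K) x = 0 →
      h.shuffle x y = h.halfShuffle x y + h.halfShuffle.flip x y := by
    intro x y hx
    rw [h.shuffle_eq_add, hx, zero_mul, map_zero, zero_add]; rfl
  have half_one : ∀ x, counit (R := K) x = 0 → h.halfShuffle x 1 = x := by
    intro x hx
    rw [h.halfShuffle_one, hx, map_zero, sub_zero]
  refine ⟨h.shuffle_isGradedHopf, h.shuffle_comm,
    fun i j _ _ x hx y hy => h.halfShuffle_graded i j x hx y hy,
    fun i j _ _ x hx y hy => add_comm i j ▸ h.halfShuffle_graded j i y hy x hx,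
    fun x y hx _ => split x y hx, half_one,
    fun x _ => h.one_halfShuffle x, half_one, fun x _ => h.one_halfShuffle x,
    fun x y _ _ => rfl, ?_, ?_⟩
  · intro x y z hx hy _
    rw [h.halfShuffle_halfShuffle hx, split y z hy]
  · intro x y hx hy
    have hΔ : ∀ z : A, comul (R := K) z = reducedComul 1 (comul (R := K)) z + z ⊗ₜ 1 + 1 ⊗ₜ z := by
      intro z; rw [reducedComul]; abel
    -- The left factors of the reduced coproduct have no component along the unit; this removes the
    -- correction term of `e2`.
    have hred : TensorProduct.lid K A ((counit (R := K)).rTensor A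
        (reducedComul 1 (comul (R := K)) x)) = 0 := by
      rw [reducedComul]
      simp only [map_sub, rTensor_counit_comul]
      simp [hx, h.counit_one]
    rw [h.comul_halfShuffle hx, hΔ x, hΔ y]
    generalize reducedComul 1 (comul (R := K)) x = s at hred
    generalize reducedComul 1 (comul (R := K)) y = t
    have e1 : ∀ s : A ⊗[K] A, tensorOp h.halfShuffle h.shuffle (s ⊗ₜ (y ⊗ₜ 1)) =
        (h.halfShuffle.flip y).rTensor A s := by
      intro s; induction s with
      | zero => simp
      | add s s' hs hs' => simp only [TensorProduct.add_tmul, map_add, hs, hs']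
      | tmul a b => simp [tensorOp_tmul, h.shuffle_one]
    -- The half-shuffle defined on all of A satisfies a ≺ 1 = a - ε(a)1, not a ≺ 1 = a, which
    -- explains the subtracted term.
    have e2 : ∀ s : A ⊗[K] A, tensorOp h.halfShuffle h.shuffle (s ⊗ₜ (1 ⊗ₜ y)) =
        (h.shuffle.flip y).lTensor A s - 1 ⊗ₜ h.shuffle
          (TensorProduct.lid K A ((counit (R := K)).rTensor A s)) y := by
      intro s; induction s with
      | zero => simp
      | add s s' hs hs' =>
        simp only [TensorProduct.add_tmul, map_add, hs, hs', LinearMap.add_apply,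
          TensorProduct.tmul_add]
        abel
      | tmul a b =>
        simp [tensorOp_tmul, h.halfShuffle_one, TensorProduct.sub_tmul,
          Algebra.algebraMap_eq_smul_one, TensorProduct.smul_tmul]
    have e3 : ∀ t : A ⊗[K] A, tensorOp h.halfShuffle h.shuffle ((x ⊗ₜ 1) ⊗ₜ t) =
        (h.halfShuffle x).rTensor A t := by
      intro t; induction t with
      | zero => simp
      | add s s' hs hs' => simp only [TensorProduct.tmul_add, map_add, hs, hs']
      | tmul a b => simp [tensorOp_tmul, h.one_shuffle]
    have e4 : ∀ t : A ⊗[K] A, tensorOp h.halfShuffle h.shuffle ((1 ⊗ₜ x) ⊗ₜ t) = 0 := by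
      intro t; induction t with
      | zero => simp
      | add s s' hs hs' => rw [TensorProduct.tmul_add, map_add, hs, hs', add_zero]
      | tmul a b => simp [tensorOp_tmul, h.one_halfShuffle]
    simp only [TensorProduct.add_tmul, TensorProduct.tmul_add, map_add, e4]
    simp only [e1, e2, e3, hred, LinearMap.rTensor_tmul, LinearMap.lTensor_tmul,
      LinearMap.flip_apply, hx, TensorProduct.zero_tmul, map_zero, LinearMap.zero_apply,
      TensorProduct.tmul_zero, h.one_shuffle, sub_zero]
    abel

end IsInfinitesimalBialgebra

end Shuffle

/-! ### Subspaces, associativity and units for sums and joins -/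

section Spaces

variable {X Y Z : Type} [TopologicalSpace X] [TopologicalSpace Y] [TopologicalSpace Z]

/-- A subspace of a sum is the sum of its traces. -/
def subtypeSumHomeomorph (W : Set (X ⊕ Y)) :
    ↥W ≃ₜ ↥(Sum.inl ⁻¹' W : Set X) ⊕ ↥(Sum.inr ⁻¹' W : Set Y) :=
  (Equiv.subtypeSum (p := (· ∈ W))).toHomeomorph fun s => by
    rw [isOpen_sum_iff]
    constructor
    · rintro ⟨O, hO, hs⟩
      rw [isOpen_sum_iff] at hO
      refine ⟨⟨_, hO.1, ?_⟩, ⟨_, hO.2, ?_⟩⟩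
      · ext ⟨x, hx⟩
        exact Set.ext_iff.1 hs ⟨Sum.inl x, hx⟩
      · ext ⟨y, hy⟩
        exact Set.ext_iff.1 hs ⟨Sum.inr y, hy⟩
    · rintro ⟨⟨O, hO, hs⟩, ⟨O', hO', hs'⟩⟩
      refine ⟨Sum.inl '' O ∪ Sum.inr '' O', ?_, ?_⟩
      · rw [isOpen_sum_iff]
        constructor
        · convert hO using 1; ext x; simp
        · convert hO' using 1; ext x; simp
      · ext ⟨x | y, hx⟩
        · have := Set.ext_iff.1 hs ⟨x, hx⟩
          change Sum.inl x ∈ Sum.inl '' O ∪ Sum.inr '' O' ↔ Sum.inl ⟨x, hx⟩ ∈ s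
          simpa using this
        · have := Set.ext_iff.1 hs' ⟨y, hx⟩
          change Sum.inr y ∈ Sum.inl '' O ∪ Sum.inr '' O' ↔ Sum.inr ⟨y, hx⟩ ∈ s
          simpa using this

theorem isOpen_joinSpace_iff {U : Set (JoinSpace X Y)} :
    IsOpen U ↔ IsOpen (Sum.inl ⁻¹' (U : Set (X ⊕ Y))) ∧ IsOpen (Sum.inr ⁻¹' (U : Set (X ⊕ Y))) ∧
      ((Sum.inl ⁻¹' (U : Set (X ⊕ Y))).Nonempty → Sum.inr ⁻¹' (U : Set (X ⊕ Y)) = Set.univ) :=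
  Iff.rfl

/-- A subspace of a join is the join of its traces. -/
def subtypeJoinHomeomorph (W : Set (JoinSpace X Y)) :
    ↥W ≃ₜ JoinSpace ↥(Sum.inl ⁻¹' (W : Set (X ⊕ Y)) : Set X)
      ↥(Sum.inr ⁻¹' (W : Set (X ⊕ Y)) : Set Y) :=
  Equiv.toHomeomorph (Y := JoinSpace ↥(Sum.inl ⁻¹' (W : Set (X ⊕ Y)) : Set X)
      ↥(Sum.inr ⁻¹' (W : Set (X ⊕ Y)) : Set Y))
    (Equiv.subtypeSum (α := X) (β := Y) (p := (· ∈ (W : Set (X ⊕ Y))))) fun s => by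
    rw [isOpen_joinSpace_iff]
    constructor
    · rintro ⟨O, hO, hs⟩
      obtain ⟨h1, h2, h3⟩ := isOpen_joinSpace_iff.1 hO
      refine ⟨⟨_, h1, ?_⟩, ⟨_, h2, ?_⟩, ?_⟩
      · ext ⟨x, hx⟩
        exact Set.ext_iff.1 hs ⟨Sum.inl x, hx⟩
      · ext ⟨y, hy⟩
        exact Set.ext_iff.1 hs ⟨Sum.inr y, hy⟩
      · rintro ⟨⟨x, hx⟩, hxs⟩
        have h4 := h3 ⟨x, (Set.ext_iff.1 hs ⟨Sum.inl x, hx⟩).2 hxs⟩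
        refine Set.eq_univ_of_forall ?_
        rintro ⟨y, hy⟩
        exact (Set.ext_iff.1 hs ⟨Sum.inr y, hy⟩).1 (h4 ▸ Set.mem_univ y : y ∈ Sum.inr ⁻¹' O)
    · rintro ⟨⟨O, hO, hs⟩, ⟨O', hO', hs'⟩, h3⟩
      -- An ambient open set with trace s: if s meets the left factor, the whole right factor must
      -- be included. Otherwise the left part has to be taken empty rather than O, since O may
      -- contain points outside W.
      by_cases hne : (Sum.inl ⁻¹' s).Nonempty
      · refine ⟨(Sum.inl '' O ∪ Sum.inr '' Set.univ : Set (X ⊕ Y)),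
          isOpen_joinSpace_iff.2 ⟨?_, ?_, fun _ => ?_⟩, ?_⟩
        · convert hO using 1; ext x; simp
        · convert isOpen_univ using 1; ext x; simp
        · ext x; simp
        · ext ⟨x | y, hx⟩
          · have := Set.ext_iff.1 hs ⟨x, hx⟩
            refine ⟨?_, fun h => Or.inl ⟨x, this.2 h, rfl⟩⟩
            rintro (⟨x', h, e⟩ | ⟨_, _, e⟩)
            · cases e; exact this.1 h
            · cases e
          · have := Set.ext_iff.1 (h3 hne) ⟨y, hx⟩
            exact ⟨fun _ => this.2 trivial, fun _ => Or.inr ⟨y, trivial, rfl⟩⟩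
      · refine ⟨(Sum.inr '' O' : Set (X ⊕ Y)), isOpen_joinSpace_iff.2 ⟨?_, ?_, ?_⟩, ?_⟩
        · convert isOpen_empty using 1; ext x; simp
        · convert hO' using 1; ext x; simp
        · rintro ⟨x, y, _, hxy⟩
          cases hxy
        · ext ⟨x | y, hx⟩
          · have : (⟨x, hx⟩ : ↥(Sum.inl ⁻¹' (W : Set (X ⊕ Y)) : Set X)) ∉ Sum.inl ⁻¹' s :=
              fun h => hne ⟨_, h⟩
            refine ⟨?_, fun h => (this h).elim⟩
            rintro ⟨_, _, e⟩
            cases e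
          · have := Set.ext_iff.1 hs' ⟨y, hx⟩
            refine ⟨?_, fun h => ⟨y, this.2 h, rfl⟩⟩
            rintro ⟨y', h, e⟩
            cases e
            exact this.1 h

/-- The join is associative. -/
def JoinSpace.assoc : JoinSpace (JoinSpace X Y) Z ≃ₜ JoinSpace X (JoinSpace Y Z) :=
  Equiv.toHomeomorph (X := JoinSpace (JoinSpace X Y) Z) (Y := JoinSpace X (JoinSpace Y Z))
    (Equiv.sumAssoc X Y Z) fun s => by
    simp only [isOpen_joinSpace_iff]
    constructor
    · rintro ⟨⟨h1, h2, h3⟩, h4, h5⟩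
      refine ⟨h1, ⟨h2, h4, ?_⟩, ?_⟩
      · rintro ⟨y, hy⟩
        exact h5 ⟨Sum.inr y, hy⟩
      · rintro ⟨x, hx⟩
        refine Set.eq_univ_of_forall ?_
        rintro (y | z)
        · exact Set.eq_univ_iff_forall.1 (h3 ⟨x, hx⟩) y
        · exact Set.eq_univ_iff_forall.1 (h5 ⟨Sum.inl x, hx⟩) z
    · rintro ⟨h1, ⟨h2, h4, h5⟩, h3⟩
      refine ⟨⟨h1, h2, ?_⟩, h4, ?_⟩
      · rintro ⟨x, hx⟩
        exact Set.eq_univ_of_forall fun y => Set.eq_univ_iff_forall.1 (h3 ⟨x, hx⟩) (Sum.inl y)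
      · rintro ⟨x | y, hx⟩
        · exact Set.eq_univ_of_forall fun z => Set.eq_univ_iff_forall.1 (h3 ⟨x, hx⟩) (Sum.inr z)
        · exact h5 ⟨y, hx⟩

/-- The empty space is a right unit for the join. -/
def JoinSpace.joinEmpty [IsEmpty Y] : JoinSpace X Y ≃ₜ X :=
  Equiv.toHomeomorph (X := JoinSpace X Y) (Equiv.sumEmpty X Y) fun s => by
    rw [isOpen_joinSpace_iff]
    exact ⟨fun h => h.1, fun h => ⟨h, isOpen_discrete _, fun _ => Subsingleton.elim _ _⟩⟩

/-- The empty space is a left unit for the join. -/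
def JoinSpace.emptyJoin [IsEmpty X] : JoinSpace X Y ≃ₜ Y :=
  Equiv.toHomeomorph (X := JoinSpace X Y) (Equiv.emptySum X Y) fun s => by
    rw [isOpen_joinSpace_iff]
    exact ⟨fun h => h.2.1, fun h => ⟨isOpen_discrete _, h, fun ⟨x, _⟩ => isEmptyElim x⟩⟩

end Spaces

/-! ### Grading and products on the span of finite spaces -/

namespace FiniteSpace

theorem exists_eq_of (X : FiniteSpace) : ∃ T : FinTopology, X = of T.Pt := by
  induction X using Quotient.inductionOn with
  | _ T => exact ⟨T, Quotient.sound ⟨(stdRepHomeo T.Pt).symm⟩⟩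

variable (X Y : Type) [TopologicalSpace X] [TopologicalSpace Y] [Finite X] [Finite Y]

theorem sum_of : (of X).sum (of Y) = of (X ⊕ Y) :=
  of_eq_of_iff.2 ⟨(stdRepHomeo X).sumCongr (stdRepHomeo Y)⟩

theorem join_of : (of X).join (of Y) = of (JoinSpace X Y) :=
  of_eq_of_iff.2 ⟨JoinSpace.congr (stdRepHomeo X) (stdRepHomeo Y)⟩

theorem of_eq_empty_iff : of X = empty ↔ IsEmpty X := by
  rw [empty, of_eq_of_iff]
  constructor
  · rintro ⟨f⟩
    exact f.toEquiv.isEmpty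
  · intro
    exact ⟨(Equiv.equivPEmpty X).toHomeomorph fun s =>
      ⟨fun _ => isOpen_discrete _, fun _ => isOpen_discrete _⟩⟩

end FiniteSpace

namespace SpanFS

variable (K : Type u) [Field K]

/-- The basis vector of a finite topological set. -/
noncomputable def space (X : Type) [TopologicalSpace X] [Finite X] : SpanFS K :=
  single K (FiniteSpace.of X)

section

variable (X Y : Type) [TopologicalSpace X] [TopologicalSpace Y] [Finite X] [Finite Y]

variable {X Y} in
theorem space_congr (f : X ≃ₜ Y) : space K X = space K Y :=
  congrArg (single K) (FiniteSpace.of_eq_of_iff.2 ⟨f⟩)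

theorem dot_space : dot K (space K X) (space K Y) = space K (X ⊕ Y) := by
  simp [dot, space, single, FiniteSpace.sum_of]

theorem join_space : join K (space K X) (space K Y) = space K (JoinSpace X Y) := by
  simp [join, space, single, FiniteSpace.join_of]

theorem comul_space : comul K (space K X) = comulSpace K X := by
  have : comul K (space K X) = comulSpace K (FiniteSpace.stdRep X).Pt :=
    (Finsupp.linearCombination_single K 1 (FiniteSpace.of X)).trans (one_smul _ _)
  rw [this]
  exact comulSpace_congr K (FiniteSpace.stdRepHomeo X)

theorem space_eq_one [IsEmpty X] : space K X = one K :=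
  congrArg (single K) ((FiniteSpace.of_eq_empty_iff X).2 ‹_›)

theorem counit_space_of_nonempty [Nonempty X] : counit K (space K X) = 0 := by
  have : FiniteSpace.of X ≠ FiniteSpace.empty := fun h =>
    not_isEmpty_of_nonempty X ((FiniteSpace.of_eq_empty_iff X).1 h)
  simp [counit, space, single, this]

theorem counit_one : counit K (one K) = 1 := by
  simp [counit, one, single]

end

variable {K}

theorem linearMap_ext {M : Type*} [AddCommMonoid M] [Module K M] {f g : SpanFS K →ₗ[K] M}
    (h : ∀ T : FinTopology, f (space K T.Pt) = g (space K T.Pt)) : f = g := by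
  refine Finsupp.lhom_ext' fun X => LinearMap.ext_ring ?_
  obtain ⟨T, rfl⟩ := X.exists_eq_of
  exact h T

theorem degree_eq_supported (n : ℕ) :
    degree K n = Finsupp.supported K K {X : FiniteSpace | X.card = n} := by
  rw [Finsupp.supported_eq_span_single, degree]
  congr 1
  ext x
  simp only [Set.mem_ofPred_eq, Set.mem_image, single]
  exact exists_congr fun X => and_congr_right fun _ => eq_comm

theorem isInternal_degree : DirectSum.IsInternal (degree K) := by
  rw [DirectSum.isInternal_submodule_iff_iSupIndep_and_iSup_eq_top]
  simp only [iSupIndep_def, funext degree_eq_supported]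
  refine ⟨fun i => ?_, ?_⟩
  · have hle : ⨆ (j : ℕ) (_ : j ≠ i), Finsupp.supported K K {X : FiniteSpace | X.card = j} ≤
        Finsupp.supported K K {X : FiniteSpace | X.card ≠ i} :=
      iSup₂_le fun j hj => Finsupp.supported_mono fun X (hX : X.card = j) (h : X.card = i) => hj (hX.symm.trans h)
    refine (Finsupp.disjoint_supported_supported (M := K) (R := K) ?_).mono_right hle
    exact Set.disjoint_left.2 fun X hX hX' => hX' hX
  · have hu : ⋃ i, {X : FiniteSpace | X.card = i} = Set.univ := by
      ext X; simp
    rw [← Finsupp.supported_iUnion, hu, Finsupp.supported_univ]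

theorem space_mem_degree (X : Type) [TopologicalSpace X] [Finite X] :
    space K X ∈ degree K (Nat.card X) :=
  Submodule.subset_span ⟨_, rfl, rfl⟩

theorem degree_le_iff {n : ℕ} {S : Submodule K (SpanFS K)} :
    degree K n ≤ S ↔ ∀ T : FinTopology, Nat.card T.Pt = n → space K T.Pt ∈ S := by
  rw [degree, Submodule.span_le]
  constructor
  · intro h T hT
    exact h ⟨FiniteSpace.of T.Pt, hT, rfl⟩
  · rintro h _ ⟨X, hX, rfl⟩
    obtain ⟨T, rfl⟩ := X.exists_eq_of
    exact h T hX

theorem mapsTo_degree {M : Type*} [AddCommMonoid M] [Module K M] {f : SpanFS K →ₗ[K] M}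
    {S : Submodule K M} {n : ℕ} (h : ∀ T : FinTopology, Nat.card T.Pt = n → f (space K T.Pt) ∈ S)
    {x : SpanFS K} (hx : x ∈ degree K n) : f x ∈ S :=
  (degree_le_iff (S := S.comap f)).2 h hx

theorem isConnectedGraded : IsConnectedGraded (degree K) (one K) (counit K) where
  internal := isInternal_degree
  degree_zero := by
    refine le_antisymm (degree_le_iff.2 fun T hT => ?_) ?_
    · have : IsEmpty T.Pt := (Nat.card_eq_zero.1 hT).resolve_right (not_infinite_iff_finite.2 inferInstance)
      rw [space_eq_one]
      exact Submodule.mem_span_singleton_self _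
    · refine (Submodule.span_singleton_le_iff_mem _ _).2 ?_
      have := space_mem_degree (K := K) PEmpty.{1}
      rwa [Nat.card_of_isEmpty, space_eq_one] at this
  counit_one := counit_one K
  counit_pos n hn x hx := by
    refine (Submodule.mem_bot K).1 (mapsTo_degree (fun T hT => ?_) hx)
    have : Nonempty T.Pt := (Nat.card_pos_iff.1 (hT ▸ hn)).1
    rw [counit_space_of_nonempty]
    exact Submodule.zero_mem _

theorem graded_of_space {m : SpanFS K →ₗ[K] SpanFS K →ₗ[K] SpanFS K}
    (h : ∀ S T : FinTopology, m (space K S.Pt) (space K T.Pt) ∈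
      degree K (Nat.card S.Pt + Nat.card T.Pt)) : IsGradedMul (degree K) m := by
  intro i j x hx y hy
  refine mapsTo_degree (f := m.flip y) (fun S hS => ?_) hx
  refine mapsTo_degree (f := m (space K S.Pt)) (fun T hT => ?_) hy
  rw [← hS, ← hT]
  exact h S T

theorem isGradedMul_dot : IsGradedMul (degree K) (dot K) := by
  refine graded_of_space fun S T => ?_
  rw [dot_space, ← Nat.card_sum]
  exact space_mem_degree _

theorem isGradedMul_join : IsGradedMul (degree K) (join K) := by
  refine graded_of_space fun S T => ?_
  rw [join_space, ← Nat.card_sum]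
  exact space_mem_degree (JoinSpace S.Pt T.Pt)

theorem isUnitalAlgebra_of_space {m : SpanFS K →ₗ[K] SpanFS K →ₗ[K] SpanFS K}
    (ha : ∀ S T U : FinTopology, m (m (space K S.Pt) (space K T.Pt)) (space K U.Pt) =
      m (space K S.Pt) (m (space K T.Pt) (space K U.Pt)))
    (h1 : ∀ T : FinTopology, m (one K) (space K T.Pt) = space K T.Pt)
    (h2 : ∀ T : FinTopology, m (space K T.Pt) (one K) = space K T.Pt) :
    IsUnitalAlgebra m (one K) := by
  refine isUnitalAlgebra_iff.2 ⟨fun x y z => ?_, fun x => ?_, fun x => ?_⟩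
  · refine LinearMap.congr_fun (linearMap_ext (f := m.flip z ∘ₗ m.flip y)
      (g := m.flip (m y z)) fun S => ?_) x
    refine LinearMap.congr_fun (linearMap_ext (f := m.flip z ∘ₗ m (space K S.Pt))
      (g := m (space K S.Pt) ∘ₗ m.flip z) fun T => ?_) y
    exact LinearMap.congr_fun (linearMap_ext (f := m (m (space K S.Pt) (space K T.Pt)))
      (g := m (space K S.Pt) ∘ₗ m (space K T.Pt)) fun U => ha S T U) z
  · exact LinearMap.congr_fun (linearMap_ext (f := m (one K)) (g := LinearMap.id) h1) x
  · exact LinearMap.congr_fun (linearMap_ext (f := m.flip (one K)) (g := LinearMap.id) h2) x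

theorem isUnitalAlgebra_dot : IsUnitalAlgebra (dot K) (one K) := by
  refine isUnitalAlgebra_of_space (fun S T U => ?_) (fun T => ?_) (fun T => ?_)
  · rw [dot_space, dot_space, dot_space, dot_space]
    exact space_congr K (Homeomorph.sumAssoc _ _ _)
  · rw [← space_eq_one K PEmpty.{1}, dot_space]
    exact space_congr K (Homeomorph.emptySum _ _)
  · rw [← space_eq_one K PEmpty.{1}, dot_space]
    exact space_congr K (Homeomorph.sumEmpty _ _)

theorem isUnitalAlgebra_join : IsUnitalAlgebra (join K) (one K) := by
  refine isUnitalAlgebra_of_space (fun S T U => ?_) (fun T => ?_) (fun T => ?_)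
  · rw [join_space, join_space, join_space, join_space]
    exact space_congr K JoinSpace.assoc
  · rw [← space_eq_one K PEmpty.{1}, join_space]
    exact space_congr K JoinSpace.emptyJoin
  · rw [← space_eq_one K PEmpty.{1}, join_space]
    exact space_congr K JoinSpace.joinEmpty

theorem dot_comm (x y : SpanFS K) : dot K x y = dot K y x := by
  have : dot K = (dot K).flip := by
    refine linearMap_ext fun S => linearMap_ext fun T => ?_
    rw [LinearMap.flip_apply, dot_space, dot_space]
    exact space_congr K (Homeomorph.sumComm _ _)
  exact LinearMap.congr_fun₂ this x y

end SpanFS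

/-- The compatibility of an infinitesimal bialgebra can be checked on a spanning set. -/
theorem infinitesimal_of_span {K : Type u} [Field K] {A : Type v} [AddCommGroup A] [Module K A]
    {s : Set A} (hs : Submodule.span K s = ⊤) {m : A →ₗ[K] A →ₗ[K] A} {Δ : A →ₗ[K] A ⊗[K] A}
    (h : ∀ x ∈ s, ∀ y ∈ s, Δ (m x y) + x ⊗ₜ[K] y =
      (m x).rTensor A (Δ y) + (m.flip y).lTensor A (Δ x)) (x y : A) :
    Δ (m x y) = (m x).rTensor A (Δ y) + (m.flip y).lTensor A (Δ x) - x ⊗ₜ[K] y := by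
  rw [eq_sub_iff_add_eq]
  have hx : x ∈ Submodule.span K s := hs ▸ Submodule.mem_top
  have hy : y ∈ Submodule.span K s := hs ▸ Submodule.mem_top
  induction hx using Submodule.span_induction with
  | zero => simp
  | add a b _ _ ha hb =>
    simp only [map_add, LinearMap.add_apply, TensorProduct.add_tmul, LinearMap.rTensor_add]
    rw [add_add_add_comm, ha, hb]
    abel
  | smul c a _ ha =>
    simp only [map_smul, LinearMap.smul_apply, LinearMap.rTensor_smul, ← TensorProduct.smul_tmul',
      ← smul_add, ha]
  | mem x hx =>
    induction hy using Submodule.span_induction with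
    | zero => simp
    | add a b _ _ ha hb =>
      simp only [map_add, LinearMap.add_apply, TensorProduct.tmul_add, LinearMap.lTensor_add]
      rw [add_add_add_comm, ha, hb]
      abel
    | smul c a _ ha =>
      simp only [map_smul, LinearMap.smul_apply, LinearMap.lTensor_smul, TensorProduct.tmul_smul,
        ← smul_add, ha]
    | mem y hy => exact h x hx y hy

/-! ### The coproduct of open sets and its compatibilities -/

namespace SpanFS

variable {K : Type u} [Field K]

section Subspaces

variable {X : Type} [TopologicalSpace X] [Finite X]

theorem space_congr_set {s t : Set X} (h : s = t) : space K ↥s = space K ↥t :=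
  space_congr K (Homeomorph.setCongr h)

theorem space_univ : space K ↥(Set.univ : Set X) = space K X :=
  space_congr K (Homeomorph.Set.univ X)

theorem space_empty : space K ↥(∅ : Set X) = one K := space_eq_one K _

theorem space_compl_univ : space K ↥(Set.univᶜ : Set X) = one K := by
  rw [space_congr_set Set.compl_univ, space_empty]

theorem space_compl_empty : space K ↥(∅ᶜ : Set X) = space K X := by
  rw [space_congr_set Set.compl_empty, space_univ]

theorem space_image {s : Set X} (t : Set ↥s) :
    space K ↥t = space K ↥(Subtype.val '' t : Set X) :=
  space_congr K (Topology.IsEmbedding.subtypeVal.homeomorphImage t)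

open Classical in
-- Letting the sum run over all subsets, with zero for those that are not open, turns later changes
-- of index into bijections of power sets.
theorem comul_space_eq_sum [Fintype (Set X)] : comul K (space K X) =
    ∑ U : Set X, if IsOpen U then space K ↥Uᶜ ⊗ₜ[K] space K ↥U else 0 := by
  rw [comul_space, comulSpace]
  have : Finite (TopologicalSpace.Opens X) := Finite.of_injective _ SetLike.coe_injective
  have : Fintype (TopologicalSpace.Opens X) := Fintype.ofFinite _
  rw [finsum_eq_sum_of_fintype, ← Finset.sum_filter]
  refine Finset.sum_bij (fun O _ => (O : Set X)) (fun O _ => ?_) (fun O _ O' _ h => ?_)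
    (fun U hU => ?_) (fun O _ => rfl)
  · exact Finset.mem_filter.2 ⟨Finset.mem_univ _, O.isOpen⟩
  · exact SetLike.coe_injective h
  · exact ⟨⟨U, (Finset.mem_filter.1 hU).2⟩, Finset.mem_univ _, rfl⟩

/-- The sets that are open in the subspace `s`. -/
def OpenIn (s t : Set X) : Prop := t ⊆ s ∧ ∃ U, IsOpen U ∧ t = s ∩ U

open Classical in
-- Indexing by subsets of the ambient space avoids subspaces of subspaces when the coproduct is
-- iterated.
theorem comul_subspace_eq_sum [Fintype (Set X)] (s : Set X) : comul K (space K ↥s) =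
    ∑ t : Set X, if OpenIn s t then space K ↥(s \ t) ⊗ₜ[K] space K ↥t else 0 := by
  have : Fintype (Set ↥s) := Fintype.ofFinite _
  rw [comul_space_eq_sum, ← Finset.sum_filter, ← Finset.sum_filter]
  refine Finset.sum_bij' (fun W _ => Subtype.val '' W) (fun t _ => Subtype.val ⁻¹' t) ?_ ?_ ?_ ?_ ?_
  · intro W hW
    obtain ⟨U, hU, rfl⟩ := (Finset.mem_filter.1 hW).2
    refine Finset.mem_filter.2 ⟨Finset.mem_univ _, Subtype.coe_image_subset _ _, U, hU, ?_⟩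
    rw [Subtype.image_preimage_coe]
  · intro t ht
    obtain ⟨_, U, hU, rfl⟩ := (Finset.mem_filter.1 ht).2
    refine Finset.mem_filter.2 ⟨Finset.mem_univ _, U, hU, ?_⟩
    simp
  · intro W _
    exact Set.preimage_image_eq _ Subtype.val_injective
  · intro t ht
    rw [Subtype.image_preimage_coe]
    exact Set.inter_eq_right.2 (Finset.mem_filter.1 ht).2.1
  · intro W _
    rw [space_image W, space_image Wᶜ]
    refine congrArg (· ⊗ₜ[K] _) (space_congr_set ?_)
    rw [Set.image_compl_eq_range_sdiff_image Subtype.val_injective, Subtype.range_coe]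

end Subspaces

theorem comul_coassoc_space (X : Type) [TopologicalSpace X] [Finite X] :
    TensorProduct.assoc K _ _ _ ((comul K).rTensor _ (comul K (space K X))) =
      (comul K).lTensor _ (comul K (space K X)) := by
  classical
  have : Fintype (Set X) := Fintype.ofFinite _
  rw [comul_space_eq_sum, ← Finset.sum_filter, map_sum, map_sum, map_sum]
  simp only [LinearMap.rTensor_tmul, LinearMap.lTensor_tmul, comul_subspace_eq_sum,
    ← Finset.sum_filter, TensorProduct.sum_tmul, TensorProduct.tmul_sum, map_sum,
    TensorProduct.assoc_tmul]
  rw [Finset.sum_sigma', Finset.sum_sigma']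
  -- Both sums run over chains Q ⊆ O of open sets, with term Oᶜ ⊗ (O \ Q) ⊗ Q. The left one is
  -- indexed by U = Q and t = O \ Q, the right one by O and Q.
  refine Finset.sum_bij' (fun p _ => ⟨p.1 ∪ p.2, p.1⟩) (fun p _ => ⟨p.2, p.1 \ p.2⟩) ?_ ?_ ?_ ?_ ?_
  · rintro ⟨U, t⟩ h
    simp only [Finset.mem_sigma, Finset.mem_filter, Finset.mem_univ, true_and] at h ⊢
    obtain ⟨hU, ht, O, hO, rfl⟩ := h
    refine ⟨?_, Set.subset_union_left, U, hU, ?_⟩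
    · convert hU.union hO using 1
      ext x; by_cases hx : x ∈ U <;> simp [hx]
    · rw [Set.inter_eq_right.2 Set.subset_union_left]
  · rintro ⟨O, Q⟩ h
    simp only [Finset.mem_sigma, Finset.mem_filter, Finset.mem_univ, true_and] at h ⊢
    obtain ⟨hO, hQ, U, hU, rfl⟩ := h
    refine ⟨hO.inter hU, ?_, O, hO, ?_⟩
    · intro x hx; exact hx.2
    · ext x; simp only [Set.mem_sdiff, Set.mem_inter_iff, Set.mem_compl_iff]; tauto
  · rintro ⟨U, t⟩ h
    simp only [Finset.mem_sigma, Finset.mem_filter, Finset.mem_univ, true_and] at h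
    have : (U ∪ t) \ U = t := by
      rw [Set.union_sdiff_left]
      exact (Set.subset_compl_iff_disjoint_right.1 h.2.1).sdiff_eq_left
    simp [this]
  · rintro ⟨O, Q⟩ h
    simp only [Finset.mem_sigma, Finset.mem_filter, Finset.mem_univ, true_and] at h
    simp [Set.union_sdiff_cancel h.2.1]
  · rintro ⟨U, t⟩ h
    simp only [Finset.mem_sigma, Finset.mem_filter, Finset.mem_univ, true_and] at h
    have e1 : (U ∪ t) \ U = t := by
      rw [Set.union_sdiff_left]
      exact (Set.subset_compl_iff_disjoint_right.1 h.2.1).sdiff_eq_left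
    have e2 : Uᶜ \ t = (U ∪ t)ᶜ := by
      ext x; simp
    rw [space_congr_set e1, space_congr_set e2]

theorem counit_space_eq_zero {X : Type} [TopologicalSpace X] [Finite X] {s : Set X}
    (hs : s.Nonempty) : counit K (space K ↥s) = 0 := by
  have := hs.to_subtype
  exact counit_space_of_nonempty K _

theorem comul_counit_left_space (X : Type) [TopologicalSpace X] [Finite X] :
    TensorProduct.lid K _ ((counit K).rTensor _ (comul K (space K X))) = space K X := by
  classical
  have : Fintype (Set X) := Fintype.ofFinite _
  rw [comul_space_eq_sum, map_sum, map_sum, Finset.sum_eq_single Set.univ]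
  · rw [if_pos isOpen_univ, space_compl_univ, space_univ, LinearMap.rTensor_tmul,
      counit_one, TensorProduct.lid_tmul, one_smul]
  · intro U _ hU
    split_ifs
    · rw [LinearMap.rTensor_tmul, counit_space_eq_zero (Set.nonempty_compl.2 hU),
        TensorProduct.zero_tmul, map_zero]
    · simp
  · simp

theorem comul_counit_right_space (X : Type) [TopologicalSpace X] [Finite X] :
    TensorProduct.rid K _ ((counit K).lTensor _ (comul K (space K X))) = space K X := by
  classical
  have : Fintype (Set X) := Fintype.ofFinite _
  rw [comul_space_eq_sum, map_sum, map_sum, Finset.sum_eq_single ∅]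
  · rw [if_pos isOpen_empty, space_compl_empty, space_empty, LinearMap.lTensor_tmul,
      counit_one, TensorProduct.rid_tmul, one_smul]
  · intro U _ hU
    split_ifs
    · rw [LinearMap.lTensor_tmul, counit_space_eq_zero (Set.nonempty_iff_ne_empty.2 hU),
        TensorProduct.tmul_zero, map_zero]
    · simp
  · simp

theorem isCounitalCoalgebra : IsCounitalCoalgebra (comul K) (counit K) := by
  refine ⟨{ comul := comul K
            counit := counit K
            coassoc := linearMap_ext fun T => comul_coassoc_space T.Pt
            rTensor_counit_comp_comul := linearMap_ext fun T => ?_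
            lTensor_counit_comp_comul := linearMap_ext fun T => ?_ }, rfl, rfl⟩
  · apply (TensorProduct.lid K _).injective
    simpa using comul_counit_left_space (K := K) T.Pt
  · apply (TensorProduct.rid K _).injective
    simpa using comul_counit_right_space (K := K) T.Pt

theorem isGradedComul : IsGradedComul (degree K) (comul K) := by
  intro n x hx
  refine mapsTo_degree (f := comul K) (fun T hT => ?_) hx
  classical
  have : Fintype (Set T.Pt) := Fintype.ofFinite _
  rw [comul_space_eq_sum]
  refine Submodule.sum_mem _ fun U _ => ?_
  split_ifs
  · refine tmul_mem_tensorDegree ?_ (space_mem_degree _) (space_mem_degree _)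
    rw [← hT, add_comm, Nat.card_coe_set_eq, Nat.card_coe_set_eq, Set.ncard_add_ncard_compl]
  · exact Submodule.zero_mem _

theorem comul_one : comul K (one K) = one K ⊗ₜ one K :=
  IsGradedCoalgebra.comul_unit ⟨isConnectedGraded, isCounitalCoalgebra, isGradedComul⟩

section Products

variable (X Y : Type) [TopologicalSpace X] [TopologicalSpace Y] [Finite X] [Finite Y]

theorem space_subtype_sum (W : Set (X ⊕ Y)) : space K ↥W =
    dot K (space K ↥(Sum.inl ⁻¹' W : Set X)) (space K ↥(Sum.inr ⁻¹' W : Set Y)) := by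
  rw [dot_space]
  exact space_congr K (subtypeSumHomeomorph W)

theorem space_subtype_join (W : Set (JoinSpace X Y)) : space K ↥W =
    join K (space K ↥(Sum.inl ⁻¹' (W : Set (X ⊕ Y)) : Set X))
      (space K ↥(Sum.inr ⁻¹' (W : Set (X ⊕ Y)) : Set Y)) := by
  rw [join_space]
  exact space_congr K (subtypeJoinHomeomorph W)

/-- Open sets of a disjoint union are pairs of open sets, and each such set and its complement are
disjoint unions of their traces. -/
theorem comul_dot_space : comul K (dot K (space K X) (space K Y)) =
    tensorOp (dot K) (dot K) (comul K (space K X) ⊗ₜ comul K (space K Y)) := by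
  classical
  have : Fintype (Set X) := Fintype.ofFinite _
  have : Fintype (Set Y) := Fintype.ofFinite _
  have : Fintype (Set (X ⊕ Y)) := Fintype.ofFinite _
  rw [dot_space, comul_space_eq_sum, comul_space_eq_sum, comul_space_eq_sum,
    TensorProduct.sum_tmul, map_sum]
  simp only [TensorProduct.tmul_sum, map_sum]
  rw [← Fintype.sum_prod_type']
  refine Fintype.sum_equiv (Set.sumEquiv (α := X) (β := Y)).toEquiv _ _ fun W => ?_
  change _ = tensorOp (dot K) (dot K)
    ((if IsOpen (Sum.inl ⁻¹' W) then _ else 0) ⊗ₜ (if IsOpen (Sum.inr ⁻¹' W) then _ else 0))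
  by_cases h1 : IsOpen (Sum.inl ⁻¹' W) <;> by_cases h2 : IsOpen (Sum.inr ⁻¹' W)
  · rw [if_pos h1, if_pos h2, if_pos (isOpen_sum_iff.2 ⟨h1, h2⟩), tensorOp_tmul,
      space_subtype_sum X Y W, space_subtype_sum X Y Wᶜ]
    rfl
  all_goals simp [isOpen_sum_iff, h1, h2]

/-- Inclusion-exclusion: an open set of the join has empty trace on X or full trace on Y. The first
family gives the sum over the open sets of Y, the second that over the open sets of X, and the pair
(∅, Y) lying in both gives X ⊗ Y. -/
theorem comul_join_space : comul K (join K (space K X) (space K Y)) + space K X ⊗ₜ[K] space K Y =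
    (join K (space K X)).rTensor _ (comul K (space K Y)) +
      ((join K).flip (space K Y)).lTensor _ (comul K (space K X)) := by
  classical
  have : Fintype (Set X) := Fintype.ofFinite _
  have : Fintype (Set Y) := Fintype.ofFinite _
  have : Fintype (Set (JoinSpace X Y)) := Fintype.ofFinite _
  obtain ⟨-, one_join, join_one⟩ := isUnitalAlgebra_iff.1 (isUnitalAlgebra_join (K := K))
  let F : Set X → Set Y → SpanFS K ⊗[K] SpanFS K := fun U V =>
    join K (space K ↥Uᶜ) (space K ↥Vᶜ) ⊗ₜ join K (space K ↥U) (space K ↥V)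
  let e : Set (JoinSpace X Y) ≃ Set X × Set Y := (Set.sumEquiv (α := X) (β := Y)).toEquiv
  have h1 : comul K (join K (space K X) (space K Y)) = ∑ U : Set X, ∑ V : Set Y,
      if IsOpen U ∧ IsOpen V ∧ (U.Nonempty → V = Set.univ) then F U V else 0 := by
    rw [join_space, comul_space_eq_sum, ← Fintype.sum_prod_type']
    refine Fintype.sum_equiv e _ _ fun W => ?_
    refine if_congr isOpen_joinSpace_iff ?_ rfl
    rw [space_subtype_join X Y W, space_subtype_join X Y Wᶜ]
    rfl
  -- The inclusion-exclusion for a single pair (U, V): union plus intersection equals the sum of the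
  -- two families.
  have h2 : ∀ U V, (if IsOpen U ∧ IsOpen V ∧ (U.Nonempty → V = Set.univ) then F U V else 0) +
      (if U = ∅ then (if V = Set.univ then F U V else 0) else 0) =
      (if U = ∅ then (if IsOpen V then F U V else 0) else 0) +
      (if V = Set.univ then (if IsOpen U then F U V else 0) else 0) := by
    intro U V
    rcases U.eq_empty_or_nonempty with rfl | hU
    · by_cases hV : V = Set.univ
      · subst hV; simp
      · simp [hV]
    · by_cases hV : V = Set.univ
      · subst hV; simp [hU.ne_empty]
      · simp [hV, hU, hU.ne_empty]
  have h3 : ∀ c : Set X → Set Y → SpanFS K ⊗[K] SpanFS K,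
      (∑ U : Set X, ∑ V : Set Y, if U = ∅ then c U V else 0) = ∑ V : Set Y, c ∅ V := by
    intro c
    rw [Finset.sum_comm]
    simp
  have h4 := Finset.sum_congr (rfl : (Finset.univ : Finset (Set X)) = Finset.univ) fun U _ =>
    Finset.sum_congr (rfl : (Finset.univ : Finset (Set Y)) = Finset.univ) fun V _ => h2 U V
  simp only [Finset.sum_add_distrib, h3, ← h1, Finset.sum_ite_eq', Finset.mem_univ, if_true] at h4
  have hF1 : ∀ U, F U Set.univ = space K ↥Uᶜ ⊗ₜ join K (space K ↥U) (space K Y) := by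
    intro U
    simp only [F, space_compl_univ, space_univ, join_one]
  have hF2 : ∀ V, F ∅ V = join K (space K X) (space K ↥Vᶜ) ⊗ₜ space K ↥V := by
    intro V
    simp only [F, space_compl_empty, space_empty, one_join]
  have hF3 : F ∅ Set.univ = space K X ⊗ₜ space K Y := by
    simp only [hF2, space_compl_univ, space_univ, join_one]
  rw [hF3] at h4
  simp only [hF1, hF2] at h4
  rw [h4, comul_space_eq_sum, comul_space_eq_sum, map_sum, map_sum]
  refine congrArg₂ _ (Finset.sum_congr rfl fun V _ => ?_) (Finset.sum_congr rfl fun V _ => ?_)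
  · split_ifs <;> simp
  · split_ifs <;> simp

theorem counit_dot_space : counit K (dot K (space K X) (space K Y)) =
    counit K (space K X) * counit K (space K Y) := by
  rw [dot_space]
  rcases isEmpty_or_nonempty X with hX | hX
  · rw [space_congr K (Homeomorph.emptySum Y X), space_eq_one K X, counit_one, one_mul]
  · rw [counit_space_of_nonempty K X, counit_space_of_nonempty, zero_mul]

end Products

theorem comul_dot (x y : SpanFS K) :
    comul K (dot K x y) = tensorOp (dot K) (dot K) (comul K x ⊗ₜ comul K y) := by
  refine LinearMap.congr_fun (linearMap_ext (f := comul K ∘ₗ (dot K).flip y)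
    (g := tensorOp (dot K) (dot K) ∘ₗ (TensorProduct.mk K _ _).flip (comul K y) ∘ₗ comul K)
    fun S => ?_) x
  exact LinearMap.congr_fun (linearMap_ext (f := comul K ∘ₗ dot K (space K S.Pt))
    (g := tensorOp (dot K) (dot K) ∘ₗ TensorProduct.mk K _ _ (comul K (space K S.Pt)) ∘ₗ comul K)
    fun T => comul_dot_space S.Pt T.Pt) y

theorem span_space : Submodule.span K (Set.range fun T : FinTopology => space K T.Pt) = ⊤ := by
  refine Submodule.eq_top_iff'.2 fun x => ?_
  have hx : x ∈ ⨆ n, degree K n :=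
    (isInternal_degree (K := K)).submodule_iSup_eq_top ▸ Submodule.mem_top
  have hle : ⨆ n, degree K n ≤
      Submodule.span K (Set.range fun T : FinTopology => space K T.Pt) :=
    iSup_le fun n => degree_le_iff.2 fun T _ => Submodule.subset_span ⟨T, rfl⟩
  exact hle hx

theorem comul_join (x y : SpanFS K) : comul K (join K x y) =
    (join K x).rTensor _ (comul K y) + ((join K).flip y).lTensor _ (comul K x) - x ⊗ₜ[K] y := by
  refine infinitesimal_of_span span_space ?_ x y
  rintro _ ⟨S, rfl⟩ _ ⟨T, rfl⟩
  exact comul_join_space S.Pt T.Pt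

theorem counit_dot (x y : SpanFS K) : counit K (dot K x y) = counit K x * counit K y := by
  have key : (dot K).compr₂ (counit K) = (LinearMap.mul K K).compl₁₂ (counit K) (counit K) :=
    linearMap_ext fun S => linearMap_ext fun T => counit_dot_space S.Pt T.Pt
  exact LinearMap.congr_fun₂ key x y

theorem isGradedHopf_dot :
    IsGradedHopf (degree K) (dot K) (one K) (comul K) (counit K) :=
  isGradedHopf_of_connected isConnectedGraded isUnitalAlgebra_dot isCounitalCoalgebra
    isGradedMul_dot isGradedComul comul_one comul_dot counit_dot

theorem isInfinitesimalBialgebra_join :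
    IsInfinitesimalBialgebra (degree K) (join K) (one K) (comul K) (counit K) :=
  ⟨isConnectedGraded, isUnitalAlgebra_join, isCounitalCoalgebra, isGradedMul_join, isGradedComul,
    comul_join⟩

end SpanFS

/-! ### Assembly of the theorem -/

/-- A graded connected Hopf algebra whose coproduct is part of an infinitesimal bialgebra is the
enveloping algebra of a `B_∞`-algebra, is cofree, and carries a shuffle structure with the same
coproduct and an unshuffle structure with the product of the infinitesimal bialgebra. -/
theorem IsInfinitesimalBialgebra.structure_theorem {K : Type u} [Field K] {A : Type u}
    [AddCommGroup A] [Module K A] {𝒜 : ℕ → Submodule K A} {m m' : A →ₗ[K] A →ₗ[K] A} {e : A}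
    {Δ : A →ₗ[K] A ⊗[K] A} {ε : A →ₗ[K] K} (h : IsInfinitesimalBialgebra 𝒜 m e Δ ε)
    (h' : IsGradedHopf 𝒜 m' e Δ ε) :
    (∃ mV, IsBInfinityAlgebra (primitivesDegree 𝒜 e Δ) mV ∧
      ∃ φ : TensorAlgebra K (primitives e Δ) ≃ₗ[K] A,
        IsBInfinityEnvelopingIso (V := primitives e Δ) (primitivesDegree 𝒜 e Δ) mV
          𝒜 m' e Δ ε φ ∧
        ∀ x, φ (TensorAlgebra.ι K x) = x) ∧
    IsCofree.{u, u, w} 𝒜 e Δ ε ∧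
    (∃ shuffle prec succ, IsShuffleBialgebra 𝒜 shuffle prec succ e Δ ε) ∧
    ∃ δ dprec dsucc, IsUnshuffleBialgebra 𝒜 m e δ dprec dsucc ε := by
  have hm := isUnitalAlgebra_iff.1 h.algebra
  obtain ⟨C, rfl, rfl⟩ := h.coalgebra
  -- The infinitesimal product becomes the ring multiplication of A, while the Hopf product `m'`
  -- remains a bare bilinear map.
  let R := ringOfMul m e hm
  let Al := algebraOfMul m e hm
  let C' : @Coalgebra K A _ R.toAddCommGroup.toAddCommMonoid Al.toModule := C
  have H : InfCompat K A 𝒜 := h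
  exact ⟨H.exists_bInfinity (m := m') h', H.isCofree,
    ⟨_, _, _, H.isShuffleBialgebra⟩, H.exists_unshuffleBialgebra⟩

theorem mainTheorem1 (K : Type u) [Field K] :
    -- the sum and the coproduct define a commutative Hopf algebra
    (IsGradedHopf (SpanFS.degree K) (SpanFS.dot K) (SpanFS.one K) (SpanFS.comul K)
        (SpanFS.counit K) ∧
      ∀ x y, SpanFS.dot K x y = SpanFS.dot K y x) ∧
    -- the join and the coproduct define an infinitesimal bialgebra
    IsInfinitesimalBialgebra (SpanFS.degree K) (SpanFS.join K) (SpanFS.one K) (SpanFS.comul K)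
      (SpanFS.counit K) ∧
    -- the Hopf algebra is the enveloping algebra of a `B_∞`-algebra structure on the space of its
    -- primitive elements
    (∃ mV, IsBInfinityAlgebra
        (primitivesDegree (SpanFS.degree K) (SpanFS.one K) (SpanFS.comul K)) mV ∧
      ∃ φ : TensorAlgebra K (primitives (SpanFS.one K) (SpanFS.comul K)) ≃ₗ[K] SpanFS K,
        IsBInfinityEnvelopingIso (V := primitives (SpanFS.one K) (SpanFS.comul K))
          (primitivesDegree (SpanFS.degree K) (SpanFS.one K) (SpanFS.comul K)) mV
          (SpanFS.degree K) (SpanFS.dot K) (SpanFS.one K) (SpanFS.comul K) (SpanFS.counit K) φ ∧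
        ∀ x, φ (TensorAlgebra.ι K x) = x) ∧
    -- it is cofree as a coalgebra
    IsCofree.{u, u, w} (SpanFS.degree K) (SpanFS.one K) (SpanFS.comul K) (SpanFS.counit K) ∧
    -- there is a shuffle bialgebra structure with the same coproduct
    (∃ shuffle prec succ, IsShuffleBialgebra (SpanFS.degree K) shuffle prec succ (SpanFS.one K)
      (SpanFS.comul K) (SpanFS.counit K)) ∧
    -- there is an unshuffle bialgebra structure whose product is the join
    (∃ δ dprec dsucc, IsUnshuffleBialgebra (SpanFS.degree K) (SpanFS.join K) (SpanFS.one K)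
      δ dprec dsucc (SpanFS.counit K)) := by
  exact ⟨⟨SpanFS.isGradedHopf_dot, SpanFS.dot_comm⟩, SpanFS.isInfinitesimalBialgebra_join,
    SpanFS.isInfinitesimalBialgebra_join.structure_theorem SpanFS.isGradedHopf_dot⟩
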